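/- **Conventions.** Let $\mathcal C$ be a category with pullbacks and with two classes of morphisms, fibrations (stable under base change) and cofibrations. Let $\mathbb M\colon\mathcal C^{op}\to\mathrm{Grpd}$ be the pseudo-functor that sends $X$ to the groupoid core $(\mathcal C_{/X})^{\simeq}$, with reindexing by pullback, and $\mathbb F\mathrm{ib}\subseteq\mathbb M$ the full sub-pseudo-functor on the fibrations. A morphism $\mathbb X\to\mathbb Y$ of pseudo-functors $\mathcal C^{op}\to\mathrm{Grpd}$ (a pseudo-natural transformation) is an *acyclic fibration* if it has the right lifting property against $\mathcal C(-,A)\to\mathcal C(-,B)$ for every cofibration $A\to B$, where squares and fillers commute up to coherent invertible modifications. A *locally representable and relatively acyclic notion of fibred structure covering all fibrations* (LPaRANoFScaF) on $\mathcal C$ consists of a pseudo-functor $\mathbb F\colon\mathcal C^{op}\to\mathrm{Grpd}$ and a morphism $\mathbb F\to\mathbb M$ such that * each component $\mathbb F(X)\to\mathbb M(X)$ is a discrete fibration, and its fibres are small sets; * for every object $Z$ and every morphism $\mathcal C(-,Z)\to\mathbb M$, the pseudo-pullback of $\mathbb F\to\mathbb M$ along it is representable; * the image of $\mathbb F\to\mathbb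 M$ is precisely $\mathbb F\mathrm{ib}$; * the resulting morphism $\mathbb F\to\mathbb F\mathrm{ib}$ is an acyclic fibration. Let $\mathcal M$ be a model category. A *filter of subterminal objects* is a non-empty, upwards closed and downwards directed set $\Phi$ of subobjects of the terminal object. It is a *model filter* if every $U\in\Phi$ is fibrant and if $f\times U$ is a cofibration (a weak equivalence) whenever $f$ is one and $U\in\Phi$. The *filter quotient* $\mathcal M_\Phi$ has the objects of $\mathcal M$, and $$\mathcal M_\Phi(X,Y)=\Big(\coprod_{U\in\Phi}\mathcal M(X\times U,Y)\Big)\big/\!\sim,$$ where $f\colon X\times U\to Y$ and $g\colon X\times V\to Y$ are identified if they agree on $X\times W$ for some $W\in\Phi$ with $W\le U,V$. A morphism of $\mathcal M_\Phi$ is a fibration (a cofibration) if for some $U\in\Phi$ it has a representative $f\colon X\times U\to Y$ whose induced map $X\times U\to Y\times U$ over $U$ is a fibration (a cofibration) of $\mathcal M$. For a pseudo-functor $\mathbb F\colon\mathcal M^{op}\to\mathrm{Grpd}$ with Grothendieck construction $\int\mathbb F\to\mathcal M$, let $(\int\mathbb F)_\Phi$ be the category with the objects $(A,x)$ of $\int\mathbb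 F$ and $$\mathrm{Hom}\big((A,x),(B,y)\big)=\operatorname{colim}_{U\in\Phi}\mathrm{Hom}_{\int\mathbb F}\big((A\times U,\,x|_{A\times U}),(B,y)\big),$$ where $x|_{A\times U}$ is the reindexing of $x$ along the projection $A\times U\to A$. This is the filtered colimit of the full subcategories $(\int\mathbb F)_U\subseteq\int\mathbb F$ on the objects whose base maps to $U$, along the restriction functors, and it is fibred over $\mathcal M_\Phi$. The *induced pseudo-functor* $\mathbb F_\Phi\colon\mathcal M_\Phi^{op}\to\mathrm{Grpd}$ is the pseudo-functor associated to the fibration $(\int\mathbb F)_\Phi\to\mathcal M_\Phi$; it is determined up to equivalence. A morphism $\mathbb F\to\mathbb M$ induces a functor $\int\mathbb F\to\mathcal M^{\to}$ and hence a functor $(\int\mathbb F)_\Phi\to(\mathcal M_\Phi)^{\to}$ over $\mathcal M_\Phi$, that is, a morphism from $\mathbb F_\Phi$ to the pseudo-functor $\mathbb M$ of $\mathcal M_\Phi$. **Proposition.** Let $\mathcal M$ be a locally Cartesian closed model category, meaning that every pullback functor $f^*\colon\mathcal M_{/Y}\to\mathcal M_{/X}$ has a right adjoint. Let $\mathbb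 F\to\mathbb M$ be an LPaRANoFScaF on $\mathcal M$, and let $\Phi$ be a (small) model filter on $\mathcal M$. Then the induced pseudo-functor $\mathbb F_\Phi$, with its induced morphism to the pseudo-functor $\mathbb M$ of $\mathcal M_\Phi$, is an LPaRANoFScaF on $\mathcal M_\Phi$. Precisely: there is an LPaRANoFScaF $\mathbb G$ on $\mathcal M_\Phi$ together with an equivalence of categories $\int\mathbb G\simeq(\int\mathbb F)_\Phi$ that commutes, up to natural isomorphism, with the functors to $(\mathcal M_\Phi)^{\to}$ (and hence with the projections to $\mathcal M_\Phi$). -/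

import Mathlib

open CategoryTheory Limits HomotopicalAlgebra Opposite
open scoped Pseudofunctor.StrongTrans Bicategory
universe w v u

noncomputable section
namespace FilterModel

section Codomain
variable {C : Type u} [Category.{v} C]

/-- The total space of an object of the groupoid `(C/X)^≃`. -/
def dom (X : C) : Core (Over X) ⥤ C := Core.inclusion _ ⋙ Over.forget X

/-- The structure map of an object of the groupoid `(C/X)^≃`. -/
def arr {X : C} (p : Core (Over X)) : (dom X).obj p ⟶ X := p.of.hom

lemma dom_map_arr {X : C} {p q : Core (Over X)} (h : p ⟶ q) :
    (dom X).map h ≫ arr q = arr p := Over.w h.iso.hom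

lemma dom_ext {X : C} {p q : Core (Over X)} {a b : p ⟶ q}
    (h : (dom X).map a = (dom X).map b) : a = b :=
  Core.hom_ext (Over.OverMorphism.ext h)

/-- An isomorphism of slices, as a morphism of the groupoid of slices. -/
def coreIsoMk {X : C} {p q : Core (Over X)} (e : (dom X).obj p ≅ (dom X).obj q)
    (h : e.hom ≫ arr q = arr p) : p ≅ q :=
  Core.isoMk (Over.isoMk e h)

lemma dom_map_coreIsoMk {X : C} {p q : Core (Over X)} (e : (dom X).obj p ≅ (dom X).obj q)
    (h : e.hom ≫ arr q = arr p) : (dom X).map (coreIsoMk e h).hom = e.hom := rfl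

variable [HasPullbacks C]

/-- Reindexing along `f` on groupoids of slices: the pullback functor, restricted to
isomorphisms. -/
def reindex {X Y : C} (f : X ⟶ Y) : Core (Over Y) ⥤ Core (Over X) :=
  (Over.pullback f).core

/-- The projection from the pullback of `p` along `f` to the total space of `p`. -/
def proj {X Y : C} (f : X ⟶ Y) (p : Core (Over Y)) :
    (dom X).obj ((reindex f).obj p) ⟶ (dom Y).obj p := pullback.fst p.of.hom f

lemma proj_isPullback {X Y : C} (f : X ⟶ Y) (p : Core (Over Y)) :
    IsPullback (proj f p) (arr ((reindex f).obj p)) (arr p) f :=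
  IsPullback.of_hasPullback p.of.hom f

lemma reindex_ext {X Y : C} {f : X ⟶ Y} {p : Core (Over Y)} {q : Core (Over X)}
    {a b : q ⟶ (reindex f).obj p}
    (h : (dom X).map a ≫ proj f p = (dom X).map b ≫ proj f p) : a = b :=
  dom_ext ((proj_isPullback f p).hom_ext h (by rw [dom_map_arr, dom_map_arr]))

lemma reindex_map_proj {X Y : C} (f : X ⟶ Y) {p q : Core (Over Y)} (h : p ⟶ q) :
    (dom X).map ((reindex f).map h) ≫ proj f q = proj f p ≫ (dom Y).map h :=
  pullback.lift_fst _ _ _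

instance (X : C) (p : Core (Over X)) : IsIso (proj (𝟙 X) p) :=
  (proj_isPullback (𝟙 X) p).isIso_fst_of_isIso

/-- Reindexing along an identity is isomorphic to the identity. -/
def reindexId (X : C) : reindex (𝟙 X) ≅ 𝟭 (Core (Over X)) :=
  NatIso.ofComponents
    (fun p ↦ coreIsoMk (asIso (proj (𝟙 X) p))
      ((proj_isPullback (𝟙 X) p).w.trans (Category.comp_id _)))
    (fun {p q} h ↦ dom_ext (by
      refine ((dom X).map_comp _ _).trans ((reindex_map_proj (𝟙 X) h).trans ?_)
      exact ((dom X).map_comp (coreIsoMk (asIso (proj (𝟙 X) p)) _).hom h).symm))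

lemma reindexId_proj {X : C} (p : Core (Over X)) :
    (dom X).map ((reindexId X).hom.app p) = proj (𝟙 X) p := rfl

/-- The canonical isomorphism between a pullback along `f ≫ g` and an iterated pullback. -/
def reindexCompIso {X Y Z : C} (f : X ⟶ Y) (g : Y ⟶ Z) (p : Core (Over Z)) :
    (reindex (f ≫ g)).obj p ≅ (reindex f).obj ((reindex g).obj p) :=
  coreIsoMk
    (IsPullback.isoIsPullback _ _ (proj_isPullback (f ≫ g) p)
      ((proj_isPullback f ((reindex g).obj p)).paste_horiz (proj_isPullback g p)))
    (IsPullback.isoIsPullback_hom_snd _ _ _ _)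

lemma reindexCompIso_proj {X Y Z : C} (f : X ⟶ Y) (g : Y ⟶ Z) (p : Core (Over Z)) :
    (dom X).map (reindexCompIso f g p).hom ≫ proj f ((reindex g).obj p) ≫ proj g p =
      proj (f ≫ g) p :=
  IsPullback.isoIsPullback_hom_fst _ _ _ _

lemma reindex_ext₂ {X Y Z : C} {f : X ⟶ Y} {g : Y ⟶ Z} {p : Core (Over Z)} {q : Core (Over X)}
    {a b : q ⟶ (reindex f).obj ((reindex g).obj p)}
    (h : (dom X).map a ≫ proj f _ ≫ proj g p = (dom X).map b ≫ proj f _ ≫ proj g p) : a = b :=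
  dom_ext (((proj_isPullback f _).paste_horiz (proj_isPullback g p)).hom_ext h
    (by rw [dom_map_arr, dom_map_arr]))

/-- Reindexing along a composition is isomorphic to the composition of the reindexings. -/
def reindexComp {X Y Z : C} (f : X ⟶ Y) (g : Y ⟶ Z) :
    reindex (f ≫ g) ≅ reindex g ⋙ reindex f :=
  NatIso.ofComponents (reindexCompIso f g)
    (fun {p q} h ↦ reindex_ext₂ (by
      have e : (dom X).map ((reindex f).map ((reindex g).map h)) ≫ proj f _ ≫ proj g q =
          proj f _ ≫ proj g p ≫ (dom Z).map h := by
        rw [reassoc_of% reindex_map_proj f, reindex_map_proj g]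
      calc (dom X).map ((reindex (f ≫ g)).map h ≫ (reindexCompIso f g q).hom) ≫
            proj f _ ≫ proj g q
          = (dom X).map ((reindex (f ≫ g)).map h) ≫ proj (f ≫ g) q := by
            rw [Functor.map_comp, Category.assoc, reindexCompIso_proj]
        _ = ((dom X).map (reindexCompIso f g p).hom ≫ proj f _ ≫ proj g p) ≫ (dom Z).map h := by
            rw [reindex_map_proj, reindexCompIso_proj]
        _ = (dom X).map ((reindexCompIso f g p).hom ≫ (reindex f).map ((reindex g).map h)) ≫
            proj f _ ≫ proj g q := by
            rw [Functor.map_comp]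
            simp only [Category.assoc]
            rw [e]))

lemma reindexComp_hom_proj {X Y Z : C} (f : X ⟶ Y) (g : Y ⟶ Z) (p : Core (Over Z)) :
    (dom X).map ((reindexComp f g).hom.app p) ≫ proj f ((reindex g).obj p) ≫ proj g p =
      proj (f ≫ g) p :=
  reindexCompIso_proj f g p

lemma reindexComp_inv_proj {X Y Z : C} (f : X ⟶ Y) (g : Y ⟶ Z) (p : Core (Over Z)) :
    (dom X).map ((reindexComp f g).inv.app p) ≫ proj (f ≫ g) p =
      proj f ((reindex g).obj p) ≫ proj g p := by
  have : (dom X).map ((reindexComp f g).inv.app p) ≫ (dom X).map ((reindexComp f g).hom.app p)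
      = 𝟙 _ := by
    rw [← Functor.map_comp, Iso.inv_hom_id_app]; exact (dom X).map_id _
  rw [← reindexComp_hom_proj f g p]
  exact (reassoc_of% this) _

lemma eqToHom_proj {X Y : C} {f f' : X ⟶ Y} (h : f = f') (p : Core (Over Y))
    (e : (reindex f).toCatHom = (reindex f').toCatHom) :
    (dom X).map ((eqToHom e).toNatTrans.app p) ≫ proj f' p = proj f p := by
  subst h
  exact (congrArg (· ≫ proj f p) ((dom X).map_id _)).trans (Category.id_comp _)

lemma reindex_assoc_proj {A B D E : C} (f : B ⟶ A) (g : D ⟶ B) (h : E ⟶ D) (p : Core (Over A)) :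
    (dom E).map ((reindexComp h (g ≫ f)).hom.app p ≫ (reindex h).map ((reindexComp g f).hom.app p) ≫
      𝟙 _ ≫ (reindexComp h g).inv.app ((reindex f).obj p) ≫ (reindexComp (h ≫ g) f).inv.app p) ≫
        proj ((h ≫ g) ≫ f) p = proj (h ≫ g ≫ f) p := by
  simp only [Functor.map_comp, Category.id_comp, Category.assoc]
  rw [reindexComp_inv_proj, reassoc_of% reindexComp_inv_proj h g]
  have e : (dom E).map ((reindex h).map ((reindexComp g f).hom.app p)) ≫
      proj h _ ≫ proj g _ ≫ proj f p = proj h _ ≫ proj (g ≫ f) p := by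
    rw [← reindexComp_hom_proj g f p]
    exact (reassoc_of% reindex_map_proj h ((reindexComp g f).hom.app p)) _
  exact (congrArg (_ ≫ ·) e).trans (reindexComp_hom_proj h (g ≫ f) p)

lemma reindex_left_proj {X Y : C} (f : X ⟶ Y) (p : Core (Over Y)) :
    (dom X).map ((reindexComp f (𝟙 Y)).hom.app p ≫ (reindex f).map ((reindexId Y).hom.app p) ≫
      𝟙 _) ≫ proj f p = proj (f ≫ 𝟙 Y) p := by
  rw [← reindexComp_hom_proj f (𝟙 Y), Category.comp_id ((reindex f).map _), Functor.map_comp,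
    Category.assoc]
  exact congrArg ((dom X).map _ ≫ ·) (reindex_map_proj f _)

lemma reindex_right_proj {X Y : C} (f : X ⟶ Y) (p : Core (Over Y)) :
    (dom X).map ((reindexComp (𝟙 X) f).hom.app p ≫ (reindexId X).hom.app ((reindex f).obj p) ≫
      𝟙 _) ≫ proj f p = proj (𝟙 X ≫ f) p := by
  rw [← reindexComp_hom_proj (𝟙 X) f, Category.comp_id ((reindexId X).hom.app _),
    Functor.map_comp, Category.assoc]
  rfl

/-- The pseudo-functor `X ↦ (C/X)^≃` that sends an object to the groupoid of all morphisms with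
that codomain, with reindexing by pullback. -/
def codomainPseudo (C : Type u) [Category.{v} C] [HasPullbacks C] :
    LocallyDiscrete Cᵒᵖ ⥤ᵖ Cat.{v, max u v} :=
  LocallyDiscrete.mkPseudofunctor
    (fun X ↦ Cat.of (Core (Over X.unop)))
    (fun f ↦ (reindex f.unop).toCatHom)
    (fun X ↦ Cat.Hom.isoMk (reindexId X.unop))
    (fun f g ↦ Cat.Hom.isoMk (reindexComp g.unop f.unop))
    (fun {A B D E} f g h ↦ by
      ext p
      exact reindex_ext ((reindex_assoc_proj f.unop g.unop h.unop p).trans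
        (eqToHom_proj (Category.assoc _ _ _).symm p _).symm))
    (fun {X Y} f ↦ by
      ext p
      exact reindex_ext ((reindex_left_proj f.unop p).trans
        (eqToHom_proj (Category.comp_id _) p _).symm))
    (fun {X Y} f ↦ by
      ext p
      exact reindex_ext ((reindex_right_proj f.unop p).trans
        (eqToHom_proj (Category.id_comp _) p _).symm))

section Fibrations
variable (C) [CategoryWithFibrations C]

/-- The property of being a fibration, on the objects of the groupoids `(C/X)^≃`. -/
def fibProperty : (codomainPseudo C).ObjectProperty where
  prop _ := fun p ↦ fibrations C (arr p)

instance [(fibrations C).IsStableUnderBaseChange] : (fibProperty C).IsClosedUnderMapObj where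
  map_obj {_ _ p} hp f := (fibrations C).of_isPullback (proj_isPullback f.as.unop p) hp

/-- The sub-pseudo-functor `𝔽ib` of `𝕄` of all fibrations. -/
abbrev fibPseudo [(fibrations C).IsStableUnderBaseChange] :
    LocallyDiscrete Cᵒᵖ ⥤ᵖ Cat.{v, max u v} :=
  (fibProperty C).fullsubcategory

end Fibrations

end Codomain

section Corestrict

variable {B : Type*} [Bicategory B] {F G : B ⥤ᵖ Cat.{v, u}} (P : G.ObjectProperty)
  [P.IsClosedUnderMapObj] (φ : F ⟶ G)

/-- The corestriction of a transformation to a full sub-pseudo-functor that contains its image. -/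
def corestrict (h : ∀ (X : B) (x : F.obj X), P.prop X ((φ.app X).toFunctor.obj x)) :
    F ⟶ P.fullsubcategory where
  app X := ((P.prop X).lift (φ.app X).toFunctor (h X)).toCatHom
  naturality {X Y} f := Cat.Hom.isoMk
    (((P.prop Y).fullyFaithfulι.whiskeringRight _).preimageIso
      (Cat.Hom.toNatIso (φ.naturality f)))
  naturality_naturality {X Y f g} η := by
    ext x
    have := congr($(φ.naturality_naturality η).toNatTrans.app x)
    apply (P.prop Y).hom_ext
    exact this
  naturality_id X := by
    ext x
    have := congr($(φ.naturality_id X).toNatTrans.app x)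
    apply (P.prop X).hom_ext
    exact this
  naturality_comp {X Y Z} f g := by
    ext x
    have := congr($(φ.naturality_comp f g).toNatTrans.app x)
    apply (P.prop Z).hom_ext
    exact this

end Corestrict

section Representable

variable {C : Type u} [Category.{v} C]

/-- The objects of the set `C(X, A)`, regarded as a discrete groupoid. -/
structure HomSet (X A : C) : Type (max u v) where
  /-- The underlying morphism. -/
  hom : X ⟶ A

/-- The only morphisms are the identities. -/
instance (X A : C) : Category.{v} (HomSet X A) where
  Hom f g := ULift.{v} (PLift (f.hom = g.hom))
  id _ := ⟨⟨rfl⟩⟩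
  comp h k := ⟨⟨h.down.down.trans k.down.down⟩⟩

/-- The set `C(X, A)` as a discrete groupoid. -/
abbrev HomGpd (X A : C) : Cat.{v, max u v} := Cat.of (HomSet X A)

instance {X A : C} (f g : HomSet X A) : Subsingleton (f ⟶ g) :=
  inferInstanceAs (Subsingleton (ULift (PLift (f.hom = g.hom))))

lemma HomGpd.hom_eq {X A : C} {f g : HomSet X A} (a b : f ⟶ g) : a = b := Subsingleton.elim _ _

/-- Equal morphisms are isomorphic objects of the discrete groupoid `C(X, A)`. -/
def HomGpd.isoOfEq {X A : C} {f g : HomSet X A} (h : f.hom = g.hom) : f ≅ g where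
  hom := ⟨⟨h⟩⟩
  inv := ⟨⟨h.symm⟩⟩

/-- A map of sets, as a functor between discrete groupoids. -/
def HomGpd.map {X A Y B : C} (t : (X ⟶ A) → (Y ⟶ B)) : HomSet X A ⥤ HomSet Y B where
  obj f := ⟨t f.hom⟩
  map h := ⟨⟨congrArg t h.down.down⟩⟩

/-- Pointwise equal functors to a discrete groupoid are isomorphic. -/
def HomGpd.natIso {D : Type*} [Category* D] {X A : C} {s t : D ⥤ HomSet X A}
    (h : ∀ f : D, (s.obj f).hom = (t.obj f).hom) : s ≅ t :=
  NatIso.ofComponents (fun f ↦ HomGpd.isoOfEq (h f)) (fun _ ↦ Subsingleton.elim _ _)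

lemma HomGpd.hom₂_eq {D : Cat.{v, max u v}} {X A : C} {s t : D ⟶ HomGpd X A} (a b : s ⟶ t) :
    a = b := by
  ext x
  exact HomGpd.hom_eq _ _

/-- The representable pseudo-functor `C(-, A)`, with values in discrete groupoids. -/
def yoPseudo (A : C) : LocallyDiscrete Cᵒᵖ ⥤ᵖ Cat.{v, max u v} :=
  LocallyDiscrete.mkPseudofunctor
    (fun X ↦ HomGpd X.unop A)
    (fun f ↦ (HomGpd.map (f.unop ≫ ·)).toCatHom)
    (fun _ ↦ Cat.Hom.isoMk (HomGpd.natIso (fun f ↦ Category.id_comp f.hom)))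
    (fun f g ↦ Cat.Hom.isoMk (HomGpd.natIso (fun h ↦ Category.assoc g.unop f.unop h.hom)))
    (fun _ _ _ ↦ HomGpd.hom₂_eq _ _)
    (fun _ ↦ HomGpd.hom₂_eq _ _)
    (fun _ ↦ HomGpd.hom₂_eq _ _)

/-- The map of representable pseudo-functors `C(-, A) ⟶ C(-, B)` given by `i : A ⟶ B`. -/
def yoMap {A B : C} (i : A ⟶ B) : yoPseudo A ⟶ yoPseudo B where
  app X := (HomGpd.map (X := X.as.unop) (Y := X.as.unop) (· ≫ i)).toCatHom
  naturality f := Cat.Hom.isoMk (HomGpd.natIso (fun g ↦ Category.assoc f.as.unop g.hom i))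
  naturality_naturality _ := HomGpd.hom₂_eq (A := B) _ _
  naturality_id _ := HomGpd.hom₂_eq (A := B) _ _
  naturality_comp _ _ := HomGpd.hom₂_eq (A := B) _ _

end Representable

/-- A 1-morphism `p` of a bicategory has the right lifting property against `i` if every square
`a ≫ p ≅ i ≫ b` that commutes up to an invertible 2-cell has a diagonal filler, up to invertible
2-cells that paste to the given one. -/
def HasRightLifting {𝓑 : Type*} [Bicategory 𝓑] {A B X Y : 𝓑} (i : A ⟶ B) (p : X ⟶ Y) : Prop :=
  ∀ (a : A ⟶ X) (b : B ⟶ Y) (θ : a ≫ p ≅ i ≫ b),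
    ∃ (l : B ⟶ X) (η : a ≅ i ≫ l) (ζ : l ≫ p ≅ b),
      θ.hom = η.hom ▷ p ≫ (α_ i l p).hom ≫ i ◁ ζ.hom

section FibredStructure

variable (C : Type u) [Category.{v} C]

variable {C} in
/-- A map of pseudo-functors is an acyclic fibration if it has the right lifting property against
`C(-, A) ⟶ C(-, B)` for all cofibrations `A ⟶ B`. -/
def IsAcyclicFibration [CategoryWithCofibrations C] {F G : LocallyDiscrete Cᵒᵖ ⥤ᵖ Cat.{v, max u v}}
    (φ : F ⟶ G) : Prop :=
  ∀ ⦃A B : C⦄ (i : A ⟶ B), cofibrations C i → HasRightLifting (yoMap i) φ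

/-- The component at an object of an invertible modification. -/
def isoApp {B D : Type*} [Bicategory B] [Bicategory D] {F G : B ⥤ᵖ D} {s t : F ⟶ G} (θ : s ≅ t)
    (X : B) : s.app X ≅ t.app X where
  hom := θ.hom.as.app X
  inv := θ.inv.as.app X
  hom_inv_id := congr(($θ.hom_inv_id).as.app X)
  inv_hom_id := congr(($θ.inv_hom_id).as.app X)

variable {C} in
/-- A square of pseudo-functors that commutes up to an invertible 2-cell exhibits its corner as the
pseudo-pullback, computed pointwise. -/
def IsPseudoPullback {P F G H : LocallyDiscrete Cᵒᵖ ⥤ᵖ Cat.{v, max u v}} (b : P ⟶ F) (r : P ⟶ G)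
    (φ : F ⟶ H) (a : G ⟶ H) (θ : b ≫ φ ≅ r ≫ a) : Prop :=
  ∀ X, ((CategoricalPullback.CatCommSqOver.toFunctorToCategoricalPullback
    (φ.app X).toFunctor (a.app X).toFunctor (P.obj X)).obj
      { fst := (b.app X).toFunctor
        snd := (r.app X).toFunctor
        iso := Cat.Hom.toNatIso (isoApp θ X) }).IsEquivalence

/-- A functor `p : E ⥤ B` is a discrete fibration if every morphism `b ⟶ p x` has a unique lift to
a morphism of `E` with codomain `x`. -/
def IsDiscreteFibration {E B : Type*} [Category* E] [Category* B] (p : E ⥤ B) : Prop :=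
  ∀ x : E, Function.Bijective (Over.post (X := x) p).obj

variable [HasPullbacks C]

/-- A notion of fibred structure: a pseudo-functor `F` with values in groupoids and a discrete
fibration `F ⟶ 𝕄` with small fibres. -/
structure FibredStructure where
  /-- The pseudo-functor of structures. -/
  toPseudofunctor : LocallyDiscrete Cᵒᵖ ⥤ᵖ Cat.{v, max u v}
  isGroupoid (X : LocallyDiscrete Cᵒᵖ) : IsGroupoid (toPseudofunctor.obj X)
  /-- The map that forgets the structure. -/
  toCodomain : toPseudofunctor ⟶ codomainPseudo C
  isDiscreteFibration (X : LocallyDiscrete Cᵒᵖ) :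
    IsDiscreteFibration (toCodomain.app X).toFunctor
  small_fibre (X : LocallyDiscrete Cᵒᵖ) (p : (codomainPseudo C).obj X) :
    Small.{w} {x : toPseudofunctor.obj X // (toCodomain.app X).toFunctor.obj x = p}

namespace FibredStructure

variable {C} (F : FibredStructure.{w} C)

/-- For every map `C(-, Z) ⟶ 𝕄`, the pseudo-pullback of `F ⟶ 𝕄` along it is representable. -/
def IsLocallyRepresentable : Prop :=
  ∀ (Z : C) (a : yoPseudo Z ⟶ codomainPseudo C),
    ∃ (R : C) (b : yoPseudo R ⟶ F.toPseudofunctor) (r : yoPseudo R ⟶ yoPseudo Z)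
      (θ : b ≫ F.toCodomain ≅ r ≫ a), IsPseudoPullback b r F.toCodomain a θ

/-- The image of `F ⟶ 𝕄` consists of precisely the fibrations. -/
def CoversFibrations [CategoryWithFibrations C] : Prop :=
  ∀ (X : LocallyDiscrete Cᵒᵖ) (p : (codomainPseudo C).obj X),
    (∃ x, (F.toCodomain.app X).toFunctor.obj x = p) ↔ (fibProperty C).prop X p

/-- The map `F ⟶ 𝔽ib`. -/
def toFib [CategoryWithFibrations C] [(fibrations C).IsStableUnderBaseChange]
    (h : F.CoversFibrations) : F.toPseudofunctor ⟶ fibPseudo C :=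
  corestrict (fibProperty C) F.toCodomain (fun X x ↦ (h X _).1 ⟨x, rfl⟩)

end FibredStructure

/-- A locally representable, relatively acyclic notion of fibred structure for all fibrations. -/
structure AcyclicFibredStructure [CategoryWithFibrations C] [CategoryWithCofibrations C]
    [(fibrations C).IsStableUnderBaseChange] extends FibredStructure.{w} C where
  isLocallyRepresentable : toFibredStructure.IsLocallyRepresentable
  coversFibrations : toFibredStructure.CoversFibrations
  isAcyclicFibration : IsAcyclicFibration (toFibredStructure.toFib coversFibrations)

end FibredStructure
section RestrictionSystem

universe v' u' t

lemma isPullback_of_exists {E : Type u'} [Category.{v'} E] {P X Y Z : E} {fst : P ⟶ X} {snd : P ⟶ Y}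
    {f : X ⟶ Z} {g : Y ⟶ Z} (w : fst ≫ f = snd ≫ g)
    (ex : ∀ {T : E} (a : T ⟶ X) (b : T ⟶ Y), a ≫ f = b ≫ g → ∃ l : T ⟶ P, l ≫ fst = a ∧ l ≫ snd = b)
    (un : ∀ {T : E} (m m' : T ⟶ P), m ≫ fst = m' ≫ fst → m ≫ snd = m' ≫ snd → m = m') :
    IsPullback fst snd f g :=
  ⟨⟨w⟩, ⟨PullbackCone.isLimitAux' _ fun s ↦
    ⟨(ex s.fst s.snd s.condition).choose, (ex s.fst s.snd s.condition).choose_spec.1,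
      (ex s.fst s.snd s.condition).choose_spec.2, fun {m} h₁ h₂ ↦ un m _
        (h₁.trans (ex s.fst s.snd s.condition).choose_spec.1.symm)
        (h₂.trans (ex s.fst s.snd s.condition).choose_spec.2.symm)⟩⟩⟩

set_option linter.unusedSectionVars false

/-- For each index `U`, a class of objects of `E` lying over `U`, closed under passing to the domain
of a morphism, such that each object `X` has a coreflection `res U X ⟶ X` (the restriction of `X`
to `U`) into the full subcategory of these objects. -/
structure RestrictionSystem (I : Type t) [Preorder I] (E : Type u') [Category.{v'} E] where
  /-- The predicate that an object lies over `U`. -/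
  IsOver : I → E → Prop
  isOver_of_hom {U : I} {Z Z' : E} : (Z ⟶ Z') → IsOver U Z' → IsOver U Z
  isOver_mono {U V : I} {Z : E} : U ≤ V → IsOver U Z → IsOver V Z
  /-- The restriction of an object to `U`. -/
  res : I → E → E
  isOver_res (U : I) (X : E) : IsOver U (res U X)
  /-- The counit of the coreflection. -/
  ι (U : I) (X : E) : res U X ⟶ X
  /-- The factorization through the coreflection. -/
  lift {U : I} {Z X : E} (h : IsOver U Z) (f : Z ⟶ X) : Z ⟶ res U X
  lift_ι {U : I} {Z X : E} (h : IsOver U Z) (f : Z ⟶ X) : lift h f ≫ ι U X = f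
  hom_ext {U : I} {Z X : E} (f g : Z ⟶ res U X) (h : f ≫ ι U X = g ≫ ι U X) : f = g

namespace RestrictionSystem

variable {I : Type t} [Preorder I] {E : Type u'} [Category.{v'} E]
  (R : RestrictionSystem I E)

/-- The map from the restriction to a smaller index to the restriction to a larger one. -/
def tr {W U : I} (h : W ≤ U) (X : E) : R.res W X ⟶ R.res U X :=
  R.lift (R.isOver_mono h (R.isOver_res W X)) (R.ι W X)

lemma tr_ι {W U : I} (h : W ≤ U) (X : E) : R.tr h X ≫ R.ι U X = R.ι W X := R.lift_ι _ _

lemma tr_tr {W V U : I} (h : W ≤ V) (h' : V ≤ U) (X : E) :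
    R.tr h X ≫ R.tr h' X = R.tr (h.trans h') X :=
  R.hom_ext _ _ (by rw [Category.assoc, tr_ι, tr_ι, tr_ι])

lemma tr_refl {U : I} (h : U ≤ U) (X : E) : R.tr h X = 𝟙 _ :=
  R.hom_ext _ _ (by rw [tr_ι, Category.id_comp])

/-- The map `f × U : X × U ⟶ Y × U` over `U` that is induced by a map `f : X × U ⟶ Y`, where
`X × U` is the restriction of `X` to `U`. -/
def ext {U : I} {X Y : E} (f : R.res U X ⟶ Y) : R.res U X ⟶ R.res U Y :=
  R.lift (R.isOver_res U X) f

lemma ext_ι {U : I} {X Y : E} (f : R.res U X ⟶ Y) : R.ext f ≫ R.ι U Y = f := R.lift_ι _ _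

/-- Two maps `X × U ⟶ Y` and `X × V ⟶ Y` are related if they agree on `X × W` for some
`W ≤ U, V`. -/
def Rel (X Y : E) (f g : Σ U, R.res U X ⟶ Y) : Prop :=
  ∃ (W : I) (h₁ : W ≤ f.1) (h₂ : W ≤ g.1), R.tr h₁ X ≫ f.2 = R.tr h₂ X ≫ g.2

variable [IsCodirectedOrder I]

/-- The equivalence relation that defines the morphisms of the filter quotient. -/
def setoid (X Y : E) : Setoid (Σ U, R.res U X ⟶ Y) where
  r := R.Rel X Y
  iseqv :=
    { refl f := ⟨f.1, le_rfl, le_rfl, rfl⟩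
      symm := fun ⟨W, h₁, h₂, h⟩ ↦ ⟨W, h₂, h₁, h.symm⟩
      trans := by
        rintro f g k ⟨W, h₁, h₂, h⟩ ⟨W', h₁', h₂', h'⟩
        obtain ⟨D, hD, hD'⟩ := exists_le_le W W'
        refine ⟨D, hD.trans h₁, hD'.trans h₂', ?_⟩
        rw [← R.tr_tr hD h₁, Category.assoc, h, ← Category.assoc, R.tr_tr,
          ← R.tr_tr hD' h₂', Category.assoc, ← h', ← Category.assoc, R.tr_tr] }

/-- The filter quotient of `E`, which has the same objects as `E`. -/
structure FilterQuotient (R : RestrictionSystem I E) where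
  /-- The underlying object. -/
  as : E

namespace FilterQuotient

variable {R}

/-- The morphisms `X ⟶ Y` of the filter quotient: equivalence classes of maps `X × U ⟶ Y`. -/
def Hom (X Y : FilterQuotient R) : Type (max t v') := Quotient (R.setoid X.as Y.as)

/-- The class of a map `X × U ⟶ Y`. -/
def cls {X Y : FilterQuotient R} (U : I) (f : R.res U X.as ⟶ Y.as) : Hom X Y := Quotient.mk _ ⟨U, f⟩

lemma cls_eq_iff {X Y : FilterQuotient R} {U V : I} (f : R.res U X.as ⟶ Y.as)
    (g : R.res V X.as ⟶ Y.as) :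
    cls U f = cls V g ↔ ∃ (W : I) (h₁ : W ≤ U) (h₂ : W ≤ V), R.tr h₁ _ ≫ f = R.tr h₂ _ ≫ g :=
  Quotient.eq (r := R.setoid X.as Y.as)

lemma cls_tr {X Y : FilterQuotient R} {U W : I} (h : W ≤ U) (f : R.res U X.as ⟶ Y.as) :
    cls W (R.tr h _ ≫ f) = cls U f :=
  (cls_eq_iff _ _).2 ⟨W, le_rfl, h, by rw [R.tr_refl, Category.id_comp]⟩

lemma exists_rep {X Y : FilterQuotient R} (f : Hom X Y) (U₀ : I) :
    ∃ (U : I) (_ : U ≤ U₀) (g : R.res U X.as ⟶ Y.as), f = cls U g := by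
  obtain ⟨⟨V, g⟩, rfl⟩ := Quotient.exists_rep f
  obtain ⟨W, hW, hW'⟩ := exists_le_le V U₀
  exact ⟨W, hW', R.tr hW _ ≫ g, (cls_tr hW g).symm⟩

/-- The composition of `f : X × U ⟶ Y` and `g : Y × V ⟶ Z`, over a common lower bound `W` of `U`
and `V`. -/
def compAt {X Y Z : E} {U V : I} (W : I) (h₁ : W ≤ U) (h₂ : W ≤ V) (f : R.res U X ⟶ Y)
    (g : R.res V Y ⟶ Z) : R.res W X ⟶ Z :=
  R.ext (R.tr h₁ X ≫ f) ≫ R.tr h₂ Y ≫ g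

lemma tr_ext {X Y : E} {U W : I} (h : W ≤ U) (f : R.res U X ⟶ Y) :
    R.tr h X ≫ R.ext f = R.ext (R.tr h X ≫ f) ≫ R.tr h Y :=
  R.hom_ext _ _ (by rw [Category.assoc, Category.assoc, R.ext_ι, R.tr_ι, R.ext_ι])

lemma tr_compAt {X Y Z : E} {U V W W' : I} (h₁ : W ≤ U) (h₂ : W ≤ V) (h : W' ≤ W)
    (f : R.res U X ⟶ Y) (g : R.res V Y ⟶ Z) :
    R.tr h X ≫ compAt W h₁ h₂ f g = compAt W' (h.trans h₁) (h.trans h₂) f g := by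
  unfold compAt
  rw [← Category.assoc, tr_ext, ← Category.assoc (R.tr h X), R.tr_tr, Category.assoc,
    ← Category.assoc (R.tr h Y), R.tr_tr]

/-- The composition of representatives. -/
def compAux {X Y Z : FilterQuotient R} (f : Σ U, R.res U X.as ⟶ Y.as)
    (g : Σ U, R.res U Y.as ⟶ Z.as) : Hom X Z :=
  have h := (exists_le_le f.1 g.1).choose_spec
  cls (exists_le_le f.1 g.1).choose (compAt _ h.1 h.2 f.2 g.2)

lemma compAux_eq {X Y Z : FilterQuotient R} (f : Σ U, R.res U X.as ⟶ Y.as)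
    (g : Σ U, R.res U Y.as ⟶ Z.as) {W : I} (h₁ : W ≤ f.1) (h₂ : W ≤ g.1) :
    compAux f g = cls W (compAt W h₁ h₂ f.2 g.2) := by
  obtain ⟨D, hD, hD'⟩ := exists_le_le (exists_le_le f.1 g.1).choose W
  exact (cls_eq_iff _ _).2 ⟨D, hD, hD', by rw [tr_compAt, tr_compAt]⟩

/-- Composition in the filter quotient. -/
def comp {X Y Z : FilterQuotient R} (f : Hom X Y) (g : Hom Y Z) : Hom X Z :=
  Quotient.liftOn₂ f g compAux (by
    rintro f g f' g' ⟨D, h₁, h₁', h⟩ ⟨D', h₂, h₂', h'⟩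
    obtain ⟨W, hW, hW'⟩ := exists_le_le D D'
    rw [compAux_eq f g (hW.trans h₁) (hW'.trans h₂),
      compAux_eq f' g' (hW.trans h₁') (hW'.trans h₂')]
    unfold compAt
    rw [← R.tr_tr hW h₁, ← R.tr_tr hW h₁', Category.assoc, h, Category.assoc,
      ← R.tr_tr hW' h₂, Category.assoc, h', ← R.tr_tr hW' h₂', Category.assoc])

lemma comp_cls {X Y Z : FilterQuotient R} {U V : I} (W : I) (h₁ : W ≤ U) (h₂ : W ≤ V)
    (f : R.res U X.as ⟶ Y.as) (g : R.res V Y.as ⟶ Z.as) :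
    comp (cls U f) (cls V g) = cls W (compAt W h₁ h₂ f g) :=
  compAux_eq ⟨U, f⟩ ⟨V, g⟩ h₁ h₂

lemma comp_cls_self {X Y Z : FilterQuotient R} {W : I}
    (f : R.res W X.as ⟶ Y.as) (g : R.res W Y.as ⟶ Z.as) :
    comp (cls W f) (cls W g) = cls W (R.ext f ≫ g) := by
  rw [comp_cls W le_rfl le_rfl, compAt, R.tr_refl, R.tr_refl, Category.id_comp, Category.id_comp]

variable [Nonempty I]

/-- The class of the map `X × U ⟶ Y` that is induced by a map `X ⟶ Y`. -/
def ofHom {X Y : E} (f : X ⟶ Y) : Hom (R := R) ⟨X⟩ ⟨Y⟩ :=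
  cls (Classical.arbitrary I) (R.ι _ X ≫ f)

lemma ofHom_eq {X Y : E} (f : X ⟶ Y) (U : I) :
    ofHom (R := R) f = cls (X := ⟨X⟩) (Y := ⟨Y⟩) U (R.ι U X ≫ f) := by
  obtain ⟨W, h, h'⟩ := exists_le_le (Classical.arbitrary I) U
  exact (cls_eq_iff _ _).2 ⟨W, h, h', by rw [← Category.assoc, ← Category.assoc, R.tr_ι, R.tr_ι]⟩

lemma ext_ι' (U : I) (X : E) : R.ext (R.ι U X) = 𝟙 _ :=
  R.hom_ext _ _ (by rw [R.ext_ι, Category.id_comp])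

lemma ext_comp_ext {U : I} {X Y Z : E} (f : R.res U X ⟶ Y) (g : R.res U Y ⟶ Z) :
    R.ext (R.ext f ≫ g) = R.ext f ≫ R.ext g :=
  R.hom_ext _ _ (by rw [R.ext_ι, Category.assoc, R.ext_ι])

instance : Category.{max t v'} (FilterQuotient R) where
  Hom := Hom
  id X := ofHom (𝟙 X.as)
  comp := comp
  id_comp {X Y} f := by
    obtain ⟨U, -, f, rfl⟩ := exists_rep f (Classical.arbitrary I)
    rw [ofHom_eq _ U, comp_cls_self, Category.comp_id, ext_ι', Category.id_comp]
  comp_id {X Y} f := by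
    obtain ⟨U, -, f, rfl⟩ := exists_rep f (Classical.arbitrary I)
    rw [ofHom_eq _ U, comp_cls_self, Category.comp_id, R.ext_ι]
  assoc {X Y Z T} f g k := by
    obtain ⟨U, -, f, rfl⟩ := exists_rep f (Classical.arbitrary I)
    obtain ⟨V, hV, g, rfl⟩ := exists_rep g U
    obtain ⟨W, hW, k, rfl⟩ := exists_rep k V
    rw [← cls_tr (hW.trans hV) f, ← cls_tr hW g, comp_cls_self, comp_cls_self, comp_cls_self,
      comp_cls_self, ext_comp_ext, Category.assoc]

/-- The class of a map `X × U ⟶ Y`, as a morphism of the filter quotient. -/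
def homMk {X Y : FilterQuotient R} (U : I) (f : R.res U X.as ⟶ Y.as) : X ⟶ Y := cls U f

lemma homMk_eq_iff {X Y : FilterQuotient R} {U V : I} (f : R.res U X.as ⟶ Y.as)
    (g : R.res V X.as ⟶ Y.as) :
    homMk U f = homMk V g ↔
      ∃ (W : I) (h₁ : W ≤ U) (h₂ : W ≤ V), R.tr h₁ _ ≫ f = R.tr h₂ _ ≫ g :=
  cls_eq_iff f g

lemma homMk_tr {X Y : FilterQuotient R} {U W : I} (h : W ≤ U) (f : R.res U X.as ⟶ Y.as) :
    homMk W (R.tr h _ ≫ f) = homMk U f := cls_tr h f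

lemma exists_homMk {X Y : FilterQuotient R} (f : X ⟶ Y) (U₀ : I) :
    ∃ (U : I) (_ : U ≤ U₀) (g : R.res U X.as ⟶ Y.as), f = homMk U g := exists_rep f U₀

lemma homMk_comp {X Y Z : FilterQuotient R} {W : I}
    (f : R.res W X.as ⟶ Y.as) (g : R.res W Y.as ⟶ Z.as) :
    homMk W f ≫ homMk W g = homMk W (R.ext f ≫ g) := comp_cls_self f g

lemma ofHom_comp {X Y Z : E} (f : X ⟶ Y) (g : Y ⟶ Z) :
    ofHom (R := R) (f ≫ g) = comp (ofHom f) (ofHom g) := by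
  have U : I := Classical.arbitrary I
  rw [ofHom_eq _ U, ofHom_eq f U, ofHom_eq g U, comp_cls_self]
  exact congrArg (cls (X := ⟨X⟩) (Y := ⟨Z⟩) U) ((Category.assoc _ _ _).symm.trans
    ((congrArg (· ≫ g) (R.ext_ι _).symm).trans (Category.assoc _ _ _)))

variable (R) in
/-- The projection functor to the filter quotient, which is the identity on objects. -/
def projection : E ⥤ FilterQuotient R where
  obj X := ⟨X⟩
  map f := ofHom f
  map_id _ := rfl
  map_comp f g := ofHom_comp f g

lemma projection_map {X Y : E} (f : X ⟶ Y) (U : I) :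
    (projection R).map f = homMk (X := ⟨X⟩) (Y := ⟨Y⟩) U (R.ι U X ≫ f) := ofHom_eq f U

lemma id_eq (X : FilterQuotient R) (U : I) : 𝟙 X = homMk U (R.ι U X.as) := by
  have := ofHom_eq (R := R) (𝟙 X.as) U
  rw [Category.comp_id] at this
  exact this

lemma homMk_comp_projection {X : FilterQuotient R} {Y Z : E} {U : I} (f : R.res U X.as ⟶ Y) (g : Y ⟶ Z) :
    homMk (Y := ⟨Y⟩) U f ≫ (projection R).map g = homMk (Y := ⟨Z⟩) U (f ≫ g) := by
  refine (congrArg (_ ≫ ·) (projection_map g U)).trans ?_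
  refine (homMk_comp (Y := ⟨Y⟩) (Z := ⟨Z⟩) f _).trans ?_
  exact congrArg (homMk (Y := ⟨Z⟩) U) ((Category.assoc _ _ _).symm.trans
    (congrArg (· ≫ g) (R.ext_ι f)))

/-- The map `X × U ⟶ X` becomes invertible. -/
instance isIso_projection_map_ι (U : I) (X : E) : IsIso ((projection R).map (R.ι U X)) := by
  refine ⟨⟨homMk (X := ⟨X⟩) (Y := ⟨R.res U X⟩) U (𝟙 _), ?_, ?_⟩⟩
  · refine (congrArg (· ≫ _) (projection_map _ U)).trans (Eq.trans ?_ (id_eq _ U).symm)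
    refine (homMk_comp (X := ⟨R.res U X⟩) (Y := ⟨X⟩) (Z := ⟨R.res U X⟩) _ _).trans ?_
    refine congrArg (homMk (X := ⟨R.res U X⟩) (Y := ⟨R.res U X⟩) U) ?_
    exact (Category.comp_id _).trans (R.hom_ext _ _ (R.ext_ι _))
  · refine (homMk_comp_projection (X := ⟨X⟩) _ _).trans (Eq.trans ?_ (id_eq _ U).symm)
    exact congrArg (homMk (X := ⟨X⟩) (Y := ⟨X⟩) U) (Category.id_comp _)

lemma projection_ι_comp_homMk {X Y : FilterQuotient R} (U : I) (f : R.res U X.as ⟶ Y.as) :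
    (projection R).map (R.ι U X.as) ≫ homMk U f = (projection R).map f := by
  refine (congrArg (· ≫ _) (projection_map _ U)).trans (Eq.trans ?_ (projection_map _ U).symm)
  refine (homMk_comp (X := ⟨R.res U X.as⟩) (Y := X) _ _).trans ?_
  refine congrArg (homMk (X := ⟨R.res U X.as⟩) (Y := Y) U) (congrArg (· ≫ f) ?_)
  exact R.hom_ext _ _ (R.ext_ι _)

/-- A functor that inverts the maps `X × U ⟶ X` factors through the filter quotient. -/
def liftMap {D : Type*} [Category* D] (G : E ⥤ D) [∀ U X, IsIso (G.map (R.ι U X))]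
    {X Y : FilterQuotient R} (f : X ⟶ Y) : G.obj X.as ⟶ G.obj Y.as :=
  Quotient.liftOn f (fun f ↦ inv (G.map (R.ι f.1 X.as)) ≫ G.map f.2) (by
    have key : ∀ {U W : I} (h : W ≤ U) (f : R.res U X.as ⟶ Y.as),
        inv (G.map (R.ι U X.as)) ≫ G.map f = inv (G.map (R.ι W X.as)) ≫ G.map (R.tr h _ ≫ f) := by
      intro U W h f
      have e : G.map (R.tr h X.as) ≫ G.map (R.ι U X.as) = G.map (R.ι W X.as) := by
        rw [← Functor.map_comp, R.tr_ι]
      have e' : inv (G.map (R.ι U X.as)) = inv (G.map (R.ι W X.as)) ≫ G.map (R.tr h X.as) := by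
        rw [IsIso.eq_inv_comp, ← e, Category.assoc, IsIso.hom_inv_id, Category.comp_id]
      rw [e', Functor.map_comp, Category.assoc]
    rintro ⟨U, f⟩ ⟨V, g⟩ ⟨W, h₁, h₂, h⟩
    exact (key h₁ f).trans ((congrArg (fun t ↦ _ ≫ G.map t) h).trans (key h₂ g).symm))

lemma liftMap_homMk {D : Type*} [Category* D] (G : E ⥤ D) [∀ U X, IsIso (G.map (R.ι U X))]
    {X Y : FilterQuotient R} (U : I) (f : R.res U X.as ⟶ Y.as) :
    liftMap G (homMk U f) = inv (G.map (R.ι U X.as)) ≫ G.map f := rfl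

/-- A functor that inverts the maps `X × U ⟶ X` factors through the filter quotient. -/
def liftFunctor {D : Type*} [Category* D] (G : E ⥤ D) [∀ U X, IsIso (G.map (R.ι U X))] :
    FilterQuotient R ⥤ D where
  obj X := G.obj X.as
  map f := liftMap G f
  map_id X := by
    rw [id_eq X (Classical.arbitrary I), liftMap_homMk, IsIso.inv_hom_id]
  map_comp {X Y Z} f g := by
    obtain ⟨U, -, f, rfl⟩ := exists_homMk f (Classical.arbitrary I)
    obtain ⟨V, hV, g, rfl⟩ := exists_homMk g U
    rw [← homMk_tr hV f, homMk_comp, liftMap_homMk, liftMap_homMk, liftMap_homMk]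
    generalize R.tr hV X.as ≫ f = f'
    have : G.map f' = G.map (R.ext f') ≫ G.map (R.ι V Y.as) := by
      rw [← Functor.map_comp, R.ext_ι]
    rw [this]
    simp only [Category.assoc, Functor.map_comp, IsIso.hom_inv_id_assoc]

lemma tr_eq_of_le {X Y : E} {U V W W' : I} {h₁ : W ≤ U} {h₂ : W ≤ V} {f : R.res U X ⟶ Y}
    {g : R.res V X ⟶ Y} (h : R.tr h₁ X ≫ f = R.tr h₂ X ≫ g) (h' : W' ≤ W) :
    R.tr (h'.trans h₁) X ≫ f = R.tr (h'.trans h₂) X ≫ g := by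
  rw [← R.tr_tr h' h₁, Category.assoc, h, ← Category.assoc, R.tr_tr]

lemma exists_homMk₂ {T X Y : FilterQuotient R} (a : T ⟶ X) (b : T ⟶ Y) :
    ∃ (U : I) (a' : R.res U T.as ⟶ X.as) (b' : R.res U T.as ⟶ Y.as),
      a = homMk U a' ∧ b = homMk U b' := by
  obtain ⟨U, -, a, rfl⟩ := exists_homMk a (Classical.arbitrary I)
  obtain ⟨V, hV, b, rfl⟩ := exists_homMk b U
  exact ⟨V, R.tr hV _ ≫ a, b, (homMk_tr hV a).symm, rfl⟩

/-- The image in the filter quotient of a morphism. -/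
def homOf {X Y : FilterQuotient R} (f : X.as ⟶ Y.as) : X ⟶ Y := (projection R).map f

lemma homOf_eq {X Y : FilterQuotient R} (f : X.as ⟶ Y.as) (U : I) :
    homOf f = homMk U (R.ι U X.as ≫ f) := projection_map f U

lemma homOf_comp {X Y Z : FilterQuotient R} (f : X.as ⟶ Y.as) (g : Y.as ⟶ Z.as) :
    homOf f ≫ homOf g = homOf (f ≫ g) := ((projection R).map_comp f g).symm

lemma homMk_comp_homOf {X Y Z : FilterQuotient R} {U : I} (f : R.res U X.as ⟶ Y.as)
    (g : Y.as ⟶ Z.as) : homMk U f ≫ homOf g = homMk U (f ≫ g) :=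
  homMk_comp_projection f g

/-- The image of a pullback square in the filter quotient is a pullback square. -/
lemma isPullback_homOf {P X Y Z : FilterQuotient R} {fst : P.as ⟶ X.as} {snd : P.as ⟶ Y.as}
    {f : X.as ⟶ Z.as} {g : Y.as ⟶ Z.as} (h : IsPullback fst snd f g) :
    IsPullback (homOf fst) (homOf snd) (homOf f) (homOf g) := by
  refine isPullback_of_exists (by rw [homOf_comp, homOf_comp, h.w]) ?_ ?_
  · intro T a b w
    obtain ⟨U, a, b, rfl, rfl⟩ := exists_homMk₂ a b
    rw [homMk_comp_homOf, homMk_comp_homOf] at w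
    obtain ⟨W, h₁, h₂, e⟩ := (homMk_eq_iff _ _).1 w
    have e' : (R.tr h₁ T.as ≫ a) ≫ f = (R.tr h₁ T.as ≫ b) ≫ g := by
      rw [Category.assoc, Category.assoc, e]
    refine ⟨homMk W (h.lift _ _ e'), ?_, ?_⟩
    · rw [homMk_comp_homOf, h.lift_fst, homMk_tr]
    · rw [homMk_comp_homOf, h.lift_snd, homMk_tr]
  · intro T m m' e₁ e₂
    obtain ⟨U, m, m', rfl, rfl⟩ := exists_homMk₂ m m'
    rw [homMk_comp_homOf, homMk_comp_homOf] at e₁ e₂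
    obtain ⟨W₁, h₁, h₁', e₁⟩ := (homMk_eq_iff _ _).1 e₁
    obtain ⟨W₂, h₂, h₂', e₂⟩ := (homMk_eq_iff _ _).1 e₂
    obtain ⟨W, k₁, k₂⟩ := exists_le_le W₁ W₂
    refine (homMk_eq_iff _ _).2 ⟨W, k₁.trans h₁, k₁.trans h₁', h.hom_ext ?_ ?_⟩
    · rw [Category.assoc, Category.assoc, tr_eq_of_le e₁ k₁]
    · rw [Category.assoc, Category.assoc]
      exact tr_eq_of_le e₂ k₂

/-- The isomorphism `X × U ≅ X` in the filter quotient. -/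
def resIso (U : I) (X : FilterQuotient R) : (⟨R.res U X.as⟩ : FilterQuotient R) ≅ X :=
  letI e : (projection R).obj (R.res U X.as) ≅ (projection R).obj X.as := asIso ((projection R).map (R.ι U X.as))
  e

lemma resIso_hom (U : I) (X : FilterQuotient R) : (resIso U X).hom = homOf (R.ι U X.as) := rfl

lemma resIso_hom_homMk {X Y : FilterQuotient R} (U : I) (f : R.res U X.as ⟶ Y.as) :
    (resIso U X).hom ≫ homMk U f = homOf (X := ⟨R.res U X.as⟩) f :=
  projection_ι_comp_homMk U f

/-- A pullback of representatives gives a pullback in the filter quotient. -/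
lemma isPullback_of_rep {U : I} {P X Y Z : FilterQuotient R} {fst : P.as ⟶ R.res U X.as}
    {snd : P.as ⟶ R.res U Y.as} {f : R.res U X.as ⟶ Z.as} {g : R.res U Y.as ⟶ Z.as}
    (h : IsPullback fst snd f g) :
    IsPullback (homOf (fst ≫ R.ι U X.as)) (homOf (snd ≫ R.ι U Y.as)) (homMk U f) (homMk U g) :=
  (isPullback_homOf (X := ⟨R.res U X.as⟩) (Y := ⟨R.res U Y.as⟩) h).of_iso (Iso.refl _)
    (resIso U X) (resIso U Y) (Iso.refl _)
    (by rw [resIso_hom, homOf_comp, Iso.refl_hom, Category.id_comp])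
    (by rw [resIso_hom, homOf_comp, Iso.refl_hom, Category.id_comp])
    (by rw [Iso.refl_hom, Category.comp_id, resIso_hom_homMk])
    (by rw [Iso.refl_hom, Category.comp_id, resIso_hom_homMk])

instance [HasPullbacks E] : HasPullbacks (FilterQuotient R) := by
  have key : ∀ {X Y Z : FilterQuotient R} (f : X ⟶ Z) (g : Y ⟶ Z), HasPullback f g := by
    intro X Y Z f g
    obtain ⟨U, -, f, rfl⟩ := exists_homMk f (Classical.arbitrary I)
    obtain ⟨V, hV, g, rfl⟩ := exists_homMk g U
    rw [← homMk_tr hV f]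
    exact (isPullback_of_rep (P := ⟨pullback (R.tr hV _ ≫ f) g⟩)
      (IsPullback.of_hasPullback (R.tr hV _ ≫ f) g)).hasPullback
  exact hasPullbacks_of_hasLimit_cospan _

/-- The class `S_Φ` of morphisms of the filter quotient: those represented by a map
`f : X × U ⟶ Y` such that the induced map `f × U : X × U ⟶ Y × U` belongs to `S`. -/
def quotientProperty (S : MorphismProperty E) : MorphismProperty (FilterQuotient R) :=
  fun X Y f ↦ ∃ (U : I) (g : R.res U X.as ⟶ Y.as), f = homMk U g ∧ S (R.ext g)

/-- Restriction along `W ≤ U` is a pullback. -/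
lemma isPullback_tr {X Y : E} {U W : I} (h : W ≤ U) (f : R.res U X ⟶ Y) :
    IsPullback (R.tr h X) (R.ext (R.tr h X ≫ f)) (R.ext f) (R.tr h Y) := by
  refine isPullback_of_exists (tr_ext h f) (fun {T} a b w ↦ ?_) (fun {T} m m' hm _ ↦ ?_)
  · have hs : R.IsOver W T := R.isOver_of_hom b (R.isOver_res _ _)
    have h₁ : R.lift hs (a ≫ R.ι U X) ≫ R.tr h X = a :=
      R.hom_ext _ _ (by rw [Category.assoc, R.tr_ι, R.lift_ι])
    refine ⟨R.lift hs (a ≫ R.ι U X), h₁, R.hom_ext _ _ ?_⟩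
    rw [Category.assoc, R.ext_ι, ← Category.assoc, h₁, ← R.tr_ι h, ← Category.assoc, ← w,
      Category.assoc, R.ext_ι]
  · refine R.hom_ext _ _ ?_
    rw [← R.tr_ι h, ← Category.assoc, hm, Category.assoc]

lemma isPullback_ext {P X Y Z : E} {U : I} {fst : P ⟶ R.res U X} {snd : P ⟶ R.res U Y}
    {f : R.res U X ⟶ Z} {g : R.res U Y ⟶ Z} (h : IsPullback fst snd f g) :
    IsPullback fst snd (R.ext f) (R.ext g) := by
  refine isPullback_of_exists (R.hom_ext _ _ ?_) (fun {T} a b w ↦ ?_)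
    (fun {T} m m' h₁ h₂ ↦ h.hom_ext h₁ h₂)
  · rw [Category.assoc, Category.assoc, R.ext_ι, R.ext_ι, h.w]
  · have w' : a ≫ f = b ≫ g := by
      rw [← R.ext_ι f, ← R.ext_ι g, ← Category.assoc, w, Category.assoc]
    exact ⟨h.lift a b w', h.lift_fst _ _ _, h.lift_snd _ _ _⟩

lemma isIso_ι {U : I} {X : E} (h : R.IsOver U X) : IsIso (R.ι U X) :=
  ⟨R.lift h (𝟙 X), R.hom_ext _ _ (by rw [Category.assoc, R.lift_ι, Category.comp_id,
    Category.id_comp]), R.lift_ι _ _⟩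

lemma isIso_rep {X Y : FilterQuotient R} (e : X ≅ Y) (U : I) :
    ∃ (W : I) (_ : W ≤ U) (a : R.res W X.as ⟶ Y.as), e.hom = homMk W a ∧ IsIso (R.ext a) := by
  obtain ⟨V₁, k₁, a, ha⟩ := exists_homMk e.hom U
  obtain ⟨V, k, b, hb⟩ := exists_homMk e.inv V₁
  have ha' : e.hom = homMk V (R.tr k _ ≫ a) := by rw [ha, homMk_tr]
  have h₁ : homMk V (R.ext (R.tr k _ ≫ a) ≫ b) = homMk V (R.ι V X.as) := by
    rw [← homMk_comp, ← id_eq, ← ha', ← hb, e.hom_inv_id]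
  have h₂ : homMk V (R.ext b ≫ R.tr k _ ≫ a) = homMk V (R.ι V Y.as) := by
    rw [← homMk_comp, ← id_eq, ← ha', ← hb, e.inv_hom_id]
  generalize R.tr k _ ≫ a = a' at ha' h₁ h₂
  obtain ⟨W₁, l₁, l₁', e₁⟩ := (homMk_eq_iff _ _).1 h₁
  obtain ⟨W₂, l₂, l₂', e₂⟩ := (homMk_eq_iff _ _).1 h₂
  obtain ⟨W, m₁, m₂⟩ := exists_le_le W₁ W₂
  have l := m₁.trans l₁
  have e₁ := tr_eq_of_le e₁ m₁
  have e₂ := tr_eq_of_le e₂ m₂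
  refine ⟨W, l.trans (k.trans k₁), R.tr l _ ≫ a', by rw [homMk_tr, ha'],
    ⟨R.ext (R.tr l _ ≫ b), ?_, ?_⟩⟩
  · refine R.hom_ext _ _ ?_
    rw [Category.assoc, R.ext_ι, ← Category.assoc, ← tr_ext, Category.assoc, e₁, R.tr_ι,
      Category.id_comp]
  · refine R.hom_ext _ _ ?_
    rw [Category.assoc, R.ext_ι, ← Category.assoc, ← tr_ext, Category.assoc, e₂, R.tr_ι,
      Category.id_comp]

lemma quotientProperty_of_iso {S : MorphismProperty E} [S.IsStableUnderBaseChange]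
    {X Y Z : FilterQuotient R} (e : X ≅ Y) (f : Y ⟶ Z) (hf : quotientProperty S f) :
    quotientProperty S (e.hom ≫ f) := by
  obtain ⟨U, f, rfl, hf⟩ := hf
  obtain ⟨W, h, a, ha, _⟩ := isIso_rep e U
  refine ⟨W, R.ext a ≫ R.tr h _ ≫ f, ?_, ?_⟩
  · rw [← homMk_comp, homMk_tr, ha]
  · rw [ext_comp_ext, MorphismProperty.cancel_left_of_respectsIso S]
    exact S.of_isPullback (isPullback_tr h f) hf

instance (S : MorphismProperty E) [HasPullbacks E] [S.IsStableUnderBaseChange] :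
    (quotientProperty (R := R) S).IsStableUnderBaseChange where
  of_isPullback {X Y Y' Z f g f' g'} sq hg := by
    obtain ⟨U, g, rfl, hg⟩ := hg
    obtain ⟨W, h, f, rfl⟩ := exists_homMk f U
    have hg' : S (R.ext (R.tr h _ ≫ g)) := S.of_isPullback (isPullback_tr h g) hg
    rw [← homMk_tr h g] at sq
    generalize R.tr h _ ≫ g = g₁ at sq hg'
    have pb := IsPullback.of_hasPullback g₁ f
    have hS : S (pullback.snd g₁ f) := S.of_isPullback (isPullback_ext pb) hg'
    let Q : FilterQuotient R := ⟨pullback g₁ f⟩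
    have pb' := isPullback_of_rep (P := Q) pb
    let e : Y' ≅ Q := sq.isoIsPullback _ _ pb'
    have he : e.hom ≫ homOf (pullback.snd g₁ f ≫ R.ι W X.as) = g' :=
      sq.isoIsPullback_hom_snd _ _ pb'
    rw [← he]
    refine quotientProperty_of_iso e _ ⟨W, _, homOf_eq _ W, ?_⟩
    have : R.ext (R.ι W Q.as ≫ pullback.snd g₁ f ≫ R.ι W X.as) =
        R.ι W Q.as ≫ pullback.snd g₁ f :=
      R.hom_ext _ _ (by rw [R.ext_ι, Category.assoc])
    have hi : IsIso (R.ι W Q.as) := isIso_ι (R.isOver_of_hom (pullback.snd g₁ f) (R.isOver_res _ _))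
    rw [this, MorphismProperty.cancel_left_of_respectsIso S]
    exact hS

end FilterQuotient

end RestrictionSystem
end RestrictionSystem

section Instances

open Pseudofunctor.CoGrothendieck
open scoped Pseudofunctor.CoGrothendieck

set_option linter.unusedVariables false
set_option linter.unusedSectionVars false

variable {C : Type u} [Category.{v} C]

lemma exists_cartesianLift {F : LocallyDiscrete Cᵒᵖ ⥤ᵖ Cat.{v, max u v}} {A B : C}
    (x : F.obj ⟨op B⟩) (k : A ⟶ B) {Z : ∫ᶜ F} (f : Z ⟶ ⟨B, x⟩) (g : Z.base ⟶ A)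
    (h : g ≫ k = f.base) :
    ∃! χ : Z ⟶ domainCartesianLift x k, χ.base = g ∧ χ ≫ cartesianLift x k = f := by
  have : Functor.IsHomLift (forget F) (g ≫ k) f := by
    rw [h]
    exact CategoryTheory.IsHomLift.map (forget F) f
  obtain ⟨χ, ⟨h₁, h₂⟩, h₃⟩ :=
    @(isStronglyCartesian_homCartesianLift x k).universal_property' _ g f this
  have := h₁
  refine ⟨χ, ⟨?_, h₂⟩, fun χ' ⟨h₄, h₅⟩ ↦ h₃ χ' ⟨?_, h₅⟩⟩
  · have := @CategoryTheory.IsHomLift.fac' _ _ _ _ (forget F) _ _ _ _ g χ h₁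
    exact this.trans ((Category.id_comp _).trans (Category.comp_id _))
  · subst h₄
    exact CategoryTheory.IsHomLift.map (forget F) χ'

variable [HasTerminal C] [HasBinaryProducts C] (Φ : Order.PFilter (Subobject (⊤_ C)))

instance : Nonempty Φ := Φ.nonempty.to_subtype

instance : IsCodirectedOrder Φ where
  directed U V := by
    obtain ⟨W, hW, h₁, h₂⟩ := Φ.directed U.1 U.2 V.1 V.2
    exact ⟨⟨W, hW⟩, h₁, h₂⟩

variable {Φ} in
lemma hom_subterminal_eq {Z : C} {U : Φ} (f g : Z ⟶ (U.1 : C)) : f = g :=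
  (cancel_mono U.1.arrow).1 (Subsingleton.elim _ _)

/-- The restriction of `X` to a subterminal object `U` is `X × U`. -/
def productSystem : RestrictionSystem Φ C where
  IsOver U Z := Nonempty (Z ⟶ (U.1 : C))
  isOver_of_hom f h := ⟨f ≫ h.some⟩
  isOver_mono {U V _} h k := ⟨k.some ≫ Subobject.ofLE U.1 V.1 h⟩
  res U X := X ⨯ (U.1 : C)
  isOver_res U X := ⟨prod.snd⟩
  ι U X := prod.fst
  lift h f := prod.lift f h.some
  lift_ι h f := prod.lift_fst _ _
  hom_ext f g h := Limits.prod.hom_ext h (hom_subterminal_eq _ _)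

/-- The filter quotient `C_Φ`. -/
abbrev FilterQuotientCategory := RestrictionSystem.FilterQuotient (productSystem Φ)

/-- The restriction of an object `x` of `∫ F` over `A` to a subterminal object `U` is the cartesian
restriction of `x` along `A × U ⟶ A`. -/
def totalSystem (F : LocallyDiscrete Cᵒᵖ ⥤ᵖ Cat.{v, max u v}) : RestrictionSystem Φ (∫ᶜ F) where
  IsOver U Z := Nonempty (Z.base ⟶ (U.1 : C))
  isOver_of_hom f h := ⟨f.base ≫ h.some⟩
  isOver_mono {U V _} h k := ⟨k.some ≫ Subobject.ofLE U.1 V.1 h⟩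
  res U X := domainCartesianLift X.fiber (prod.fst : X.base ⨯ (U.1 : C) ⟶ X.base)
  isOver_res U X := ⟨prod.snd⟩
  ι U X := cartesianLift X.fiber prod.fst
  lift {U Z X} h f := (exists_cartesianLift X.fiber prod.fst f (prod.lift f.base h.some)
    (prod.lift_fst _ _)).choose
  lift_ι {U Z X} h f := (exists_cartesianLift X.fiber prod.fst f (prod.lift f.base h.some)
    (prod.lift_fst _ _)).choose_spec.1.2
  hom_ext {U Z X} f g h := by
    have hb : f.base ≫ (prod.fst : X.base ⨯ (U.1 : C) ⟶ X.base) = g.base ≫ prod.fst :=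
      congrArg Hom.base h
    have hb' : f.base = g.base := Limits.prod.hom_ext hb (hom_subterminal_eq _ _)
    exact (exists_cartesianLift X.fiber prod.fst (g ≫ cartesianLift X.fiber prod.fst) g.base
      rfl).unique ⟨hb', h⟩ ⟨rfl, rfl⟩

end Instances

section Arrows

open Pseudofunctor.CoGrothendieck
open scoped Pseudofunctor.CoGrothendieck

variable {C : Type u} [Category.{v} C] [HasPullbacks C]

lemma square_isPullback {A B : C} (k : A ⟶ B) {p : Core (Over A)} {q : Core (Over B)}
    (h : p ⟶ (reindex k).obj q) : IsPullback ((dom A).map h ≫ proj k q) (arr p) (arr q) k :=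
  (proj_isPullback k q).of_iso ((dom A).mapIso (asIso h)).symm (Iso.refl _) (Iso.refl _)
    (Iso.refl _) (by simp) (by simp [dom_map_arr]) (by simp) (by simp)

lemma square_comp {A B D : C} (k : A ⟶ B) (l : B ⟶ D) {p : Core (Over A)} {q : Core (Over B)}
    {r : Core (Over D)} (h : p ⟶ (reindex k).obj q) (h' : q ⟶ (reindex l).obj r) :
    (dom A).map (h ≫ (reindex k).map h' ≫ (reindexComp k l).inv.app r) ≫ proj (k ≫ l) r =
      ((dom A).map h ≫ proj k q) ≫ (dom B).map h' ≫ proj l r := by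
  rw [Functor.map_comp, Functor.map_comp, Category.assoc, Category.assoc, Category.assoc,
    reindexComp_inv_proj]
  refine congrArg (_ ≫ ·) ?_
  rw [← Category.assoc, ← Category.assoc]
  exact congrArg (· ≫ _) (reindex_map_proj k h')

lemma square_id {A : C} (p : Core (Over A)) :
    (dom A).map ((reindexId A).inv.app p) ≫ proj (𝟙 A) p = 𝟙 ((dom A).obj p) := by
  rw [← reindexId_proj, ← Functor.map_comp, Iso.inv_hom_id_app]
  exact (dom A).map_id p

/-- The functor `∫ 𝕄 ⥤ C^→` that sends `(X, p)` to the morphism `p`, and a morphism of `∫ 𝕄` to the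
pullback square that it amounts to. -/
def codomainArrow : ∫ᶜ (codomainPseudo C) ⥤ Arrow C where
  obj X := Arrow.mk (arr X.fiber)
  map {X Y} f := Arrow.homMk ((dom X.base).map f.fiber ≫ proj f.base Y.fiber) f.base
    (square_isPullback f.base f.fiber).w
  map_id X := Arrow.hom_ext _ _ (square_id X.fiber) rfl
  map_comp f g := Arrow.hom_ext _ _ (square_comp f.base g.base f.fiber g.fiber) rfl

/-- The functor `∫ F ⥤ C^→` given by a map of pseudo-functors `F ⟶ 𝕄`. -/
def totalArrow {F : LocallyDiscrete Cᵒᵖ ⥤ᵖ Cat.{v, max u v}} (φ : F ⟶ codomainPseudo C) :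
    ∫ᶜ F ⥤ Arrow C :=
  map φ ⋙ codomainArrow

lemma totalArrow_isPullback {F : LocallyDiscrete Cᵒᵖ ⥤ᵖ Cat.{v, max u v}}
    (φ : F ⟶ codomainPseudo C) {X Y : ∫ᶜ F} (f : X ⟶ Y) :
    IsPullback ((totalArrow φ).map f).left ((totalArrow φ).obj X).hom ((totalArrow φ).obj Y).hom
      f.base :=
  square_isPullback f.base ((map φ).map f).fiber

end Arrows

section Induced

open RestrictionSystem.FilterQuotient

variable {C : Type u} [Category.{v} C] [HasPullbacks C] [HasTerminal C] [HasBinaryProducts C]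
  (Φ : Order.PFilter (Subobject (⊤_ C)))

instance {F : LocallyDiscrete Cᵒᵖ ⥤ᵖ Cat.{v, max u v}} (φ : F ⟶ codomainPseudo C) (U : Φ)
    (X : Pseudofunctor.CoGrothendieck F) :
    IsIso ((totalArrow φ ⋙ (projection (productSystem Φ)).mapArrow).map
      ((totalSystem Φ F).ι U X)) := by
  have h₁ : IsIso ((projection (productSystem Φ)).map ((totalSystem Φ F).ι U X).base) :=
    isIso_projection_map_ι (R := productSystem Φ) U X.base
  have h₂ := isPullback_homOf (R := productSystem Φ) (P := ⟨_⟩) (X := ⟨_⟩) (Y := ⟨_⟩) (Z := ⟨_⟩)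
    (totalArrow_isPullback φ ((totalSystem Φ F).ι U X))
  have h₄ := @IsPullback.isIso_fst_of_isIso _ _ _ _ _ _ _ _ _ _ h₂ h₁
  exact @Arrow.isIso_of_isIso_left_of_isIso_right _ _ _ _ _ h₄ h₁

/-- The total category `(∫ F)_Φ` of the induced pseudo-functor. -/
abbrev InducedTotal (F : LocallyDiscrete Cᵒᵖ ⥤ᵖ Cat.{v, max u v}) :=
  RestrictionSystem.FilterQuotient (totalSystem Φ F)

/-- The functor `(∫ F)_Φ ⥤ (C_Φ)^→` induced by the functor `∫ F ⥤ C^→` of a map of pseudo-functors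
`F ⟶ 𝕄`. Its composition with the codomain functor is the fibration `(∫ F)_Φ ⥤ C_Φ`. -/
def inducedArrow {F : LocallyDiscrete Cᵒᵖ ⥤ᵖ Cat.{v, max u v}} (φ : F ⟶ codomainPseudo C) :
    InducedTotal Φ F ⥤ Arrow (FilterQuotientCategory Φ) :=
  liftFunctor (totalArrow φ ⋙ (projection (productSystem Φ)).mapArrow)

/-- A pseudo-functor `G` over `𝕄` on `C_Φ` is the one induced by a pseudo-functor `F` over `𝕄` on
`C`: the fibration that corresponds to `G` is equivalent to `(∫ F)_Φ`, compatibly with the functors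
to the arrow category of `C_Φ` (and so also with the projections to `C_Φ`). -/
def IsInduced {F : LocallyDiscrete Cᵒᵖ ⥤ᵖ Cat.{v, max u v}} (φ : F ⟶ codomainPseudo C)
    {G : LocallyDiscrete (FilterQuotientCategory Φ)ᵒᵖ ⥤ᵖ Cat.{max u v, max u v}}
    (ψ : G ⟶ codomainPseudo (FilterQuotientCategory Φ)) : Prop :=
  ∃ e : Pseudofunctor.CoGrothendieck G ≌ InducedTotal Φ F,
    Nonempty (totalArrow ψ ≅ e.functor ⋙ inducedArrow Φ φ)

instance [CategoryWithFibrations C] : CategoryWithFibrations (FilterQuotientCategory Φ) where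
  fibrations := quotientProperty (fibrations C)

instance [CategoryWithCofibrations C] : CategoryWithCofibrations (FilterQuotientCategory Φ) where
  cofibrations := quotientProperty (cofibrations C)

instance [CategoryWithFibrations C] [(fibrations C).IsStableUnderBaseChange] :
    (fibrations (FilterQuotientCategory Φ)).IsStableUnderBaseChange :=
  inferInstanceAs (quotientProperty (R := productSystem Φ)
    (fibrations C)).IsStableUnderBaseChange

/-- A model filter: a filter of subterminal objects that are fibrant, such that cofibrations and
weak equivalences are stable under taking the product with members of the filter. -/
structure IsModelFilter [CategoryWithFibrations C] [CategoryWithCofibrations C]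
    [CategoryWithWeakEquivalences C] : Prop where
  isFibrant {U : Subobject (⊤_ C)} (hU : U ∈ Φ) : IsFibrant (U : C)
  cofibrations_prod {U : Subobject (⊤_ C)} (hU : U ∈ Φ) {X Y : C} (f : X ⟶ Y) :
    cofibrations C f → cofibrations C (prod.map f (𝟙 (U : C)))
  weakEquivalences_prod {U : Subobject (⊤_ C)} (hU : U ∈ Φ) {X Y : C} (f : X ⟶ Y) :
    weakEquivalences C f → weakEquivalences C (prod.map f (𝟙 (U : C)))

end Induced
end FilterModel
end

open FilterModel

/-! A notion of fibred structure can be described without pseudo-functors. The functor `T =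
totalArrow φ` from `∫ F` to the arrow category sends every morphism to a pullback square, and
pullback squares into structured arrows lift along it, uniquely up to isomorphism. This is
`IsStructured T`: up to equivalence, `T` is a discrete fibration over the category of arrows and
pullback squares, that is, a presheaf of structures on it.

By the Yoneda lemma, a map from `C(-, Z)` to `𝕄` is an arrow with codomain `Z`, and a lifting
problem against `C(-, A) ⟶ C(-, B)` is a pullback square from a structured arrow over `A` to a
fibration over `B`. Hence local representability says that among the pullback squares from
structured arrows to a given arrow there is a universal one (`hasUniversal_totalArrow`), and
acyclicity says that structures on fibrations extend along pullback squares over cofibrations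
(`isAcyclic_totalArrow`).

In this form the conditions pass to the filter quotient. Each concerns finitely many arrows, squares
and equations, which have representatives over some `U` in the filter; an equation, or the property
of being a pullback square, that holds in the quotient holds after shrinking `U`
(`exists_of_arrowProj_map_eq`, `exists_isCart_comp`). As `X × U ⟶ X` becomes invertible, shrinking
changes nothing up to isomorphism. So universal structured arrows stay universal, a fibration of the
quotient is isomorphic to the image of a fibration, and an extension problem is represented by one
along a cofibration `i × W`. The structures on an arrow come from structures on its restrictions to
the members of the filter, which is small.

Conversely, a functor with `IsStructured` yields a presheaf of structures, an `ArrowStructure`: a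
structure on `p` is a class of pullback squares from `p` to structured arrows. Its elements form a
pseudo-functor with a genuine discrete fibration to `𝕄`, and its total category is equivalent to the
given one (`exists_acyclicFibredStructure`). -/

noncomputable section
namespace FilterModel

/-! ### Pullback squares and presheaves of structures on arrows -/

section Cartesian

variable {D : Type*} [Category* D]

/-- A morphism of arrows is Cartesian if it is a pullback square. -/
def IsCart {p q : Arrow D} (d : p ⟶ q) : Prop := IsPullback d.left p.hom q.hom d.right

lemma IsCart.comp {p q r : Arrow D} {d : p ⟶ q} {e : q ⟶ r} (hd : IsCart d) (he : IsCart e) :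
    IsCart (d ≫ e) :=
  IsPullback.paste_horiz hd he

lemma IsCart.of_comp {p q r : Arrow D} {d : p ⟶ q} {e : q ⟶ r} (he : IsCart e)
    (h : IsCart (d ≫ e)) : IsCart d :=
  IsPullback.of_right h d.w he

lemma IsCart.of_isIso {p q : Arrow D} (d : p ⟶ q) [IsIso d] : IsCart d :=
  IsPullback.of_horiz_isIso ⟨d.w⟩

lemma IsCart.id (p : Arrow D) : IsCart (𝟙 p) := .of_isIso _

lemma IsCart.isIso {p q : Arrow D} {d : p ⟶ q} (hd : IsCart d) (h : IsIso d.right) : IsIso d := by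
  have : IsIso d.left := IsPullback.isIso_fst_of_isIso hd
  exact Arrow.isIso_of_isIso_left_of_isIso_right _

/-- Together with `IsCart.exists_lift`, this says that pullback squares are the Cartesian morphisms
of the codomain functor. Most equalities of squares below are checked in this way: after composition
with a Cartesian square, and on codomains. -/
lemma IsCart.hom_ext {p q r : Arrow D} {e : q ⟶ r} (he : IsCart e) {a b : p ⟶ q}
    (h : a ≫ e = b ≫ e) (hr : a.right = b.right) : a = b := by
  refine Arrow.hom_ext _ _ (IsPullback.hom_ext he congr(($h).left) ?_) hr
  rw [a.w, b.w, hr]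

lemma IsCart.exists_lift {p q r : Arrow D} {e : q ⟶ r} (he : IsCart e) (d : p ⟶ r)
    (k : p.right ⟶ q.right) (hk : k ≫ e.right = d.right) :
    ∃ a : p ⟶ q, a ≫ e = d ∧ a.right = k := by
  have w : d.left ≫ r.hom = (p.hom ≫ k) ≫ e.right := by rw [Category.assoc, hk, d.w]
  exact ⟨Arrow.homMk (he.lift _ _ w) k (he.lift_snd _ _ w),
    Arrow.hom_ext _ _ (he.lift_fst _ _ w) hk, rfl⟩

/-- The pullback of an arrow along a morphism to its codomain. -/
lemma exists_isCart [HasPullbacks D] (q : Arrow D) {X : D} (k : X ⟶ q.right) :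
    ∃ (P : D) (p : P ⟶ X) (d : Arrow.mk p ⟶ q), IsCart d ∧ d.right = k :=
  ⟨pullback q.hom k, pullback.snd _ _, Arrow.homMk (pullback.fst _ _) k pullback.condition,
    IsPullback.of_hasPullback _ _, rfl⟩

/-- Structures on the arrows of a category that can be restricted along pullback squares. -/
structure ArrowStructure (D : Type*) [Category* D] where
  /-- The type of structures on an arrow. -/
  str : Arrow D → Type w
  /-- Restriction along a pullback square. -/
  restr {p q : Arrow D} (d : p ⟶ q) (hd : IsCart d) : str q → str p
  restr_id {p : Arrow D} (h : IsCart (𝟙 p)) (s : str p) : restr (𝟙 p) h s = s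
  restr_comp {p q r : Arrow D} (d : p ⟶ q) (e : q ⟶ r) (hd : IsCart d) (he : IsCart e)
    (h : IsCart (d ≫ e)) (s : str r) : restr (d ≫ e) h s = restr d hd (restr e he s)

/-- The proof argument of `restr` depends on the square, so an equality of squares has to transport
it. -/
lemma ArrowStructure.restr_congr (S : ArrowStructure.{w} D) {p q : Arrow D} {d e : p ⟶ q}
    (h : d = e) (hd : IsCart d) (s : S.str q) : S.restr d hd s = S.restr e (h ▸ hd) s := by
  subst h; rfl

end Cartesian

/-! ### Groupoids of slices inside the arrow category -/

section Squares

variable {D : Type u} [Category.{v} D]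

/-- An object of a groupoid of slices as an object of the arrow category. -/
abbrev objArrow {X : D} (p : Core (Over X)) : Arrow D := Arrow.mk (arr p)

/-- A morphism of a groupoid of slices as a morphism of arrows. -/
def mapArrow {X : D} {p q : Core (Over X)} (m : p ⟶ q) : objArrow p ⟶ objArrow q :=
  Arrow.homMk ((dom X).map m) (𝟙 X) ((dom_map_arr m).trans (Category.comp_id _).symm)

lemma mapArrow_id {X : D} (p : Core (Over X)) : mapArrow (𝟙 p) = 𝟙 _ :=
  Arrow.hom_ext _ _ ((dom X).map_id p) rfl

lemma mapArrow_comp {X : D} {p q r : Core (Over X)} (m : p ⟶ q) (n : q ⟶ r) :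
    mapArrow (m ≫ n) = mapArrow m ≫ mapArrow n :=
  Arrow.hom_ext _ _ ((dom X).map_comp m n) (Category.comp_id _).symm

lemma mapArrow_injective {X : D} {p q : Core (Over X)} {m n : p ⟶ q}
    (h : mapArrow m = mapArrow n) : m = n :=
  dom_ext congr(($h).left)

instance {X : D} {p q : Core (Over X)} (m : p ⟶ q) : IsIso (mapArrow m) :=
  ⟨mapArrow (inv m), by rw [← mapArrow_comp, IsIso.hom_inv_id, mapArrow_id],
    by rw [← mapArrow_comp, IsIso.inv_hom_id, mapArrow_id]⟩

lemma isCart_mapArrow {X : D} {p q : Core (Over X)} (m : p ⟶ q) : IsCart (mapArrow m) :=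
  .of_isIso _

/-- A square over an identity between isomorphic arrows comes from the groupoid of slices. -/
lemma exists_mapArrow {X : D} {p q : Core (Over X)} (d : objArrow p ⟶ objArrow q) (hd : IsCart d)
    (h : d.right = 𝟙 X) : ∃ m : p ⟶ q, mapArrow m = d := by
  have : IsIso d.right := by rw [h]; exact inferInstanceAs (IsIso (𝟙 X))
  have := hd.isIso this
  have : IsIso d.left := inferInstance
  refine ⟨(coreIsoMk (asIso d.left) ?_).hom, Arrow.hom_ext _ _ rfl h.symm⟩
  have := d.w
  rw [h] at this
  exact this.trans (Category.comp_id _)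

variable [HasPullbacks D]

/-- The pullback square given by reindexing. -/
def projArrow {X Y : D} (f : X ⟶ Y) (p : Core (Over Y)) :
    objArrow ((reindex f).obj p) ⟶ objArrow p :=
  Arrow.homMk (proj f p) f (proj_isPullback f p).w

lemma isCart_projArrow {X Y : D} (f : X ⟶ Y) (p : Core (Over Y)) : IsCart (projArrow f p) :=
  proj_isPullback f p

lemma mapArrow_reindex_projArrow {X Y : D} (f : X ⟶ Y) {p q : Core (Over Y)} (m : p ⟶ q) :
    mapArrow ((reindex f).map m) ≫ projArrow f q = projArrow f p ≫ mapArrow m :=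
  Arrow.hom_ext _ _ (reindex_map_proj f m) ((Category.id_comp _).trans (Category.comp_id _).symm)

/-- Here and in `mapArrow_reindexComp`, the coherence isomorphisms of reindexing become the
canonical comparisons of projection squares; coherence can thus be checked on squares. -/
lemma mapArrow_reindexId {X : D} (p : Core (Over X)) :
    mapArrow ((reindexId X).hom.app p) = projArrow (𝟙 X) p :=
  Arrow.hom_ext _ _ (reindexId_proj p) rfl

lemma mapArrow_reindexComp {X Y Z : D} (f : X ⟶ Y) (g : Y ⟶ Z) (p : Core (Over Z)) :
    mapArrow ((reindexComp f g).hom.app p) ≫ projArrow f _ ≫ projArrow g p =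
      projArrow (f ≫ g) p :=
  Arrow.hom_ext _ _ (reindexComp_hom_proj f g p) (Category.id_comp _)

end Squares

section

variable {C : Type*} [Category* C] {B : Type*} [Bicategory B]

/-- Naturality with respect to 2-cells is automatic over a locally discrete bicategory. -/
lemma naturality_of_locallyDiscrete {F G : LocallyDiscrete C ⥤ᵖ B} (app : ∀ X, F.obj X ⟶ G.obj X)
    (nat : ∀ {X Y} (f : X ⟶ Y), F.map f ≫ app Y ≅ app X ≫ G.map f)
    {X Y : LocallyDiscrete C} {f g : X ⟶ Y} (η : f ⟶ g) :
    F.map₂ η ▷ app Y ≫ (nat g).hom = (nat f).hom ≫ app X ◁ G.map₂ η := by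
  obtain rfl := LocallyDiscrete.eq_of_hom η
  obtain rfl : η = 𝟙 _ := Subsingleton.elim _ _
  simp

end

/-! ### The pseudo-functor of arrows with a structure -/

namespace ArrowStructure

variable {D : Type u} [Category.{v} D] (S : ArrowStructure.{max u v} D)

/-- The objects of the slice over `X` with a structure. -/
structure Elt (X : D) : Type (max u v) where
  /-- The underlying arrow. -/
  pt : Core (Over X)
  /-- The structure. -/
  str : S.str (objArrow pt)

variable {S}

namespace Elt

/-- The isomorphisms of arrows that preserve the structure. -/
@[ext]
structure Hom {X : D} (x y : S.Elt X) : Type v where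
  /-- The underlying isomorphism. -/
  hom : x.pt ⟶ y.pt
  restr_str : S.restr (mapArrow hom) (isCart_mapArrow _) y.str = x.str

instance (X : D) : Category.{v} (S.Elt X) where
  Hom := Hom
  id x := ⟨𝟙 _, by rw [S.restr_congr (mapArrow_id _), S.restr_id]⟩
  comp m n := ⟨m.hom ≫ n.hom, by
    rw [S.restr_congr (mapArrow_comp _ _), S.restr_comp _ _ (isCart_mapArrow _) (isCart_mapArrow _),
      n.restr_str, m.restr_str]⟩

lemma hom_ext {X : D} {x y : S.Elt X} {m n : x ⟶ y} (h : Hom.hom m = Hom.hom n) : m = n :=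
  Hom.ext h

/-- An isomorphism of arrows that preserves the structure, as an isomorphism. -/
def isoMk {X : D} {x y : S.Elt X} (e : x.pt ≅ y.pt)
    (h : S.restr (mapArrow e.hom) (isCart_mapArrow _) y.str = x.str) : x ≅ y where
  hom := ⟨e.hom, h⟩
  inv := ⟨e.inv, by
    rw [← h, ← S.restr_comp _ _ _ _ ((isCart_mapArrow _).comp (isCart_mapArrow _))]
    rw [S.restr_congr (e := 𝟙 _) (by rw [← mapArrow_comp, e.inv_hom_id, mapArrow_id]),
      S.restr_id]⟩
  hom_inv_id := hom_ext e.hom_inv_id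
  inv_hom_id := hom_ext e.inv_hom_id

instance (X : D) : IsGroupoid (S.Elt X) where
  all_isIso m := (isoMk (asIso (Hom.hom m)) m.restr_str).isIso_hom

variable (S) in
/-- The functor that forgets the structure. -/
def forget (X : D) : S.Elt X ⥤ Core (Over X) where
  obj x := x.pt
  map m := Hom.hom m

variable [HasPullbacks D]

variable (S) in
/-- Reindexing of arrows with a structure. -/
def reindex {X Y : D} (f : X ⟶ Y) : S.Elt Y ⥤ S.Elt X where
  obj x := ⟨(FilterModel.reindex f).obj x.pt, S.restr (projArrow f x.pt) (isCart_projArrow _ _) x.str⟩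
  map m := ⟨(FilterModel.reindex f).map (Hom.hom m), by
    rw [← S.restr_comp _ _ _ _ ((isCart_mapArrow _).comp (isCart_projArrow _ _)),
      S.restr_congr (mapArrow_reindex_projArrow f _), S.restr_comp _ _ (isCart_projArrow _ _)
      (isCart_mapArrow _), m.restr_str]⟩
  map_id x := hom_ext ((FilterModel.reindex f).map_id _)
  map_comp m n := hom_ext ((FilterModel.reindex f).map_comp _ _)

variable (S) in
/-- Reindexing along an identity is isomorphic to the identity. -/
def reindexId (X : D) : reindex S (𝟙 X) ≅ 𝟭 (S.Elt X) :=
  NatIso.ofComponents (fun x ↦ isoMk ((FilterModel.reindexId X).app x.pt)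
      (S.restr_congr (mapArrow_reindexId x.pt) _ _))
    (fun _ ↦ hom_ext ((FilterModel.reindexId X).hom.naturality _))

variable (S) in
/-- Reindexing along a composition is isomorphic to the composition of the reindexings. -/
def reindexComp {X Y Z : D} (f : X ⟶ Y) (g : Y ⟶ Z) :
    reindex S (f ≫ g) ≅ reindex S g ⋙ reindex S f :=
  NatIso.ofComponents (fun x ↦ isoMk ((FilterModel.reindexComp f g).app x.pt) (by
      refine (S.restr_comp (mapArrow _) _ (isCart_mapArrow _) (isCart_projArrow f _)
        ((isCart_mapArrow _).comp (isCart_projArrow _ _)) _).symm.trans ?_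
      refine (S.restr_comp _ _ _ (isCart_projArrow g _) (((isCart_mapArrow _).comp
        (isCart_projArrow _ _)).comp (isCart_projArrow _ _)) _).symm.trans ?_
      exact S.restr_congr ((Category.assoc _ _ _).trans (mapArrow_reindexComp f g x.pt)) _ _))
    (fun _ ↦ hom_ext ((FilterModel.reindexComp f g).hom.naturality _))

/-- The coherence axioms of a pseudo-functor on a locally discrete bicategory contain `eqToHom`
between the reindexings along equal morphisms; it is compatible with the projections. -/
lemma eqToHom_proj {X Y : D} {f f' : X ⟶ Y} (h : f = f') (x : S.Elt Y)
    (e : (reindex S f).toCatHom = (reindex S f').toCatHom) :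
    (dom X).map (Hom.hom ((eqToHom e).toNatTrans.app x)) ≫ proj f' x.pt = proj f x.pt := by
  subst h
  exact (congrArg (· ≫ proj f x.pt) ((dom X).map_id _)).trans (Category.id_comp _)

end Elt

variable [HasPullbacks D]

variable (S) in
/-- The pseudo-functor of arrows with a structure. -/
def toPseudo : LocallyDiscrete Dᵒᵖ ⥤ᵖ Cat.{v, max u v} :=
  LocallyDiscrete.mkPseudofunctor
    (fun X ↦ Cat.of (S.Elt X.unop))
    (fun f ↦ (Elt.reindex S f.unop).toCatHom)
    (fun X ↦ Cat.Hom.isoMk (Elt.reindexId S X.unop))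
    (fun f g ↦ Cat.Hom.isoMk (Elt.reindexComp S g.unop f.unop))
    -- Structure-preserving isomorphisms are determined by the underlying isomorphisms of arrows, so
    -- the axioms reduce to those of `codomainPseudo`.
    (fun {A B D E} f g h ↦ by
      ext x
      exact Elt.hom_ext (reindex_ext ((reindex_assoc_proj f.unop g.unop h.unop x.pt).trans
        (Elt.eqToHom_proj (Category.assoc _ _ _).symm x _).symm)))
    (fun {X Y} f ↦ by
      ext x
      exact Elt.hom_ext (reindex_ext ((reindex_left_proj f.unop x.pt).trans
        (Elt.eqToHom_proj (Category.comp_id _) x _).symm)))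
    (fun {X Y} f ↦ by
      ext x
      exact Elt.hom_ext (reindex_ext ((reindex_right_proj f.unop x.pt).trans
        (Elt.eqToHom_proj (Category.id_comp _) x _).symm)))

variable (S) in
/-- The naturality isomorphism of the map that forgets the structure. -/
def forgetNaturality {X Y : LocallyDiscrete Dᵒᵖ} (f : X ⟶ Y) :
    S.toPseudo.map f ≫ (show S.toPseudo.obj Y ⟶ (codomainPseudo D).obj Y from
        (Elt.forget S Y.as.unop).toCatHom) ≅
      (show S.toPseudo.obj X ⟶ (codomainPseudo D).obj X from
        (Elt.forget S X.as.unop).toCatHom) ≫ (codomainPseudo D).map f :=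
  Cat.Hom.isoMk (NatIso.ofComponents (fun x ↦ Iso.refl ((FilterModel.reindex f.as.unop).obj x.pt))
    (fun _ ↦ (Category.comp_id _).trans (Category.id_comp _).symm))

variable (S) in
/-- The map that forgets the structure. -/
def toCodomain : S.toPseudo ⟶ codomainPseudo D where
  app X := (Elt.forget S X.as.unop).toCatHom
  naturality f := S.forgetNaturality f
  naturality_naturality η := naturality_of_locallyDiscrete _ S.forgetNaturality η
  naturality_id X := by
    ext x
    exact (Category.id_comp _).trans
      ((congrArg (_ ≫ ·) (Category.comp_id _)).trans (Category.comp_id _)).symm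
  -- Forgetting the structure commutes strictly with reindexing, so only unit laws and the coherence
  -- isomorphism of `reindexComp` remain.
  naturality_comp {X Y Z} f g := by
    ext x
    refine (Category.id_comp _).trans (Eq.symm ?_)
    refine (congrArg (_ ≫ ·) ?_).trans (Category.comp_id _)
    refine (Category.id_comp _).trans ((Category.id_comp _).trans ((Category.id_comp _).trans
      ((Category.comp_id _).trans ?_)))
    exact (FilterModel.reindex g.as.unop).map_id _

end ArrowStructure

open Pseudofunctor.CoGrothendieck
open scoped Pseudofunctor.CoGrothendieck

/-! ### Maps to the codomain pseudo-functor in terms of pullback squares -/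

section TotalArrow

variable {D : Type u} [Category.{v} D] [HasPullbacks D]

lemma codomainArrow_map {x y : ∫ᶜ (codomainPseudo D)} (f : x ⟶ y) :
    codomainArrow.map f =
      mapArrow (q := (reindex f.base).obj y.fiber) f.fiber ≫ projArrow f.base y.fiber :=
  Arrow.hom_ext _ _ rfl (Category.id_comp _).symm

variable {K : LocallyDiscrete Dᵒᵖ ⥤ᵖ Cat.{v, max u v}}

/-- The value of a map to the codomain pseudo-functor, as an object of a groupoid of slices. -/
def slice (s : K ⟶ codomainPseudo D) {X : LocallyDiscrete Dᵒᵖ} (k : K.obj X) :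
    Core (Over X.as.unop) :=
  (s.app X).toFunctor.obj k

/-- The action of a map to the codomain pseudo-functor on morphisms. -/
def sliceMap (s : K ⟶ codomainPseudo D) {X : LocallyDiscrete Dᵒᵖ} {k k' : K.obj X} (m : k ⟶ k') :
    slice s k ⟶ slice s k' :=
  (s.app X).toFunctor.map m

/-- The naturality of a map to the codomain pseudo-functor. -/
def sliceNat (s : K ⟶ codomainPseudo D) {X Y : LocallyDiscrete Dᵒᵖ} (f : X ⟶ Y) (k : K.obj X) :
    slice s ((K.map f).toFunctor.obj k) ⟶ (reindex f.as.unop).obj (slice s k) :=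
  (s.naturality f).hom.toNatTrans.app k

/-- The component of a 2-cell between maps to the codomain pseudo-functor. -/
def sliceTwo {s t : K ⟶ codomainPseudo D} (Γ : s ⟶ t) {X : LocallyDiscrete Dᵒᵖ} (k : K.obj X) :
    slice s k ⟶ slice t k :=
  (Γ.as.app X).toNatTrans.app k

/-- The component of a 2-cell between maps to the codomain pseudo-functor, as an isomorphism. -/
def sliceTwoIso {s t : K ⟶ codomainPseudo D} (Γ : s ⟶ t) {X : LocallyDiscrete Dᵒᵖ} (k : K.obj X) :
    slice s k ≅ slice t k :=
  asIso (sliceTwo Γ k)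

/-- The map of arrows given by the naturality of a map to the codomain pseudo-functor. -/
def natArrow (s : K ⟶ codomainPseudo D) {X Y : LocallyDiscrete Dᵒᵖ} (f : X ⟶ Y) (k : K.obj X) :
    objArrow (slice s ((K.map f).toFunctor.obj k)) ⟶ objArrow (slice s k) :=
  mapArrow (sliceNat s f k) ≫ projArrow f.as.unop _

lemma isCart_natArrow (s : K ⟶ codomainPseudo D) {X Y : LocallyDiscrete Dᵒᵖ} (f : X ⟶ Y)
    (k : K.obj X) : IsCart (natArrow s f k) :=
  (isCart_mapArrow _).comp (isCart_projArrow _ _)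

/-- The value of `totalArrow s` at a morphism, as a map between arrows of slices. -/
def totalMap (s : K ⟶ codomainPseudo D) {x y : ∫ᶜ K} (f : x ⟶ y) :
    objArrow (slice s x.fiber) ⟶ objArrow (slice s y.fiber) :=
  (totalArrow s).map f

lemma isCart_totalMap (s : K ⟶ codomainPseudo D) {x y : ∫ᶜ K} (f : x ⟶ y) :
    IsCart (totalMap s f) :=
  totalArrow_isPullback s f

lemma totalMap_id (s : K ⟶ codomainPseudo D) (x : ∫ᶜ K) : totalMap s (𝟙 x) = 𝟙 _ :=
  (totalArrow s).map_id x

lemma totalMap_comp (s : K ⟶ codomainPseudo D) {x y z : ∫ᶜ K} (f : x ⟶ y) (g : y ⟶ z) :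
    totalMap s (f ≫ g) = totalMap s f ≫ totalMap s g :=
  (totalArrow s).map_comp f g

/-- A morphism of `∫ K` is a vertical morphism followed by a reindexing; the square splits
accordingly. -/
lemma totalMap_eq (s : K ⟶ codomainPseudo D) {x y : ∫ᶜ K} (f : x ⟶ y) :
    totalMap s f = mapArrow (sliceMap s f.fiber) ≫ natArrow s f.base.op.toLoc y.fiber := by
  refine (codomainArrow_map _).trans ?_
  refine (congrArg (· ≫ _) (mapArrow_comp _ _)).trans ?_
  exact Category.assoc _ _ _

variable {s t : K ⟶ codomainPseudo D}

/-- This is the modification axiom for `Γ`, moved from the groupoid of slices to squares by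
composing with the projection. -/
lemma natArrow_comp_mapArrow (Γ : s ⟶ t) {X Y : LocallyDiscrete Dᵒᵖ} (f : X ⟶ Y) (k : K.obj X) :
    natArrow s f k ≫ mapArrow (sliceTwo Γ k) = mapArrow (sliceTwo Γ _) ≫ natArrow t f k := by
  have h : sliceTwo Γ ((K.map f).toFunctor.obj k) ≫ sliceNat t f k = sliceNat s f k ≫
        (reindex f.as.unop).map (sliceTwo Γ k) :=
    congr($(Γ.as.naturality f).toNatTrans.app k)
  unfold natArrow
  rw [Category.assoc, ← mapArrow_reindex_projArrow, ← Category.assoc, ← Category.assoc,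
    ← mapArrow_comp, ← h, mapArrow_comp]

/-- A 2-cell acts as a natural transformation between the total functors: on vertical morphisms
because its components are natural, on reindexings by the modification axiom. -/
lemma totalMap_comp_mapArrow (Γ : s ⟶ t) {x y : ∫ᶜ K} (f : x ⟶ y) :
    totalMap s f ≫ mapArrow (sliceTwo Γ y.fiber) =
      mapArrow (sliceTwo Γ x.fiber) ≫ totalMap t f := by
  have h : sliceMap s f.fiber ≫ sliceTwo Γ _ = sliceTwo Γ _ ≫ sliceMap t f.fiber :=
    (Γ.as.app _).toNatTrans.naturality f.fiber
  rw [totalMap_eq, totalMap_eq, Category.assoc, natArrow_comp_mapArrow, ← Category.assoc,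
    ← Category.assoc, ← mapArrow_comp, ← mapArrow_comp, h]

end TotalArrow

/-! ### Lifting maps and 2-cells to arrows with a structure -/

namespace ArrowStructure

variable {D : Type u} [Category.{v} D] [HasPullbacks D] {S : ArrowStructure.{max u v} D}
  {K : LocallyDiscrete Dᵒᵖ ⥤ᵖ Cat.{v, max u v}}

/-- An object of the total category of `S.toPseudo`, as an arrow with a structure. -/
abbrev fiberElt (x : ∫ᶜ S.toPseudo) : S.Elt x.base := x.fiber

lemma natArrow_toCodomain {X Y : LocallyDiscrete Dᵒᵖ} (f : X ⟶ Y) (x : S.Elt X.as.unop) :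
    natArrow S.toCodomain f x = projArrow f.as.unop x.pt :=
  (congrArg (· ≫ _) (mapArrow_id _)).trans (Category.id_comp _)

/-- The vertical part of `f` preserves structures, and reindexing restricts them along the
projection square by definition. -/
lemma restr_totalMap {x y : ∫ᶜ S.toPseudo} (f : x ⟶ y) :
    S.restr (totalMap S.toCodomain f) (isCart_totalMap _ f) (fiberElt y).str =
      (fiberElt x).str := by
  refine Eq.trans ?_ f.fiber.restr_str
  refine (S.restr_congr ((totalMap_eq S.toCodomain f).trans
    (congrArg (_ ≫ ·) (natArrow_toCodomain _ _))) _ _).trans ?_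
  exact S.restr_comp _ _ (isCart_mapArrow _) (isCart_projArrow _ _) _ _

lemma sliceNat_comp_toCodomain (a : K ⟶ S.toPseudo) {X Y : LocallyDiscrete Dᵒᵖ} (f : X ⟶ Y)
    (k : K.obj X) :
    sliceNat (a ≫ S.toCodomain) f k = Elt.Hom.hom ((a.naturality f).hom.toNatTrans.app k) := by
  refine (Category.id_comp _).trans ((congrArg (_ ≫ ·) ?_).trans (Category.comp_id _))
  exact (Category.id_comp _).trans (Category.id_comp _)

section Lift

variable (b : K ⟶ codomainPseudo D)
  (σ : ∀ (X : LocallyDiscrete Dᵒᵖ) (k : K.obj X), S.str (objArrow (slice b k)))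
  (h₁ : ∀ (X : LocallyDiscrete Dᵒᵖ) {k k' : K.obj X} (m : k ⟶ k'),
    S.restr (mapArrow (sliceMap b m)) (isCart_mapArrow _) (σ X k') = σ X k)
  (h₂ : ∀ {X Y : LocallyDiscrete Dᵒᵖ} (f : X ⟶ Y) (k : K.obj X),
    S.restr (natArrow b f k) (isCart_natArrow b f k) (σ X k) = σ Y ((K.map f).toFunctor.obj k))

/-- The component of a lift at an object. -/
def liftApp (X : LocallyDiscrete Dᵒᵖ) : K.obj X ⥤ S.Elt X.as.unop where
  obj k := ⟨(b.app X).toFunctor.obj k, σ X k⟩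
  map m := ⟨(b.app X).toFunctor.map m, h₁ X m⟩
  map_id k := Elt.hom_ext ((b.app X).toFunctor.map_id k)
  map_comp m n := Elt.hom_ext ((b.app X).toFunctor.map_comp m n)

/-- The naturality of a lift. -/
def liftNaturality {X Y : LocallyDiscrete Dᵒᵖ} (f : X ⟶ Y) :
    K.map f ≫ (show K.obj Y ⟶ S.toPseudo.obj Y from (liftApp b σ h₁ Y).toCatHom) ≅
      (show K.obj X ⟶ S.toPseudo.obj X from (liftApp b σ h₁ X).toCatHom) ≫ S.toPseudo.map f :=
  Cat.Hom.isoMk (NatIso.ofComponents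
    (fun k ↦ Elt.isoMk (x := (liftApp b σ h₁ Y).obj ((K.map f).toFunctor.obj k))
      (y := (Elt.reindex S f.as.unop).obj ((liftApp b σ h₁ X).obj k))
      ((Cat.Hom.toNatIso (b.naturality f)).app k) (by
        refine Eq.trans ?_ (h₂ f k)
        exact (S.restr_comp _ _ (isCart_mapArrow _) (isCart_projArrow _ _) _ _).symm))
    (fun m ↦ Elt.hom_ext ((b.naturality f).hom.toNatTrans.naturality m)))

/-- A lift of a map to the codomain pseudo-functor, given by compatible structures. -/
def lift : K ⟶ S.toPseudo where
  app X := (liftApp b σ h₁ X).toCatHom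
  naturality f := liftNaturality b σ h₁ h₂ f
  naturality_naturality η := naturality_of_locallyDiscrete _ (liftNaturality b σ h₁ h₂) η
  naturality_id X := by
    ext k
    exact Elt.hom_ext congr($(b.naturality_id X).toNatTrans.app k)
  naturality_comp f g := by
    ext k
    exact Elt.hom_ext congr($(b.naturality_comp f g).toNatTrans.app k)

/-- The lift of a map composes to it. -/
def liftCompIso : lift b σ h₁ h₂ ≫ S.toCodomain ≅ b :=
  Pseudofunctor.StrongTrans.isoMk
    (fun X ↦ Cat.Hom.isoMk (NatIso.ofComponents
      (fun k ↦ Iso.refl ((b.app X).toFunctor.obj k))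
      (fun _ ↦ (Category.comp_id _).trans (Category.id_comp _).symm)))
    (fun f ↦ by
      ext k
      refine (Category.id_comp _).trans (Eq.symm ?_)
      refine (congrArg (_ ≫ ·) ((reindex f.as.unop).map_id _)).trans ((Category.comp_id _).trans ?_)
      exact sliceNat_comp_toCodomain (lift b σ h₁ h₂) f k)

end Lift

/-- A 2-cell to the codomain pseudo-functor that preserves the structures, as an invertible 2-cell
to the pseudo-functor of arrows with a structure. -/
def isoLift {a a' : K ⟶ S.toPseudo} (Γ : a ≫ S.toCodomain ⟶ a' ≫ S.toCodomain)
    (h : ∀ (X : LocallyDiscrete Dᵒᵖ) (k : K.obj X),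
      S.restr (mapArrow (sliceTwo Γ k)) (isCart_mapArrow _)
        (Elt.str ((a'.app X).toFunctor.obj k)) = Elt.str ((a.app X).toFunctor.obj k)) : a ≅ a' :=
  Pseudofunctor.StrongTrans.isoMk
    (fun X ↦ Cat.Hom.isoMk (NatIso.ofComponents
      (fun k ↦ Elt.isoMk (x := (a.app X).toFunctor.obj k) (y := (a'.app X).toFunctor.obj k)
        (sliceTwoIso Γ k) (h X k))
      (fun m ↦ Elt.hom_ext ((Γ.as.app X).toNatTrans.naturality m))))
    (fun f ↦ by
      ext k
      refine Elt.hom_ext (Eq.trans ?_ (congr($(Γ.as.naturality f).toNatTrans.app k).trans ?_))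
      · exact congrArg (_ ≫ ·) (sliceNat_comp_toCodomain a' f k).symm
      · exact congrArg (· ≫ _) (sliceNat_comp_toCodomain a f k))

end ArrowStructure

/-! ### Squares of composite transformations -/

section Composition

variable {D : Type u} [Category.{v} D] [HasPullbacks D]
  {K K' : LocallyDiscrete Dᵒᵖ ⥤ᵖ Cat.{v, max u v}}

lemma sliceNat_comp (g : K' ⟶ K) (a : K ⟶ codomainPseudo D) {X Y : LocallyDiscrete Dᵒᵖ}
    (f : X ⟶ Y) (k : K'.obj X) :
    sliceNat (g ≫ a) f k = sliceMap a ((g.naturality f).hom.toNatTrans.app k) ≫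
      sliceNat a f ((g.app X).toFunctor.obj k) := by
  refine (Category.id_comp _).trans (congrArg (_ ≫ ·) ?_)
  exact (Category.id_comp _).trans (Category.comp_id _)

lemma natArrow_comp (g : K' ⟶ K) (a : K ⟶ codomainPseudo D) {X Y : LocallyDiscrete Dᵒᵖ}
    (f : X ⟶ Y) (k : K'.obj X) :
    natArrow (g ≫ a) f k = mapArrow (sliceMap a ((g.naturality f).hom.toNatTrans.app k)) ≫
      natArrow a f ((g.app X).toFunctor.obj k) := by
  exact (congrArg (· ≫ _) ((congrArg mapArrow (sliceNat_comp g a f k)).trans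
    (mapArrow_comp _ _))).trans (Category.assoc _ _ _)

lemma sliceMap_id (a : K ⟶ codomainPseudo D) {X : LocallyDiscrete Dᵒᵖ} (k : K.obj X) :
    sliceMap a (𝟙 k) = 𝟙 _ := (a.app X).toFunctor.map_id k

/-- This makes the functoriality of `totalMap` available for naturality squares. -/
lemma natArrow_eq_totalMap (a : K ⟶ codomainPseudo D) {X Y : LocallyDiscrete Dᵒᵖ}
    (f : X ⟶ Y) (k : K.obj X) :
    natArrow a f k = totalMap a (x := ⟨Y.as.unop, (K.map f).toFunctor.obj k⟩)
      (y := ⟨X.as.unop, k⟩) ⟨f.as.unop, 𝟙 _⟩ := by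
  rw [totalMap_eq]
  refine (Category.id_comp _).symm.trans (congrArg (· ≫ _) ?_)
  exact ((congrArg mapArrow (sliceMap_id a _)).trans (mapArrow_id _)).symm

end Composition

/-! ### Maps out of representables and their universal values -/

section Yoneda

variable {D : Type u} [Category.{v} D] {A : D}

lemma yo_hom_ext {x y : ∫ᶜ (yoPseudo A)} {f g : x ⟶ y} (h : f.base = g.base) : f = g :=
  Pseudofunctor.CoGrothendieck.Hom.ext _ _ h (HomGpd.hom_eq _ _)

/-- The map in `∫ C(-, A)` from any object to the universal one. -/
def yoUniv {X : D} (k : HomSet X A) :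
    (⟨X, k⟩ : ∫ᶜ (yoPseudo A)) ⟶ ⟨A, (⟨𝟙 A⟩ : HomSet A A)⟩ :=
  ⟨k.hom, (⟨⟨(Category.comp_id k.hom).symm⟩⟩ : k ⟶ (⟨k.hom ≫ 𝟙 A⟩ : HomSet X A))⟩

variable [HasPullbacks D]

/-- The value of a map `C(-, A) ⟶ 𝕄`. -/
abbrev yoSlice (a : yoPseudo A ⟶ codomainPseudo D) {X : D} (k : HomSet X A) : Core (Over X) :=
  slice (K := yoPseudo A) a (X := ⟨op X⟩) k

/-- The map to the universal value of a map `C(-, A) ⟶ 𝕄`. -/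
def yoArrow (a : yoPseudo A ⟶ codomainPseudo D) {X : D} (k : HomSet X A) :
    objArrow (yoSlice a k) ⟶ objArrow (yoSlice a ⟨𝟙 A⟩) :=
  totalMap a (yoUniv k)

lemma isCart_yoArrow (a : yoPseudo A ⟶ codomainPseudo D) {X : D} (k : HomSet X A) :
    IsCart (yoArrow a k) :=
  isCart_totalMap _ _

/-- The action of a map `C(-, A) ⟶ 𝕄` on morphisms. -/
abbrev yoSliceMap (a : yoPseudo A ⟶ codomainPseudo D) {X : D} {k k' : HomSet X A} (m : k ⟶ k') :
    yoSlice a k ⟶ yoSlice a k' :=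
  sliceMap (K := yoPseudo A) a (X := ⟨op X⟩) m

lemma yoSliceMap_yoArrow (a : yoPseudo A ⟶ codomainPseudo D) {X : D} {k k' : HomSet X A}
    (m : k ⟶ k') : mapArrow (yoSliceMap a m) ≫ yoArrow a k' = yoArrow a k := by
  obtain ⟨k⟩ := k
  obtain ⟨k'⟩ := k'
  obtain rfl : k = k' := m.down.down
  obtain rfl : m = 𝟙 _ := HomGpd.hom_eq _ _
  exact (congrArg (· ≫ _) ((congrArg mapArrow (sliceMap_id a _)).trans (mapArrow_id _))).trans
    (Category.id_comp _)

/-- The naturality of a map `C(-, A) ⟶ 𝕄`, as a pullback square. -/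
def yoNatArrow (a : yoPseudo A ⟶ codomainPseudo D) {X Y : D} (f : Y ⟶ X) (k : HomSet X A) :
    objArrow (yoSlice a (⟨f ≫ k.hom⟩ : HomSet Y A)) ⟶ objArrow (yoSlice a k) :=
  natArrow (K := yoPseudo A) a (X := ⟨op X⟩) f.op.toLoc k

lemma isCart_yoNatArrow (a : yoPseudo A ⟶ codomainPseudo D) {X Y : D} (f : Y ⟶ X)
    (k : HomSet X A) : IsCart (yoNatArrow a f k) :=
  isCart_natArrow _ _ _

lemma yoNatArrow_right (a : yoPseudo A ⟶ codomainPseudo D) {X Y : D} (f : Y ⟶ X)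
    (k : HomSet X A) : (yoNatArrow a f k).right = f :=
  Category.id_comp _

/-- Both sides are values of `totalMap` at morphisms of `∫ C(-, A)`, and such morphisms are
determined by their base since the fibres are discrete. -/
lemma yoNatArrow_yoArrow (a : yoPseudo A ⟶ codomainPseudo D) {X Y : D} (f : Y ⟶ X)
    (k : HomSet X A) : yoNatArrow a f k ≫ yoArrow a k = yoArrow a ⟨f ≫ k.hom⟩ := by
  refine (congrArg (· ≫ _) (natArrow_eq_totalMap (K := yoPseudo A) a (X := ⟨op X⟩)
    f.op.toLoc k)).trans ?_
  exact (totalMap_comp a _ (yoUniv k)).symm.trans (congrArg (totalMap a) (yo_hom_ext rfl))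

lemma yoNatArrow_comp {B : D} (i : A ⟶ B) (a : yoPseudo B ⟶ codomainPseudo D) {X Y : D}
    (f : Y ⟶ X) (k : HomSet X A) :
    yoNatArrow (yoMap i ≫ a) f k =
      mapArrow (yoSliceMap a (k := ⟨(f ≫ k.hom) ≫ i⟩) (k' := ⟨f ≫ k.hom ≫ i⟩)
        ⟨⟨Category.assoc _ _ _⟩⟩) ≫ yoNatArrow a f ⟨k.hom ≫ i⟩ :=
  natArrow_comp (yoMap i) a (X := ⟨op X⟩) f.op.toLoc k

end Yoneda

namespace ArrowStructure

variable {D : Type u} [Category.{v} D] [HasPullbacks D] {S : ArrowStructure.{max u v} D}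

section Lift

variable {A : D} (b : yoPseudo A ⟶ codomainPseudo D) {r : Arrow D} (s : S.str r)
  (e : ∀ {X : D} (k : HomSet X A), objArrow (yoSlice b k) ⟶ r)
  (he : ∀ {X : D} (k : HomSet X A), IsCart (e k))

lemma yoLift_map (X : D) {k k' : HomSet X A} (m : k ⟶ k') :
    S.restr (mapArrow (yoSliceMap b m)) (isCart_mapArrow _) (S.restr (e k') (he k') s) =
      S.restr (e k) (he k) s := by
  obtain ⟨k⟩ := k
  obtain ⟨k'⟩ := k'
  obtain rfl : k = k' := m.down.down
  obtain rfl : m = 𝟙 _ := HomGpd.hom_eq _ _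
  exact (S.restr_congr ((congrArg mapArrow (sliceMap_id b _)).trans (mapArrow_id _)) _ _).trans
    (S.restr_id _ _)

lemma yoLift_natArrow
    (hn : ∀ {X Y : D} (f : Y ⟶ X) (k : HomSet X A),
      yoNatArrow b f k ≫ e k = e ⟨f ≫ k.hom⟩)
    {X Y : D} (f : Y ⟶ X) (k : HomSet X A) :
    S.restr (yoNatArrow b f k) (isCart_yoNatArrow _ _ _) (S.restr (e k) (he k) s) =
      S.restr (e ⟨f ≫ k.hom⟩) (he _) s :=
  (S.restr_comp _ _ _ _ ((isCart_yoNatArrow b f k).comp (he _)) _).symm.trans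
      (S.restr_congr (hn f k) _ _)

variable (hn : ∀ {X Y : D} (f : Y ⟶ X) (k : HomSet X A), yoNatArrow b f k ≫ e k = e ⟨f ≫ k.hom⟩)

/-- The lift of a map `C(-, A) ⟶ 𝕄` to arrows with a structure that is given by a compatible family
of pullback squares. -/
def yoLift : yoPseudo A ⟶ S.toPseudo :=
  lift b (fun X k ↦ S.restr (e (X := X.as.unop) k) (he k) s)
    (fun X _ _ m ↦ yoLift_map b s e he X.as.unop m) (fun f k ↦ yoLift_natArrow b s e he hn f.as.unop k)

/-- The lift of a map composes to it. -/
def yoLiftIso : yoLift b s e he hn ≫ S.toCodomain ≅ b :=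
  liftCompIso b (fun X k ↦ S.restr (e (X := X.as.unop) k) (he k) s)
    (fun X _ _ m ↦ yoLift_map b s e he X.as.unop m) (fun f k ↦ yoLift_natArrow b s e he hn f.as.unop k)

end Lift

variable {K : LocallyDiscrete Dᵒᵖ ⥤ᵖ Cat.{v, max u v}}

/-- The value of a map to the pseudo-functor of arrows with a structure. -/
abbrev eltOf (a : K ⟶ S.toPseudo) {X : LocallyDiscrete Dᵒᵖ} (k : K.obj X) : S.Elt X.as.unop :=
  (a.app X).toFunctor.obj k

lemma restr_natArrow (a : K ⟶ S.toPseudo) {X Y : LocallyDiscrete Dᵒᵖ} (f : X ⟶ Y) (k : K.obj X) :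
    S.restr (natArrow (a ≫ S.toCodomain) f k) (isCart_natArrow _ _ _) (eltOf a k).str =
      (eltOf a ((K.map f).toFunctor.obj k)).str := by
  refine Eq.trans ?_ ((a.naturality f).hom.toNatTrans.app k).restr_str
  refine Eq.trans ?_ (S.restr_comp _ _ (isCart_mapArrow _) (isCart_projArrow _ _)
    ((isCart_mapArrow _).comp (isCart_projArrow _ _)) _)
  exact S.restr_congr (congrArg (mapArrow · ≫ _) (sliceNat_comp_toCodomain a f k)) _ _

lemma restr_totalMap_comp (a : K ⟶ S.toPseudo) {x y : ∫ᶜ K} (f : x ⟶ y) :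
    S.restr (totalMap (a ≫ S.toCodomain) f) (isCart_totalMap _ f) (eltOf a y.fiber).str =
      (eltOf a x.fiber).str := by
  refine (S.restr_congr (totalMap_eq (a ≫ S.toCodomain) f) _ _).trans ?_
  refine (S.restr_comp _ _ (isCart_mapArrow _) (isCart_natArrow _ _ _) _ _).trans ?_
  refine (congrArg _ (restr_natArrow a _ _)).trans ?_
  exact ((a.app _).toFunctor.map f.fiber).restr_str

/-- For maps out of `C(-, A)`, compatibility with structures can be checked at the universal
element. -/
lemma restr_sliceTwo {A : D} {a a' : yoPseudo A ⟶ S.toPseudo}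
    (Γ : a ≫ S.toCodomain ⟶ a' ≫ S.toCodomain)
    (h : S.restr (mapArrow (sliceTwo Γ (X := ⟨op A⟩) (⟨𝟙 A⟩ : HomSet A A))) (isCart_mapArrow _)
      (eltOf a' (X := ⟨op A⟩) (⟨𝟙 A⟩ : HomSet A A)).str =
        (eltOf a (X := ⟨op A⟩) (⟨𝟙 A⟩ : HomSet A A)).str)
    (X : LocallyDiscrete Dᵒᵖ) (k : HomSet X.as.unop A) :
    S.restr (mapArrow (sliceTwo Γ (X := X) k)) (isCart_mapArrow _) (eltOf a' (X := X) k).str =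
      (eltOf a (X := X) k).str := by
  -- The structures at `k` are restrictions of those at the identity of `A`, and the naturality of
  -- `Γ` carries the comparison at the identity to the one at `k`.
  have e := restr_totalMap_comp a (yoUniv k)
  have e' := restr_totalMap_comp a' (yoUniv k)
  refine (congrArg _ e').symm.trans (Eq.trans ?_ e)
  refine (S.restr_comp (mapArrow (sliceTwo Γ (X := X) k))
    (totalMap (a' ≫ S.toCodomain) (yoUniv k)) _ _
    ((isCart_mapArrow _).comp (isCart_totalMap _ _)) _).symm.trans ?_
  refine (S.restr_congr (totalMap_comp_mapArrow Γ (yoUniv k)).symm _ _).trans ?_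
  refine (S.restr_comp _ _ (isCart_totalMap _ _) (isCart_mapArrow _) _ _).trans ?_
  exact congrArg _ h

end ArrowStructure

/-! ### Presheaves of structures give notions of fibred structure -/

namespace ArrowStructure

variable {D : Type u} [Category.{v} D] (S : ArrowStructure.{max u v} D)

variable {S} in
-- Needed for the uniqueness of lifts: the structure on the domain of a structure-preserving
-- isomorphism is the restricted one, so the lift is equal to the chosen one as an object of the
-- slice.
lemma Elt.over_mk_eq {X : D} {x : S.Elt X} {p : Core (Over X)} {s : S.str (objArrow p)}
    (m : p ⟶ x.pt) (h : S.restr (mapArrow m) (isCart_mapArrow _) x.str = s) :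
    (Over.mk (Y := ⟨p, S.restr (mapArrow m) (isCart_mapArrow _) x.str⟩)
      (⟨m, rfl⟩ : Elt.Hom ⟨p, _⟩ x) : Over x) = Over.mk (Y := ⟨p, s⟩) (⟨m, h⟩ : Elt.Hom ⟨p, s⟩ x) := by
  subst h
  rfl

/-- The lift of an isomorphism to `x.pt` is forced, as its domain has to carry the restriction of
the structure of `x`. -/
lemma isDiscreteFibration (X : D) : IsDiscreteFibration (Elt.forget S X) := by
  intro x
  refine Function.bijective_iff_has_inverse.2 ⟨fun Z ↦
    Over.mk (Y := ⟨Z.left, S.restr (mapArrow Z.hom) (isCart_mapArrow _) x.str⟩)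
      (⟨Z.hom, rfl⟩ : Elt.Hom ⟨Z.left, S.restr (mapArrow Z.hom) (isCart_mapArrow _) x.str⟩ x),
    fun Z ↦ ?_, fun Z ↦ rfl⟩
  obtain ⟨⟨p, s⟩, ⟨⟩, ⟨m, h⟩⟩ := Z
  exact Elt.over_mk_eq m h

lemma small_fibre (hs : ∀ p : Arrow D, Small.{w} (S.str p)) (X : D) (p : Core (Over X)) :
    Small.{w} {x : S.Elt X // x.pt = p} := by
  have := hs (objArrow p)
  refine small_of_injective (β := S.str (objArrow p)) (f := fun x ↦ x.2 ▸ x.1.str) ?_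
  rintro ⟨⟨q, s⟩, rfl⟩ ⟨⟨q', s'⟩, h⟩ e
  obtain rfl : q' = q := h
  obtain rfl : s = s' := e
  rfl

variable [HasPullbacks D]

/-- The notion of fibred structure given by structures on arrows. -/
def toFibredStructure (hs : ∀ p : Arrow D, Small.{w} (S.str p)) : FibredStructure.{w} D where
  toPseudofunctor := S.toPseudo
  isGroupoid X := inferInstanceAs (IsGroupoid (S.Elt X.as.unop))
  toCodomain := S.toCodomain
  isDiscreteFibration X := S.isDiscreteFibration X.as.unop
  small_fibre X p := S.small_fibre hs X.as.unop p

/-- For every arrow, there is a universal pullback of it with a structure. -/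
def IsRepresentable : Prop :=
  ∀ p : Arrow D, ∃ (r : Arrow D) (c : r ⟶ p) (s : S.str r), IsCart c ∧
    ∀ (q : Arrow D) (d : q ⟶ p) (_ : IsCart d) (t : S.str q),
      ∃! m : q ⟶ r, m ≫ c = d ∧ ∃ hm : IsCart m, S.restr m hm s = t

/-- The arrows that admit a structure are precisely the fibrations. -/
def CoversFibrations [CategoryWithFibrations D] : Prop :=
  ∀ p : Arrow D, Nonempty (S.str p) ↔ fibrations D p.hom

/-- Structures on fibrations can be extended along cofibrations. -/
def IsAcyclic [CategoryWithFibrations D] [CategoryWithCofibrations D] : Prop :=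
  ∀ {p q : Arrow D} (c : q ⟶ p) (hc : IsCart c), cofibrations D c.right → fibrations D p.hom →
    ∀ s : S.str q, ∃ t : S.str p, S.restr c hc t = s

variable {S}

lemma coversFibrations [CategoryWithFibrations D] (hs : ∀ p : Arrow D, Small.{w} (S.str p))
    (h : S.CoversFibrations) : (S.toFibredStructure hs).CoversFibrations := by
  intro X p
  refine Iff.trans ⟨?_, ?_⟩ (h (objArrow (show Core (Over X.as.unop) from p)))
  · rintro ⟨x, rfl⟩
    exact ⟨Elt.str x⟩
  · rintro ⟨s⟩
    exact ⟨(⟨p, s⟩ : S.Elt X.as.unop), rfl⟩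

/-! ### Universal structures give pseudo-pullbacks -/

section Representable

variable {Z R : D} (a : yoPseudo Z ⟶ codomainPseudo D) {r : Arrow D}
  {c : r ⟶ objArrow (yoSlice a ⟨𝟙 Z⟩)} (hc : IsCart c)

/-- The square to the universal arrow with a structure. -/
def toUniv {X : D} (k : HomSet X r.right) :
    objArrow (yoSlice (yoMap c.right ≫ a) k) ⟶ r :=
  (hc.exists_lift (yoArrow a ⟨k.hom ≫ c.right⟩) k.hom rfl).choose

lemma toUniv_comp {X : D} (k : HomSet X r.right) :
    toUniv a hc k ≫ c = yoArrow a ⟨k.hom ≫ c.right⟩ :=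
  (hc.exists_lift (yoArrow a ⟨k.hom ≫ c.right⟩) k.hom rfl).choose_spec.1

lemma toUniv_right {X : D} (k : HomSet X r.right) : (toUniv a hc k).right = k.hom :=
  (hc.exists_lift (yoArrow a ⟨k.hom ≫ c.right⟩) k.hom rfl).choose_spec.2

lemma isCart_toUniv {X : D} (k : HomSet X r.right) : IsCart (toUniv a hc k) :=
  IsCart.of_comp hc (by rw [toUniv_comp]; exact isCart_yoArrow _ _)

/-- After composition with the Cartesian square `c` this becomes the compatibility of the squares
`yoArrow a`, and the codomain parts agree. -/
lemma yoNatArrow_toUniv {X Y : D} (f : Y ⟶ X) (k : HomSet X r.right) :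
    yoNatArrow (yoMap c.right ≫ a) f k ≫ toUniv a hc k = toUniv a hc ⟨f ≫ k.hom⟩ := by
  refine hc.hom_ext ?_ ?_
  · rw [Category.assoc, toUniv_comp, toUniv_comp]
    refine (congrArg (· ≫ _) (yoNatArrow_comp c.right a f k)).trans ?_
    refine (Category.assoc _ _ _).trans ?_
    refine (congrArg (_ ≫ ·) (yoNatArrow_yoArrow a f ⟨k.hom ≫ c.right⟩)).trans ?_
    exact yoSliceMap_yoArrow a _
  · rw [toUniv_right]
    refine (congrArg (_ ≫ ·) (toUniv_right a hc k)).trans ?_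
    exact congrArg (· ≫ _) (yoNatArrow_right _ f k)

variable (s : S.str r)

/-- The universal structure, as a map from a representable. -/
def univLift : yoPseudo r.right ⟶ S.toPseudo :=
  yoLift (yoMap c.right ≫ a) s (toUniv a hc) (isCart_toUniv a hc) (yoNatArrow_toUniv a hc)

/-- The universal structure is a structure on the restriction of the given arrow. -/
def univLiftIso : univLift a hc s ≫ S.toCodomain ≅ yoMap c.right ≫ a :=
  yoLiftIso (yoMap c.right ≫ a) s (toUniv a hc) (isCart_toUniv a hc) (yoNatArrow_toUniv a hc)

/-- An object of the pseudo-pullback at `X` is a structured arrow over `X` with an isomorphism to a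
value of `a`, that is, with a pullback square to the universal value of `a`. By `hr` these are
classified by maps from `X` to the codomain of `r`. Existence in `hr` gives essential surjectivity
and uniqueness gives fullness; faithfulness holds because the source is discrete. -/
lemma isPseudoPullback_univLift
    (hr : ∀ (q : Arrow D) (d : q ⟶ objArrow (yoSlice a ⟨𝟙 Z⟩)) (_ : IsCart d) (t : S.str q),
      ∃! m : q ⟶ r, m ≫ c = d ∧ ∃ hm : IsCart m, S.restr m hm s = t) :
    IsPseudoPullback (univLift a hc s) (yoMap c.right) S.toCodomain a (univLiftIso a hc s) := by
  intro X
  let E := (CategoricalPullback.CatCommSqOver.toFunctorToCategoricalPullback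
    (S.toCodomain.app X).toFunctor (a.app X).toFunctor ((yoPseudo r.right).obj X)).obj
      { fst := ((univLift a hc s).app X).toFunctor
        snd := ((yoMap c.right).app X).toFunctor
        iso := Cat.Hom.toNatIso (isoApp (univLiftIso a hc s) X) }
  have h₁ : E.Faithful := ⟨fun {k k'} m n _ ↦ HomGpd.hom_eq (X := X.as.unop) _ _⟩
  have h₂ : E.Full := by
    refine ⟨fun {k k'} g ↦ ?_⟩
    change HomSet X.as.unop r.right at k k'
    let n : (⟨k.hom ≫ c.right⟩ : HomSet X.as.unop Z) ⟶ ⟨k'.hom ≫ c.right⟩ := g.snd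
    let g₁ : Elt.Hom (S := S) (X := X.as.unop) ⟨_, S.restr (toUniv a hc k) (isCart_toUniv a hc k) s⟩
      ⟨_, S.restr (toUniv a hc k') (isCart_toUniv a hc k') s⟩ := g.fst
    have hg : g₁.hom = yoSliceMap a n :=
      (Category.comp_id _).symm.trans (g.w.trans (Category.id_comp _))
    -- The squares to `r` given by `k` and, via `n`, by `k'` lie over the same square and restrict
    -- `s` to the same structure, so they coincide; their codomain parts are `k` and `k'`.
    have hk : k.hom = k'.hom := by
      obtain ⟨m, -, hm⟩ := hr _ (yoArrow a ⟨k.hom ≫ c.right⟩) (isCart_yoArrow _ _)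
        (S.restr (toUniv a hc k) (isCart_toUniv a hc k) s)
      have e₁ := hm (toUniv a hc k) ⟨toUniv_comp a hc k, isCart_toUniv a hc k, rfl⟩
      have e₂ := hm (mapArrow (yoSliceMap a n) ≫ toUniv a hc k') ⟨?_,
        (isCart_mapArrow _).comp (isCart_toUniv a hc k'), ?_⟩
      · have e₃ := congr(($(e₁.trans e₂.symm)).right)
        rw [toUniv_right] at e₃
        exact e₃.trans ((Category.id_comp _).trans (toUniv_right a hc k'))
      · exact (Category.assoc _ _ _).trans ((congrArg (_ ≫ ·) (toUniv_comp a hc k')).trans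
          (yoSliceMap_yoArrow a n))
      · refine (S.restr_comp _ _ (isCart_mapArrow _) (isCart_toUniv a hc k') _ _).trans ?_
        refine Eq.trans ?_ g₁.restr_str
        exact S.restr_congr (congrArg mapArrow hg.symm) _ _
    let m : k ⟶ k' := ⟨⟨hk⟩⟩
    refine ⟨m, CategoricalPullback.hom_ext ?_ (HomGpd.hom_eq (X := X.as.unop) _ _)⟩
    have hm := (Category.comp_id _).symm.trans ((E.map m).w.trans (Category.id_comp _))
    exact Elt.hom_ext (hm.trans ((congrArg (yoSliceMap a) (HomGpd.hom_eq _ _)).trans hg.symm))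
  have h₃ : E.EssSurj := by
    refine ⟨fun Y ↦ ?_⟩
    let f : HomSet X.as.unop Z := Y.snd
    let x : S.Elt X.as.unop := Y.fst
    let i : x.pt ≅ yoSlice a f := Y.iso
    -- The codomain part of the classifying square is the required preimage.
    obtain ⟨m, ⟨hm, hm', hs⟩, -⟩ := hr (objArrow x.pt) (mapArrow i.hom ≫ yoArrow a f)
      ((isCart_mapArrow _).comp (isCart_yoArrow _ _)) x.str
    let k : HomSet X.as.unop r.right := ⟨m.right⟩
    have hk : k.hom ≫ c.right = f.hom := congr(($hm).right).trans (Category.id_comp _)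
    let j : (⟨k.hom ≫ c.right⟩ : HomSet X.as.unop Z) ≅ f := HomGpd.isoOfEq hk
    let j' : yoSlice a ⟨k.hom ≫ c.right⟩ ≅ yoSlice a f := (a.app X).toFunctor.mapIso j
    let l : (⟨_, S.restr (toUniv a hc k) (isCart_toUniv a hc k) s⟩ : S.Elt X.as.unop) ≅ x :=
      Elt.isoMk (j' ≪≫ i.symm) (by
        rw [← hs]
        refine (S.restr_comp _ _ _ _ ((isCart_mapArrow _).comp hm') _).symm.trans
          (S.restr_congr ?_ _ _)
        refine hc.hom_ext ?_ ?_
        · rw [toUniv_comp, Category.assoc, hm, ← Category.assoc, ← mapArrow_comp]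
          refine (congrArg (mapArrow · ≫ _) ((Category.assoc _ _ _).trans
            ((congrArg (_ ≫ ·) i.inv_hom_id).trans (Category.comp_id _)))).trans ?_
          exact yoSliceMap_yoArrow a j.hom
        · rw [toUniv_right]
          exact Category.id_comp _)
    refine ⟨k, ⟨CategoricalPullback.mkIso l j ?_⟩⟩
    refine Eq.trans ?_ (Category.id_comp _).symm
    exact (Category.assoc _ _ _).trans
      ((congrArg (_ ≫ ·) i.inv_hom_id).trans (Category.comp_id _))
  exact {}

end Representable

lemma isLocallyRepresentable (hs : ∀ p : Arrow D, Small.{w} (S.str p)) (h : S.IsRepresentable) :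
    (S.toFibredStructure hs).IsLocallyRepresentable := by
  intro Z a
  obtain ⟨r, c, s, hc, hr⟩ := h (objArrow (yoSlice a ⟨𝟙 Z⟩))
  exact ⟨r.right, univLift a hc s, yoMap c.right, univLiftIso a hc s,
    isPseudoPullback_univLift a hc s hr⟩

end ArrowStructure

/-! ### Passing between the fibrations and all arrows -/

section Fibrations

variable {D : Type u} [Category.{v} D] [HasPullbacks D] [CategoryWithFibrations D]
  [(fibrations D).IsStableUnderBaseChange] {K : LocallyDiscrete Dᵒᵖ ⥤ᵖ Cat.{v, max u v}}

variable (D) in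
/-- The inclusion `𝔽ib ⟶ 𝕄`. -/
def fibInclusion : fibPseudo D ⟶ codomainPseudo D := (fibProperty D).ι

/-- The naturality of a map to the pseudo-functor of fibrations. -/
def fibNat (b : K ⟶ fibPseudo D) {X Y : LocallyDiscrete Dᵒᵖ} (f : X ⟶ Y) (k : K.obj X) :
    slice (b ≫ fibInclusion D) ((K.map f).toFunctor.obj k) ⟶
      (reindex f.as.unop).obj (slice (b ≫ fibInclusion D) k) :=
  ((b.naturality f).hom.toNatTrans.app k).hom

lemma sliceNat_comp_fibInclusion (b : K ⟶ fibPseudo D) {X Y : LocallyDiscrete Dᵒᵖ} (f : X ⟶ Y)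
    (k : K.obj X) : sliceNat (b ≫ fibInclusion D) f k = fibNat b f k := by
  refine (Category.id_comp _).trans ((congrArg (_ ≫ ·) ?_).trans (Category.comp_id _))
  exact (Category.id_comp _).trans (Category.id_comp _)

lemma slice_fibration (b : K ⟶ fibPseudo D) {X : LocallyDiscrete Dᵒᵖ} (k : K.obj X) :
    fibrations D (arr (slice (b ≫ fibInclusion D) k)) :=
  ((b.app X).toFunctor.obj k).property

/-- A 2-cell to the codomain pseudo-functor gives a 2-cell to the pseudo-functor of fibrations. -/
def isoFib {b b' : K ⟶ fibPseudo D} (Γ : b ≫ fibInclusion D ⟶ b' ≫ fibInclusion D) : b ≅ b' :=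
  Pseudofunctor.StrongTrans.isoMk
    (fun X ↦ Cat.Hom.isoMk (NatIso.ofComponents
      (fun k ↦ ObjectProperty.isoMk _ (X := (b.app X).toFunctor.obj k)
        (Y := (b'.app X).toFunctor.obj k) (sliceTwoIso Γ k))
      (fun m ↦ ObjectProperty.hom_ext _ ((Γ.as.app X).toNatTrans.naturality m))))
    (fun f ↦ by
      ext k
      refine ObjectProperty.hom_ext _
        (Eq.trans ?_ (congr($(Γ.as.naturality f).toNatTrans.app k).trans ?_))
      · exact congrArg (_ ≫ ·) (sliceNat_comp_fibInclusion b' f k).symm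
      · exact congrArg (· ≫ _) (sliceNat_comp_fibInclusion b f k))

/-- The map to the fibrations composes to the map to all arrows. -/
def toFibIso {F : FibredStructure.{w} D} (h : F.CoversFibrations) :
    F.toFib h ≫ fibInclusion D ≅ F.toCodomain :=
  Pseudofunctor.StrongTrans.isoMk
    (fun X ↦ Cat.Hom.isoMk (NatIso.ofComponents
      (fun x ↦ Iso.refl (slice F.toCodomain x))
      (fun _ ↦ (Category.comp_id _).trans (Category.id_comp _).symm)))
    (fun f ↦ by
      ext x
      refine (Category.id_comp _).trans (Eq.symm ?_)
      refine (congrArg (_ ≫ ·) ((reindex f.as.unop).map_id _)).trans ((Category.comp_id _).trans ?_)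
      exact sliceNat_comp_fibInclusion (F.toFib h) f x)

variable {F : FibredStructure.{w} D} (h : F.CoversFibrations)
  {K K' : LocallyDiscrete Dᵒᵖ ⥤ᵖ Cat.{v, max u v}}

/-- A 2-cell between maps to the pseudo-functor of fibrations, as a 2-cell between maps to the
codomain pseudo-functor. -/
def twoCell {a : K ⟶ F.toPseudofunctor} {g : K ⟶ K'} {b : K' ⟶ fibPseudo D}
    (θ : a ≫ F.toFib h ⟶ g ≫ b) : a ≫ F.toCodomain ⟶ g ≫ b ≫ fibInclusion D :=
  a ◁ (toFibIso h).inv ≫ (α_ _ _ _).inv ≫ θ ▷ fibInclusion D ≫ (α_ _ _ _).hom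

/-- The associators and `toFibIso` have identity components, so only the component of `θ` remains.
-/
lemma sliceTwo_twoCell {a : K ⟶ F.toPseudofunctor} {g : K ⟶ K'} {b : K' ⟶ fibPseudo D}
    (θ : a ≫ F.toFib h ⟶ g ≫ b) {X : LocallyDiscrete Dᵒᵖ} (k : K.obj X) :
    sliceTwo (twoCell h θ) k = ((θ.as.app X).toNatTrans.app k).hom :=
  (Category.id_comp _).trans ((Category.id_comp _).trans (Category.comp_id _))

/-- A 2-cell `l ≫ φ ≅ b` of maps to the pseudo-functor of fibrations, from a 2-cell of maps to the
codomain pseudo-functor. -/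
def fibTwoCell {l : K ⟶ F.toPseudofunctor} {b : K ⟶ fibPseudo D}
    (e : l ≫ F.toCodomain ⟶ b ≫ fibInclusion D) : l ≫ F.toFib h ≅ b :=
  isoFib ((α_ _ _ _).hom ≫ l ◁ (toFibIso h).hom ≫ e)

lemma fibTwoCell_app {l : K ⟶ F.toPseudofunctor} {b : K ⟶ fibPseudo D}
    (e : l ≫ F.toCodomain ⟶ b ≫ fibInclusion D) {X : LocallyDiscrete Dᵒᵖ} (k : K.obj X) :
    (((fibTwoCell h e).hom.as.app X).toNatTrans.app k).hom = sliceTwo e k :=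
  (Category.id_comp _).trans (Category.id_comp _)

end Fibrations

/-! ### Extension of structures gives acyclic fibrations -/

namespace ArrowStructure

variable {D : Type u} [Category.{v} D] [HasPullbacks D] {S : ArrowStructure.{max u v} D}

section Extension

variable {K K' : LocallyDiscrete Dᵒᵖ ⥤ᵖ Cat.{v, max u v}}

/-- The 2-cell from a map `a` to a lift. -/
def liftTwoCell {a : K ⟶ S.toPseudo} {g : K ⟶ K'} {b : K' ⟶ codomainPseudo D}
    {l : K' ⟶ S.toPseudo} (Γ : a ≫ S.toCodomain ⟶ g ≫ b) (e : l ≫ S.toCodomain ≅ b) :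
    a ≫ S.toCodomain ⟶ (g ≫ l) ≫ S.toCodomain :=
  Γ ≫ g ◁ e.inv ≫ (α_ _ _ _).inv

lemma sliceTwo_liftTwoCell {a : K ⟶ S.toPseudo} {g : K ⟶ K'} {b : K' ⟶ codomainPseudo D}
    {l : K' ⟶ S.toPseudo} (Γ : a ≫ S.toCodomain ⟶ g ≫ b) (e : l ≫ S.toCodomain ≅ b)
    {X : LocallyDiscrete Dᵒᵖ} (k : K.obj X) :
    sliceTwo (liftTwoCell Γ e) k = sliceTwo Γ k ≫ sliceTwo e.inv ((g.app X).toFunctor.obj k) :=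
  congrArg (_ ≫ ·) (Category.comp_id _)

/-- Supplies the condition that the two cells of a filler paste to the given 2-cell. -/
lemma liftTwoCell_comp {a : K ⟶ S.toPseudo} {g : K ⟶ K'} {b : K' ⟶ codomainPseudo D}
    {l : K' ⟶ S.toPseudo} (Γ : a ≫ S.toCodomain ⟶ g ≫ b) (e : l ≫ S.toCodomain ≅ b)
    {X : LocallyDiscrete Dᵒᵖ} (k : K.obj X) :
    sliceTwo (liftTwoCell Γ e) k ≫ sliceTwo e.hom ((g.app X).toFunctor.obj k) = sliceTwo Γ k := by
  have h : sliceTwo e.inv ((g.app X).toFunctor.obj k) ≫ sliceTwo e.hom ((g.app X).toFunctor.obj k) =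
      𝟙 _ :=
    congr(($(e.inv_hom_id).as.app X).toNatTrans.app ((g.app X).toFunctor.obj k))
  rw [sliceTwo_liftTwoCell]
  exact (Category.assoc _ _ _).trans ((congrArg (_ ≫ ·) h).trans (Category.comp_id _))

variable {A B : D} (i : A ⟶ B) {a : yoPseudo A ⟶ S.toPseudo} {b' : yoPseudo B ⟶ codomainPseudo D}
  (Γ : a ≫ S.toCodomain ⟶ yoMap i ≫ b')

/-- The pullback square given by a commutative square of maps from representables. -/
def extSquare : objArrow (yoSlice (a ≫ S.toCodomain) ⟨𝟙 A⟩) ⟶ objArrow (yoSlice b' ⟨𝟙 B⟩) :=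
  mapArrow (sliceTwo Γ (X := ⟨op A⟩) (⟨𝟙 A⟩ : HomSet A A)) ≫ yoArrow b' ⟨𝟙 A ≫ i⟩

lemma isCart_extSquare : IsCart (extSquare i Γ) := (isCart_mapArrow _).comp (isCart_yoArrow _ _)

lemma extSquare_right : (extSquare i Γ).right = i := (Category.id_comp _).trans (Category.id_comp _)

variable (t : S.str (objArrow (yoSlice b' ⟨𝟙 B⟩)))

/-- The map from a representable given by a structure on an arrow. -/
def extLift : yoPseudo B ⟶ S.toPseudo :=
  yoLift b' t (yoArrow b') (isCart_yoArrow b') (yoNatArrow_yoArrow b')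

/-- The map given by a structure on an arrow composes to the map given by the arrow. -/
def extLiftIso : extLift t ≫ S.toCodomain ≅ b' :=
  yoLiftIso b' t (yoArrow b') (isCart_yoArrow b') (yoNatArrow_yoArrow b')

lemma sliceTwo_extLiftIso_inv {X : D} (k : HomSet X B) :
    sliceTwo (extLiftIso t).inv (X := ⟨op X⟩) k = 𝟙 (yoSlice b' k) := rfl

lemma sliceTwo_liftTwoCell_extLiftIso {X : D} (k : HomSet X A) :
    sliceTwo (liftTwoCell Γ (extLiftIso t)) (X := ⟨op X⟩) k =
      (show yoSlice (a ≫ S.toCodomain) k ⟶ yoSlice b' ⟨k.hom ≫ i⟩ from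
        sliceTwo Γ (X := ⟨op X⟩) k) := by
  refine (sliceTwo_liftTwoCell Γ (extLiftIso t) (X := ⟨op X⟩) k).trans ?_
  have h := sliceTwo_extLiftIso_inv t (⟨k.hom ≫ i⟩ : HomSet X B)
  exact (congrArg (sliceTwo Γ (X := ⟨op X⟩) k ≫ ·) h).trans (Category.comp_id _)

/-- The condition `ht` that `t` extends the structure of `a` at the identity of `A` is turned into
the hypothesis of `restr_sliceTwo`, since `extSquare` is the component of the 2-cell followed by a
square along which `extLift` restricts `t`. -/
lemma restr_extSquare (ht : S.restr (extSquare i Γ) (isCart_extSquare i Γ) t =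
      (eltOf a (X := ⟨op A⟩) (⟨𝟙 A⟩ : HomSet A A)).str) :
    S.restr (mapArrow (sliceTwo (liftTwoCell Γ (extLiftIso t)) (X := ⟨op A⟩) (⟨𝟙 A⟩ : HomSet A A)))
      (isCart_mapArrow _)
      (eltOf (yoMap i ≫ extLift t) (X := ⟨op A⟩) (⟨𝟙 A⟩ : HomSet A A)).str =
        (eltOf a (X := ⟨op A⟩) (⟨𝟙 A⟩ : HomSet A A)).str := by
  have hd : mapArrow (sliceTwo (liftTwoCell Γ (extLiftIso t)) (X := ⟨op A⟩) (⟨𝟙 A⟩ : HomSet A A)) ≫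
      yoArrow b' ⟨𝟙 A ≫ i⟩ = extSquare i Γ :=
    congrArg (mapArrow · ≫ _) (sliceTwo_liftTwoCell_extLiftIso i Γ t ⟨𝟙 A⟩)
  rw [← ht]
  refine Eq.trans ?_ (S.restr_congr hd ((isCart_mapArrow _).comp (isCart_yoArrow _ _)) t)
  exact (S.restr_comp _ _ (isCart_mapArrow _) (isCart_yoArrow _ _) _ t).symm

end Extension

variable [CategoryWithFibrations D] [CategoryWithCofibrations D]
  [(fibrations D).IsStableUnderBaseChange] (hs : ∀ p : Arrow D, Small.{w} (S.str p))

/-- By Yoneda, the lifting problem amounts to the pullback square `extSquare` over `i`, from a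
structured arrow to a fibration. An extension `t` of the structure defines the filler `extLift t`.
That the 2-cell from `a` preserves structures only has to be tested at the identity of `A`. -/
lemma isAcyclicFibration (h : S.CoversFibrations) (h' : S.IsAcyclic) :
    IsAcyclicFibration ((S.toFibredStructure hs).toFib (coversFibrations hs h)) := by
  intro A B i hi a b θ
  let H := coversFibrations hs h
  let Γ : (show yoPseudo A ⟶ S.toPseudo from a) ≫ S.toCodomain ⟶ yoMap i ≫ b ≫ fibInclusion D :=
    twoCell H θ.hom
  have hΓ (X : LocallyDiscrete Dᵒᵖ) (k : HomSet X.as.unop A) :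
      sliceTwo Γ (X := X) k = ((θ.hom.as.app X).toNatTrans.app k).hom := sliceTwo_twoCell H θ.hom k
  have hb : fibrations D (objArrow (yoSlice (b ≫ fibInclusion D) ⟨𝟙 B⟩)).hom := slice_fibration b _
  have hi' : cofibrations D (extSquare i Γ).right := by
    rw [extSquare_right]
    exact hi
  clear_value Γ
  obtain ⟨t, ht⟩ := h' _ (isCart_extSquare i Γ) hi' hb
    (eltOf (show yoPseudo A ⟶ S.toPseudo from a) (X := ⟨op A⟩) (⟨𝟙 A⟩ : HomSet A A)).str
  have hη := restr_sliceTwo _ (restr_extSquare i Γ t ht)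
  have hc (X : LocallyDiscrete Dᵒᵖ) (k : HomSet X.as.unop A) :=
    liftTwoCell_comp Γ (extLiftIso t) (X := X) k
  refine ⟨extLift t, isoLift (liftTwoCell Γ (extLiftIso t)) hη,
    fibTwoCell (F := S.toFibredStructure hs) H (extLiftIso t).hom, ?_⟩
  -- The pasting equation is checked componentwise on the underlying isomorphisms of arrows.
  refine Pseudofunctor.StrongTrans.homCategory.ext fun X ↦ ?_
  ext k
  refine ObjectProperty.hom_ext _ (Eq.symm ?_)
  have h₁ := fibTwoCell_app (F := S.toFibredStructure hs) H (extLiftIso t).hom (X := X) (((yoMap i).app X).toFunctor.obj k)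
  have h₂ := (hc X k).trans (hΓ X k)
  exact Eq.trans (congrArg (fun m ↦ sliceTwo (liftTwoCell Γ (extLiftIso t)) k ≫ m)
    ((Category.id_comp _).trans h₁)) h₂

/-- The acyclic notion of fibred structure given by structures on arrows. -/
def toAcyclicFibredStructure (h₁ : S.IsRepresentable) (h₂ : S.CoversFibrations)
    (h₃ : S.IsAcyclic) : AcyclicFibredStructure.{w} D where
  toFibredStructure := S.toFibredStructure hs
  isLocallyRepresentable := isLocallyRepresentable hs h₁
  coversFibrations := coversFibrations hs h₂
  isAcyclicFibration := isAcyclicFibration hs h₂ h₃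

end ArrowStructure

-- Categories of structured arrows

universe v' u'

/-- A category of arrows with a structure that can be restricted uniquely along pullback squares. -/
structure IsStructured {D : Type u} [Category.{v} D] {E : Type u'} [Category.{v'} E]
    (T : E ⥤ Arrow D) : Prop where
  isCart_map {z z' : E} (f : z ⟶ z') : IsCart (T.map f)
  exists_lift {z : E} {p : Arrow D} (c : p ⟶ T.obj z) (hc : IsCart c) :
    ∃ (z' : E) (f : z' ⟶ z) (α : p ≅ T.obj z'), α.hom ≫ T.map f = c
  exists_fac {x y z : E} (f : x ⟶ z) (g : y ⟶ z) (h : T.obj x ⟶ T.obj y)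
    (w : h ≫ T.map g = T.map f) : ∃ m : x ⟶ y, T.map m = h
  map_injective {x y : E} {m n : x ⟶ y} (h : T.map m = T.map n) : m = n

namespace IsStructured

variable {D : Type u} [Category.{v} D] {E : Type max u v} [Category.{v'} E]

/-- For every arrow, there is a universal pullback of it with a structure. -/
def HasUniversal (T : E ⥤ Arrow D) : Prop :=
  ∀ p : Arrow D, ∃ (z : E) (c : T.obj z ⟶ p), IsCart c ∧
    ∀ (y : E) (d : T.obj y ⟶ p), IsCart d → ∃! m : y ⟶ z, T.map m ≫ c = d

/-- The arrows that admit a structure are precisely the fibrations. -/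
def CoversFibrations [CategoryWithFibrations D] (T : E ⥤ Arrow D) : Prop :=
  (∀ z, fibrations D (T.obj z).hom) ∧
    ∀ p : Arrow D, fibrations D p.hom → ∃ z, Nonempty (T.obj z ≅ p)

/-- Structures on fibrations can be extended along cofibrations. -/
def IsAcyclic [CategoryWithFibrations D] [CategoryWithCofibrations D] (T : E ⥤ Arrow D) : Prop :=
  ∀ (z : E) (p : Arrow D) (c : T.obj z ⟶ p), IsCart c → cofibrations D c.right →
    fibrations D p.hom → ∃ (y : E) (e : T.obj y ≅ p) (m : z ⟶ y), T.map m ≫ e.hom = c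

/-- Up to isomorphism, the structures on an arrow form a small set. -/
def HasSmallFibres (T : E ⥤ Arrow D) : Prop :=
  ∀ p : Arrow D, ∃ (ι : Type w) (y : ι → E) (e : ∀ i, p ≅ T.obj (y i)),
    ∀ (z : E) (c : p ≅ T.obj z), ∃ (i : ι) (m : z ⟶ y i), c.hom ≫ T.map m = (e i).hom

/-- A representative of a structure on an arrow. -/
structure Rep (T : E ⥤ Arrow D) (p : Arrow D) where
  /-- The structured arrow. -/
  pt : E
  /-- The pullback square. -/
  hom : p ⟶ T.obj pt
  isCart : IsCart hom

variable {T : E ⥤ Arrow D}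

/-- Two representatives are related if they restrict to the same structure. -/
def Rel (p : Arrow D) (x y : Rep T p) : Prop :=
  ∃ (w : E) (f : w ⟶ x.pt) (g : w ⟶ y.pt) (α : p ≅ T.obj w),
    α.hom ≫ T.map f = x.hom ∧ α.hom ≫ T.map g = y.hom

variable (hT : IsStructured T)

/-- The equivalence relation on representatives. -/
def setoid (p : Arrow D) : Setoid (Rep T p) where
  r := Rel p
  iseqv :=
    { refl x := by
        obtain ⟨w, f, α, h⟩ := hT.exists_lift x.hom x.isCart
        exact ⟨w, f, f, α, h, h⟩
      symm := fun ⟨w, f, g, α, h, h'⟩ ↦ ⟨w, g, f, α, h', h⟩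
      trans := by
        rintro x y z ⟨w, f, g, α, h₁, h₂⟩ ⟨w', f', g', β, h₃, h₄⟩
        -- Both `w` and `w'` are restrictions of `y` to the arrow `p`, so the comparison of their
        -- arrows lifts to a morphism between them.
        obtain ⟨m, hm⟩ := hT.exists_fac g f' (α.inv ≫ β.hom) (by
          rw [Category.assoc, h₃, ← h₂, Iso.inv_hom_id_assoc])
        exact ⟨w, f, m ≫ g', α, h₁, by
          rw [Functor.map_comp, hm, Category.assoc, Iso.hom_inv_id_assoc, h₄]⟩ }

/-- The structures on an arrow. -/
def Str (p : Arrow D) : Type max u v := Quotient (hT.setoid p)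

/-- The structure given by a pullback square to a structured arrow. -/
def cls {p : Arrow D} (z : E) (c : p ⟶ T.obj z) (hc : IsCart c) : hT.Str p :=
  Quotient.mk (hT.setoid p) ⟨z, c, hc⟩

/-- A restriction of `z` along `c` is, by composition with `f`, also a restriction of `z'` along `c
≫ T.map f`. -/
lemma cls_comp_map {p : Arrow D} {z z' : E} (c : p ⟶ T.obj z) (hc : IsCart c) (f : z ⟶ z')
    (h : IsCart (c ≫ T.map f)) : hT.cls z' (c ≫ T.map f) h = hT.cls z c hc := by
  obtain ⟨w, g, α, e⟩ := hT.exists_lift c hc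
  exact Quotient.sound ⟨w, g ≫ f, g, α, by rw [Functor.map_comp, ← Category.assoc, e], e⟩

lemma cls_congr {p : Arrow D} {z : E} {c c' : p ⟶ T.obj z} (h : c = c') (hc : IsCart c) :
    hT.cls z c hc = hT.cls z c' (h ▸ hc) := by
  subst h; rfl

/-- Lifting the square replaces the structured arrow by its restriction to `p`, so every structure
is represented by an isomorphism. -/
lemma exists_cls {p : Arrow D} (s : hT.Str p) :
    ∃ (z : E) (α : p ≅ T.obj z), s = hT.cls z α.hom (.of_isIso _) := by
  obtain ⟨⟨z, c, hc⟩, rfl⟩ := Quotient.exists_rep s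
  obtain ⟨w, f, α, h⟩ := hT.exists_lift c hc
  exact ⟨w, α, (hT.cls_congr h.symm hc).trans (hT.cls_comp_map _ _ f _)⟩

/-- The relation provides a common restriction `w`. Its arrow is isomorphic to that of `z`, so the
map `w ⟶ z` has a section by `exists_fac`, which is then composed with `w ⟶ z'`. -/
lemma exists_hom {p : Arrow D} {z z' : E} (α : p ≅ T.obj z) (c : p ⟶ T.obj z') (hc : IsCart c)
    (h : hT.cls z α.hom (.of_isIso _) = hT.cls z' c hc) : ∃ m : z ⟶ z', α.hom ≫ T.map m = c := by
  obtain ⟨w, f, g, β, h₁, h₂⟩ := Quotient.exact h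
  obtain ⟨m, hm⟩ := hT.exists_fac (𝟙 z) f (α.inv ≫ β.hom) (by
    rw [Category.assoc, h₁, Iso.inv_hom_id, T.map_id])
  exact ⟨m ≫ g, by rw [Functor.map_comp, hm, Category.assoc, Iso.hom_inv_id_assoc, h₂]⟩

/-- The structures on arrows given by a category of structured arrows. -/
def arrowStructure : ArrowStructure.{max u v} D where
  str := hT.Str
  restr {p q} d hd := Quotient.map (fun x ↦ ⟨x.pt, d ≫ x.hom, hd.comp x.isCart⟩) (by
    -- Lifting `d` at the common restriction `w` of `x` and `y` gives a common restriction over `p`.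
    rintro x y ⟨w, f, g, α, h₁, h₂⟩
    obtain ⟨w', k, β, h⟩ := hT.exists_lift (d ≫ α.hom) (hd.comp (.of_isIso _))
    exact ⟨w', k ≫ f, k ≫ g, β,
      by rw [Functor.map_comp, ← Category.assoc, h, Category.assoc, h₁],
      by rw [Functor.map_comp, ← Category.assoc, h, Category.assoc, h₂]⟩)
  restr_id h s := by
    obtain ⟨x, rfl⟩ := Quotient.exists_rep s
    exact hT.cls_congr (Category.id_comp _) _
  restr_comp d e hd he h s := by
    obtain ⟨x, rfl⟩ := Quotient.exists_rep s
    exact hT.cls_congr (Category.assoc _ _ _) _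

lemma restr_cls {p q : Arrow D} (d : p ⟶ q) (hd : IsCart d) (z : E) (c : q ⟶ T.obj z)
    (hc : IsCart c) : hT.arrowStructure.restr d hd (hT.cls z c hc) = hT.cls z (d ≫ c) (hd.comp hc) :=
  rfl

/-- For a structure on `q` represented by `y` with `q ≅ T.obj y`, the squares from `q` that restrict
the tautological structure of `z` to it correspond to the morphisms `y ⟶ z`, by `exists_hom` and
`cls_comp_map`. So universality in `E` is universality for structures. -/
lemma isRepresentable (h : HasUniversal T) : hT.arrowStructure.IsRepresentable := by
  intro p
  obtain ⟨z, c, hc, hz⟩ := h p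
  refine ⟨T.obj z, c, hT.cls z (𝟙 _) (.id _), hc, fun q d hd t ↦ ?_⟩
  obtain ⟨y, α, rfl⟩ := hT.exists_cls t
  obtain ⟨m, hm, hm'⟩ := hz y (α.inv ≫ d) (.comp (.of_isIso _) hd)
  refine ⟨α.hom ≫ T.map m, ⟨by rw [Category.assoc, hm, Iso.hom_inv_id_assoc],
    .comp (.of_isIso _) (hT.isCart_map m), ?_⟩, ?_⟩
  · rw [restr_cls, ← hT.cls_comp_map α.hom (.of_isIso _) m (.comp (.of_isIso _) (hT.isCart_map m))]
    exact hT.cls_congr (Category.comp_id _) _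
  · rintro n ⟨hn, hn', e⟩
    rw [restr_cls, hT.cls_congr (Category.comp_id n)] at e
    obtain ⟨m', rfl⟩ := hT.exists_hom α n hn' e.symm
    rw [hm' m' (by simp [← hn])]

lemma coversFibrations [CategoryWithFibrations D] [(fibrations D).IsStableUnderBaseChange]
    (h : CoversFibrations T) : hT.arrowStructure.CoversFibrations := by
  refine fun p ↦ ⟨fun ⟨s⟩ ↦ ?_, fun hp ↦ ?_⟩
  · obtain ⟨⟨z, c, hc⟩, -⟩ := Quotient.exists_rep s
    exact (fibrations D).of_isPullback hc (h.1 z)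
  · obtain ⟨z, ⟨e⟩⟩ := h.2 p hp
    exact ⟨hT.cls z e.inv (.of_isIso _)⟩

lemma isAcyclic [CategoryWithFibrations D] [CategoryWithCofibrations D]
    (hD : ∀ {X Y Z : D} (e : X ≅ Y) (f : Y ⟶ Z), cofibrations D f → cofibrations D (e.hom ≫ f))
    (h : IsAcyclic T) : hT.arrowStructure.IsAcyclic := by
  intro p q c hc hi hp s
  obtain ⟨z, α, rfl⟩ := hT.exists_cls s
  -- Replacing `q` by the arrow of its representative precomposes the cofibration with an
  -- isomorphism, which is why `hD` is needed.
  obtain ⟨y, e, m, hm⟩ := h z p (α.inv ≫ c) (.comp (.of_isIso _) hc)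
    (hD (Arrow.rightFunc.mapIso α.symm) c.right hi) hp
  have hm' : c ≫ e.inv = α.hom ≫ T.map m := by
    rw [Iso.comp_inv_eq, Category.assoc, hm, Iso.hom_inv_id_assoc]
  refine ⟨hT.cls y e.inv (.of_isIso _), ?_⟩
  rw [restr_cls, hT.cls_congr hm', cls_comp_map]

lemma small_str (h : HasSmallFibres.{w} T) (p : Arrow D) : Small.{w} (hT.Str p) := by
  obtain ⟨ι, y, e, hy⟩ := h p
  refine small_of_surjective (f := fun i ↦ hT.cls (y i) (e i).hom (.of_isIso _)) fun s ↦ ?_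
  obtain ⟨z, α, rfl⟩ := hT.exists_cls s
  obtain ⟨i, m, hm⟩ := hy z α
  exact ⟨i, (hT.cls_congr hm.symm _).trans (hT.cls_comp_map _ _ m _)⟩

end IsStructured

/-! ### Recovering the category of structured arrows as a total category -/

namespace ArrowStructure

variable {D : Type u} [Category.{v} D] [HasPullbacks D] {S : ArrowStructure.{max u v} D}

/-- With `totalMap_injective`: morphisms of the total category are the pullback squares that
restrict the structure. Such a square factors through the projection square, and the vertical
remainder is an isomorphism preserving the structure. -/
lemma exists_totalMap_eq {x y : ∫ᶜ S.toPseudo}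
    (d : objArrow (fiberElt x).pt ⟶ objArrow (fiberElt y).pt) (hd : IsCart d)
    (h : S.restr d hd (fiberElt y).str = (fiberElt x).str) :
    ∃ f : x ⟶ y, totalMap S.toCodomain f = d := by
  obtain ⟨a, ha, har⟩ := (isCart_projArrow d.right (fiberElt y).pt).exists_lift d (𝟙 _)
    (Category.id_comp _)
  obtain ⟨m, rfl⟩ := exists_mapArrow a ((isCart_projArrow _ _).of_comp (by rwa [ha])) har
  refine ⟨⟨d.right, (⟨m, ?_⟩ : Elt.Hom (fiberElt x) ((Elt.reindex S d.right).obj (fiberElt y)))⟩, ?_⟩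
  · refine (S.restr_comp _ _ (isCart_mapArrow _) (isCart_projArrow _ _)
      ((isCart_mapArrow _).comp (isCart_projArrow _ _)) _).symm.trans ?_
    rw [S.restr_congr ha, h]
  · refine (totalMap_eq S.toCodomain _).trans ((congrArg (_ ≫ ·) (natArrow_toCodomain _ _)).trans ?_)
    exact ha

lemma totalMap_injective {x y : ∫ᶜ S.toPseudo} {f g : x ⟶ y}
    (h : totalMap S.toCodomain f = totalMap S.toCodomain g) : f = g := by
  obtain ⟨b, m⟩ := f
  obtain ⟨b', m'⟩ := g
  obtain rfl : b = b' := congr(($h).right)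
  congr 1
  refine Elt.hom_ext (mapArrow_injective ((isCart_projArrow b (fiberElt y).pt).hom_ext ?_ rfl))
  have e (n) := (totalMap_eq S.toCodomain (x := x) (y := y) ⟨b, n⟩).trans
    (congrArg (_ ≫ ·) (natArrow_toCodomain _ _))
  exact (e m).symm.trans (h.trans (e m'))

end ArrowStructure

namespace IsStructured

variable {D : Type u} [Category.{v} D] [HasPullbacks D] {E : Type max u v} [Category.{v'} E]
  {T : E ⥤ Arrow D} (hT : IsStructured T)

open ArrowStructure

/-- The structured arrow of an object of the total category. -/
def total (x : ∫ᶜ hT.arrowStructure.toPseudo) : E := (hT.exists_cls (fiberElt x).str).choose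

/-- The isomorphism of an arrow with structure to its structured arrow. -/
def totalIso (x : ∫ᶜ hT.arrowStructure.toPseudo) :
    objArrow (fiberElt x).pt ≅ T.obj (hT.total x) :=
  (hT.exists_cls (fiberElt x).str).choose_spec.choose

lemma str_eq (x : ∫ᶜ hT.arrowStructure.toPseudo) :
    (fiberElt x).str = hT.cls (hT.total x) (hT.totalIso x).hom (.of_isIso _) :=
  (hT.exists_cls (fiberElt x).str).choose_spec.choose_spec

/-- A morphism of the total category, as a map of arrows. -/
def squareMap {x y : ∫ᶜ hT.arrowStructure.toPseudo} (f : x ⟶ y) :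
    objArrow (fiberElt x).pt ⟶ objArrow (fiberElt y).pt :=
  totalMap hT.arrowStructure.toCodomain f

lemma exists_map {x y : ∫ᶜ hT.arrowStructure.toPseudo} (f : x ⟶ y) :
    ∃ m : hT.total x ⟶ hT.total y, (hT.totalIso x).hom ≫ T.map m =
      hT.squareMap f ≫ (hT.totalIso y).hom := by
  have hf : IsCart (hT.squareMap f) := isCart_totalMap _ f
  refine hT.exists_hom (hT.totalIso x) _ (hf.comp (.of_isIso _)) ?_
  rw [← str_eq, ← restr_totalMap f, str_eq]
  rfl

/-- The morphism of structured arrows given by a morphism of the total category. -/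
def mapTotal {x y : ∫ᶜ hT.arrowStructure.toPseudo} (f : x ⟶ y) : hT.total x ⟶ hT.total y :=
  (hT.exists_map f).choose

lemma totalIso_map {x y : ∫ᶜ hT.arrowStructure.toPseudo} (f : x ⟶ y) :
    (hT.totalIso x).hom ≫ T.map (hT.mapTotal f) = hT.squareMap f ≫ (hT.totalIso y).hom :=
  (hT.exists_map f).choose_spec

lemma mapTotal_eq {x y : ∫ᶜ hT.arrowStructure.toPseudo} (f : x ⟶ y) (m : hT.total x ⟶ hT.total y)
    (h : (hT.totalIso x).hom ≫ T.map m = hT.squareMap f ≫ (hT.totalIso y).hom) :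
    hT.mapTotal f = m :=
  hT.map_injective (by rw [← cancel_epi (hT.totalIso x).hom, totalIso_map, h])

/-- The functor from the total category to the given category of structured arrows. -/
def totalFunctor : ∫ᶜ hT.arrowStructure.toPseudo ⥤ E where
  obj := hT.total
  map f := hT.mapTotal f
  map_id x := hT.mapTotal_eq _ _ (by
    have h : hT.squareMap (𝟙 x) = 𝟙 _ := totalMap_id _ x
    rw [T.map_id, Category.comp_id, h, Category.id_comp])
  map_comp {x y z} f g := hT.mapTotal_eq _ _ (by
    have h : hT.squareMap (f ≫ g) = hT.squareMap f ≫ hT.squareMap g := totalMap_comp _ f g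
    rw [T.map_comp, ← Category.assoc, totalIso_map, Category.assoc, totalIso_map, h,
      Category.assoc])

instance : hT.totalFunctor.Faithful where
  map_injective {x y} f g h := totalMap_injective (by
    have h : hT.mapTotal f = hT.mapTotal g := h
    have := hT.totalIso_map f
    rw [h, hT.totalIso_map] at this
    exact ((cancel_mono _).1 this).symm)

lemma exists_mapTotal {x y : ∫ᶜ hT.arrowStructure.toPseudo} (m : hT.total x ⟶ hT.total y) :
    ∃ f : x ⟶ y, hT.mapTotal f = m := by
  have e : ((hT.totalIso x).hom ≫ T.map m ≫ (hT.totalIso y).inv) ≫ (hT.totalIso y).hom =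
      (hT.totalIso x).hom ≫ T.map m := by simp
  obtain ⟨f, hf⟩ := exists_totalMap_eq (x := x) (y := y)
    ((hT.totalIso x).hom ≫ T.map m ≫ (hT.totalIso y).inv)
    (.comp (.of_isIso _) ((hT.isCart_map m).comp (.of_isIso _))) (by
      rw [str_eq hT y, str_eq hT x]
      refine (hT.restr_cls _ _ _ _ _).trans ((hT.cls_congr e _).trans ?_)
      exact hT.cls_comp_map _ _ m _)
  refine ⟨f, hT.mapTotal_eq _ _ ?_⟩
  rw [← e]
  exact congrArg (· ≫ (hT.totalIso y).hom) hf.symm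

instance : hT.totalFunctor.Full := ⟨hT.exists_mapTotal⟩

/-- The arrow `T.obj z` with its tautological structure has `z` and its chosen representative as two
representatives of one structure; `exists_hom` in both directions gives inverse morphisms. -/
lemma exists_total_iso (z : E) : ∃ x : ∫ᶜ hT.arrowStructure.toPseudo,
    Nonempty (hT.total x ≅ z) := by
  let x : ∫ᶜ hT.arrowStructure.toPseudo := ⟨(T.obj z).right,
    (⟨⟨Over.mk (T.obj z).hom⟩, hT.cls z (𝟙 _) (.id _)⟩ : hT.arrowStructure.Elt (T.obj z).right)⟩
  let α : T.obj z ≅ T.obj (hT.total x) := hT.totalIso x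
  have hx : hT.cls (hT.total x) α.hom (.of_isIso _) = hT.cls z (𝟙 (T.obj z)) (.id _) :=
    (hT.str_eq x).symm
  obtain ⟨m, hm⟩ := hT.exists_hom α _ _ hx
  obtain ⟨n, hn⟩ := hT.exists_hom (Iso.refl _) _ _ hx.symm
  rw [Iso.refl_hom, Category.id_comp] at hn
  refine ⟨x, ⟨⟨m, n, hT.map_injective ?_, hT.map_injective ?_⟩⟩⟩
  · rw [T.map_comp, hn, T.map_id, ← cancel_epi α.hom, ← Category.assoc, hm, Category.id_comp,
      Category.comp_id]
  · rw [T.map_comp, hn, T.map_id, hm]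

instance : hT.totalFunctor.EssSurj := ⟨hT.exists_total_iso⟩

instance : hT.totalFunctor.IsEquivalence where

/-- The structures on arrows given by a category of structured arrows are the given ones. -/
def totalFunctorIso : totalArrow hT.arrowStructure.toCodomain ≅ hT.totalFunctor ⋙ T :=
  NatIso.ofComponents hT.totalIso (fun f ↦ (hT.totalIso_map f).symm)

/-- A category of structured arrows with good properties amounts to an acyclic notion of fibred
structure. -/
theorem exists_acyclicFibredStructure [CategoryWithFibrations D] [CategoryWithCofibrations D]
    [(fibrations D).IsStableUnderBaseChange] (hT : IsStructured T)
    (hD : ∀ {X Y Z : D} (e : X ≅ Y) (f : Y ⟶ Z), cofibrations D f → cofibrations D (e.hom ≫ f))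
    (h₁ : HasUniversal T) (h₂ : CoversFibrations T) (h₃ : IsAcyclic T)
    (h₄ : HasSmallFibres.{w} T) :
    ∃ (G : AcyclicFibredStructure.{w} D) (e : ∫ᶜ G.toPseudofunctor ≌ E),
      Nonempty (totalArrow G.toCodomain ≅ e.functor ⋙ T) :=
  ⟨toAcyclicFibredStructure (hT.small_str h₄) (hT.isRepresentable h₁) (hT.coversFibrations h₂)
    (hT.isAcyclic hD h₃), hT.totalFunctor.asEquivalence, ⟨hT.totalFunctorIso⟩⟩

end IsStructured

/-! ### The Yoneda lemma for pseudo-functors and for squares -/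

section YonedaMap

variable {D : Type u} [Category.{v} D] {H : LocallyDiscrete Dᵒᵖ ⥤ᵖ Cat.{v, max u v}} {A : D}
  (x : H.obj ⟨op A⟩)

/-- Equal morphisms, as a 2-cell of the locally discrete bicategory. -/
def twoCellOfEq {X : D} {f g : X ⟶ A} (h : f = g) : f.op.toLoc ⟶ g.op.toLoc :=
  Discrete.eqToHom (congrArg Quiver.Hom.op h)

/-- The component of the map `C(-, A) ⟶ H` given by an element of `H(A)`. -/
def yoMapApp (X : D) : HomSet X A ⥤ H.obj ⟨op X⟩ where
  obj k := (H.map k.hom.op.toLoc).toFunctor.obj x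
  map m := (H.map₂ (twoCellOfEq m.down.down)).toNatTrans.app x
  map_id k := congr($(H.map₂_id k.hom.op.toLoc).toNatTrans.app x)
  map_comp m n := (congrArg (fun η ↦ (H.map₂ η).toNatTrans.app x) (Subsingleton.elim _ _)).trans
    congr($(H.map₂_comp (twoCellOfEq m.down.down) (twoCellOfEq n.down.down)).toNatTrans.app x)

/-- The naturality of the map `C(-, A) ⟶ H` given by an element of `H(A)`. -/
def yoMapNaturality {X Y : LocallyDiscrete Dᵒᵖ} (f : X ⟶ Y) :
    (yoPseudo A).map f ≫ (show (yoPseudo A).obj Y ⟶ H.obj Y from (yoMapApp x Y.as.unop).toCatHom) ≅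
      (show (yoPseudo A).obj X ⟶ H.obj X from (yoMapApp x X.as.unop).toCatHom) ≫ H.map f :=
  Cat.Hom.isoMk (NatIso.ofComponents
    (fun k ↦ (Cat.Hom.toNatIso (H.mapComp (HomSet.hom (X := X.as.unop) k).op.toLoc f)).app x)
    (by
      rintro ⟨k⟩ ⟨k'⟩ m
      obtain rfl : k = k' := m.down.down
      obtain rfl : m = 𝟙 _ := HomGpd.hom_eq (X := X.as.unop) _ _
      refine (congrArg (· ≫ _) (CategoryTheory.Functor.map_id _ _)).trans
        ((Category.id_comp _).trans (Eq.symm ?_))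
      exact (congrArg (_ ≫ ·) (CategoryTheory.Functor.map_id _ _)).trans (Category.comp_id _)))

/-- The map `C(-, A) ⟶ H` given by an element of `H(A)`. -/
def yoOf : yoPseudo A ⟶ H where
  app X := (yoMapApp x X.as.unop).toCatHom
  naturality f := yoMapNaturality x f
  naturality_naturality η := naturality_of_locallyDiscrete _ (yoMapNaturality x) η
  naturality_id X := by
    ext k
    change HomSet X.as.unop A at k
    -- This expresses the comparison for a composition with an identity through the inverse of
    -- `mapId`, which then cancels.
    have := H.mapComp_id_right_hom_app k.hom.op.toLoc x
    refine (congrArg (· ≫ (H.mapId X).hom.toNatTrans.app _) this).trans ?_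
    refine (Category.assoc _ _ _).trans ((congrArg (_ ≫ ·)
      congr($((H.mapId X).inv_hom_id).toNatTrans.app
        ((H.map k.hom.op.toLoc).toFunctor.obj x))).trans ?_)
    refine (Category.comp_id _).trans (Eq.trans ?_
      ((congrArg (_ ≫ ·) (Category.id_comp _)).trans (Category.comp_id _)).symm)
    exact congrArg (fun η ↦ (H.map₂ η).toNatTrans.app x) (Subsingleton.elim _ _)
  naturality_comp {X Y Z} f g := by
    ext k
    change HomSet X.as.unop A at k
    have := H.mapComp_assoc_right_hom_app k.hom.op.toLoc f g x
    refine this.trans (congrArg₂ (· ≫ ·)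
      (congrArg (fun η ↦ (H.map₂ η).toNatTrans.app x) (Subsingleton.elim _ _)) ?_)
    refine Eq.trans ?_ (Category.id_comp _).symm
    refine congrArg₂ (· ≫ ·) rfl ?_
    exact ((Category.id_comp _).trans (Category.comp_id _)).symm

end YonedaMap

section TwoCell

variable {D : Type u} [Category.{v} D] [HasPullbacks D] {A B : D}

lemma yoNatArrow_yoMap_yoArrow (i : A ⟶ B) (t : yoPseudo B ⟶ codomainPseudo D) {X Y : D}
    (f : Y ⟶ X) (k : HomSet X A) :
    yoNatArrow (yoMap i ≫ t) f k ≫ yoArrow t ⟨k.hom ≫ i⟩ = yoArrow t ⟨(f ≫ k.hom) ≫ i⟩ := by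
  refine (congrArg (· ≫ _) (yoNatArrow_comp i t f k)).trans ((Category.assoc _ _ _).trans ?_)
  refine (congrArg (_ ≫ ·) (yoNatArrow_yoArrow t f ⟨k.hom ≫ i⟩)).trans ?_
  exact yoSliceMap_yoArrow t _

variable (i : A ⟶ B) (s : yoPseudo A ⟶ codomainPseudo D) (t : yoPseudo B ⟶ codomainPseudo D)
  (d : objArrow (yoSlice s ⟨𝟙 A⟩) ⟶ objArrow (yoSlice t ⟨𝟙 B⟩)) (hd : IsCart d) (hi : d.right = i)

lemma exists_squareApp (hd : IsCart d) (hi : d.right = i) {X : D} (k : HomSet X A) :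
    ∃ m : yoSlice s k ⟶ yoSlice t ⟨k.hom ≫ i⟩,
      mapArrow m ≫ yoArrow t ⟨k.hom ≫ i⟩ = yoArrow s k ≫ d := by
  obtain ⟨a, ha, har⟩ := (isCart_yoArrow t ⟨k.hom ≫ i⟩).exists_lift (yoArrow s k ≫ d) (𝟙 X)
    ((Category.id_comp _).trans (congrArg (k.hom ≫ ·) hi.symm))
  obtain ⟨m, rfl⟩ := exists_mapArrow a ((isCart_yoArrow _ _).of_comp
    (by rw [ha]; exact (isCart_yoArrow _ _).comp hd)) har
  exact ⟨m, ha⟩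

/-- The component of the 2-cell given by a pullback square. -/
def squareApp {X : D} (k : HomSet X A) : yoSlice s k ⟶ yoSlice t ⟨k.hom ≫ i⟩ :=
  (exists_squareApp i s t d hd hi k).choose

lemma squareApp_yoArrow {X : D} (k : HomSet X A) :
    mapArrow (squareApp i s t d hd hi k) ≫ yoArrow t ⟨k.hom ≫ i⟩ = yoArrow s k ≫ d :=
  (exists_squareApp i s t d hd hi k).choose_spec

/-- Both sides lie over `f`, and their composites with the Cartesian square `yoArrow t` are both the
universal square of `s` followed by `d`. -/
lemma squareApp_naturality {X Y : D} (f : Y ⟶ X) (k : HomSet X A) :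
    mapArrow (squareApp i s t d hd hi ⟨f ≫ k.hom⟩) ≫ yoNatArrow (yoMap i ≫ t) f k =
      yoNatArrow s f k ≫ mapArrow (squareApp i s t d hd hi k) := by
  refine (isCart_yoArrow t ⟨k.hom ≫ i⟩).hom_ext ?_ ?_
  · refine (Category.assoc _ _ _).trans ((congrArg (_ ≫ ·)
      (yoNatArrow_yoMap_yoArrow i t f k)).trans ?_)
    refine (squareApp_yoArrow i s t d hd hi ⟨f ≫ k.hom⟩).trans ?_
    rw [Category.assoc, squareApp_yoArrow, ← Category.assoc, yoNatArrow_yoArrow]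
  · refine (Category.id_comp _).trans ((yoNatArrow_right _ f k).trans ?_)
    exact ((Category.comp_id _).trans (yoNatArrow_right s f k)).symm

lemma squareApp_sliceNat {X Y : LocallyDiscrete Dᵒᵖ} (f : X ⟶ Y) (k : HomSet X.as.unop A) :
    squareApp i s t d hd hi ⟨f.as.unop ≫ k.hom⟩ ≫ sliceNat (yoMap i ≫ t) f k =
      sliceNat s f k ≫ (reindex f.as.unop).map (squareApp i s t d hd hi k) := by
  refine mapArrow_injective ((isCart_projArrow f.as.unop _).hom_ext ?_ rfl)
  have := squareApp_naturality i s t d hd hi f.as.unop k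
  refine ((congrArg (· ≫ _) (mapArrow_comp _ _)).trans (Category.assoc _ _ _)).trans
    (this.trans (Eq.symm ?_))
  refine ((congrArg (· ≫ _) (mapArrow_comp _ _)).trans (Category.assoc _ _ _)).trans ?_
  exact (congrArg (_ ≫ ·) (mapArrow_reindex_projArrow _ _)).trans (Category.assoc _ _ _).symm

/-- The component of the 2-cell given by a pullback square, as an isomorphism. -/
def squareIso {X : D} (k : HomSet X A) : yoSlice s k ≅ yoSlice t ⟨k.hom ≫ i⟩ :=
  asIso (squareApp i s t d hd hi k)

/-- The 2-cell between maps out of representables given by a pullback square. -/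
def squareTwoCell : s ≅ yoMap i ≫ t :=
  Pseudofunctor.StrongTrans.isoMk
    (fun X ↦ Cat.Hom.isoMk (NatIso.ofComponents
      (squareIso i s t d hd hi (X := X.as.unop)) (by
      rintro ⟨k⟩ ⟨k'⟩ m
      obtain rfl : k = k' := m.down.down
      obtain rfl : m = 𝟙 _ := HomGpd.hom_eq (X := X.as.unop) _ _
      refine (congrArg (· ≫ _) (CategoryTheory.Functor.map_id _ _)).trans
        ((Category.id_comp _).trans (Eq.symm ?_))
      exact (congrArg (_ ≫ ·) (CategoryTheory.Functor.map_id _ _)).trans (Category.comp_id _))))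
    (fun {X Y} f ↦ by
      ext k
      exact squareApp_sliceNat i s t d hd hi f k)

end TwoCell

lemma IsCart.of_comp_eq {D : Type*} [Category* D] {p q r : Arrow D} {a : p ⟶ q} {e : q ⟶ r}
    {d : p ⟶ r} (he : IsCart e) (hd : IsCart d) (h : a ≫ e = d) : IsCart a :=
  he.of_comp (by rwa [h])

/-- Two morphisms `x ⟶ y` with the same image are lifts of the same object of the slice, hence equal
objects of the slice over `y`. -/
lemma IsDiscreteFibration.map_injective {E B : Type*} [Category* E] [Category* B] {p : E ⥤ B}
    (h : IsDiscreteFibration p) {x y : E} {m n : x ⟶ y} (e : p.map m = p.map n) : m = n := by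
  have : Over.mk m = Over.mk n := (h y).injective (congrArg Over.mk e)
  injection this

lemma IsDiscreteFibration.exists_lift {E B : Type*} [Category* E] [Category* B] {p : E ⥤ B}
    (h : IsDiscreteFibration p) {x : E} {b : B} (f : b ⟶ p.obj x) :
    ∃ (x' : E) (hx : p.obj x' = b) (u : x' ⟶ x), p.map u = eqToHom hx ≫ f := by
  obtain ⟨Z, hZ⟩ := (h x).surjective (Over.mk f)
  injection hZ with h₁ h₂ h₃
  subst h₁
  exact ⟨Z.left, rfl, Z.hom, (eq_of_heq h₃).trans (Category.id_comp _).symm⟩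

/-! ### The total category of a notion of fibred structure is structured -/

section Lift

variable {D : Type u} [Category.{v} D] {F : LocallyDiscrete Dᵒᵖ ⥤ᵖ Cat.{v, max u v}}

/-- Since the fibres are groupoids, every morphism of `∫ F` is a vertical isomorphism followed by a
Cartesian lift, and so is itself Cartesian. -/
lemma exists_total_lift (hF : ∀ X, IsGroupoid (F.obj X)) {x y z : ∫ᶜ F} (f : x ⟶ z) (g : y ⟶ z)
    (k : x.base ⟶ y.base) (w : k ≫ g.base = f.base) : ∃ m : x ⟶ y, m.base = k ∧ m ≫ g = f := by
  obtain ⟨χ, ⟨rfl, h⟩, -⟩ := exists_cartesianLift z.fiber g.base f k w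
  have : IsIso g.fiber := (hF _).all_isIso g.fiber
  -- The factorization through the chosen Cartesian lift is corrected by the inverse of the vertical
  -- part of `g`.
  refine ⟨⟨χ.base, χ.fiber ≫ (F.map χ.base.op.toLoc).toFunctor.map (inv g.fiber)⟩, rfl, ?_⟩
  rw [← h]
  refine Hom.ext _ _ rfl (Eq.trans ?_ (Category.comp_id _).symm)
  refine (Category.assoc _ _ _).trans (congrArg (χ.fiber ≫ ·) ?_)
  refine (Category.assoc _ _ _).symm.trans (congrArg (· ≫ _) ?_)
  exact (CategoryTheory.Functor.map_comp _ _ _).symm.trans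
    (congrArg (F.map χ.base.op.toLoc).toFunctor.map (IsIso.inv_hom_id g.fiber))

end Lift

section Total

variable {D : Type u} [Category.{v} D] [HasPullbacks D]
  {F K : LocallyDiscrete Dᵒᵖ ⥤ᵖ Cat.{v, max u v}}

lemma sliceMap_comp (φ : F ⟶ codomainPseudo D) {X : LocallyDiscrete Dᵒᵖ} {x y z : F.obj X}
    (m : x ⟶ y) (n : y ⟶ z) : sliceMap φ (m ≫ n) = sliceMap φ m ≫ sliceMap φ n :=
  (φ.app X).toFunctor.map_comp m n

lemma totalMap_comp_left (g : K ⟶ F) (φ : F ⟶ codomainPseudo D) {x y : ∫ᶜ K} (f : x ⟶ y) :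
    totalMap (g ≫ φ) f = totalMap φ ((map g).map f) := by
  refine (totalMap_eq (g ≫ φ) f).trans (Eq.trans ?_ (totalMap_eq φ ((map g).map f)).symm)
  refine (congrArg (_ ≫ ·) (natArrow_comp g φ f.base.op.toLoc y.fiber)).trans ?_
  refine (Category.assoc _ _ _).symm.trans (congrArg (· ≫ _) ?_)
  exact ((congrArg mapArrow (sliceMap_comp φ _ _)).trans (mapArrow_comp _ _)).symm

variable (φ : F ⟶ codomainPseudo D)

/-- Equal objects of a groupoid of slices are isomorphic arrows. -/
def eqArrow {X : D} {p q : Core (Over X)} (h : p = q) : objArrow p ≅ objArrow q :=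
  eqToIso (congrArg objArrow h)

lemma exists_slice_eq (hφ : ∀ X, IsDiscreteFibration (φ.app X).toFunctor) {X : D}
    {p : Core (Over X)} {y : F.obj ⟨op X⟩} (α : p ⟶ slice φ y) :
    ∃ (x : F.obj ⟨op X⟩) (h : slice φ x = p) (u : x ⟶ y),
      (eqArrow h.symm).hom ≫ mapArrow (sliceMap φ u) = mapArrow α := by
  obtain ⟨x, h, u, hu⟩ := (hφ ⟨op X⟩).exists_lift (b := p) α
  refine ⟨x, h, u, ?_⟩
  change slice φ x = p at h
  subst h
  exact (Category.id_comp _).trans (congrArg mapArrow (hu.trans (Category.id_comp _)))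

lemma exists_totalMap_comp {X : D} {y y' : F.obj ⟨op X⟩} {z : ∫ᶜ F} (u : y ⟶ y')
    (n : (⟨X, y'⟩ : ∫ᶜ F) ⟶ z) : ∃ m : (⟨X, y⟩ : ∫ᶜ F) ⟶ z,
      totalMap φ m = mapArrow (sliceMap φ u) ≫ totalMap φ n := by
  refine ⟨⟨n.base, u ≫ n.fiber⟩, ?_⟩
  refine (totalMap_eq φ _).trans (Eq.trans ?_ (congrArg (_ ≫ ·) (totalMap_eq φ n)).symm)
  refine Eq.trans (congrArg (· ≫ _) ?_) (Category.assoc _ _ _)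
  exact (congrArg mapArrow (sliceMap_comp φ _ _)).trans (mapArrow_comp _ _)

/-- Two morphisms to `z` with the same base differ by a vertical isomorphism, namely the fibre part
of one followed by the inverse of the other. -/
lemma exists_sliceMap_comp (hF : ∀ X, IsGroupoid (F.obj X)) {X : D} {y y' : F.obj ⟨op X⟩}
    {z : ∫ᶜ F} (m : (⟨X, y⟩ : ∫ᶜ F) ⟶ z) (n : (⟨X, y'⟩ : ∫ᶜ F) ⟶ z) (h : m.base = n.base) :
    ∃ u : y ⟶ y', mapArrow (sliceMap φ u) ≫ totalMap φ n = totalMap φ m := by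
  obtain ⟨k, m⟩ := m
  obtain ⟨k', n⟩ := n
  obtain rfl : k = k' := h
  have : IsIso n := (hF _).all_isIso n
  refine ⟨m ≫ inv n, ?_⟩
  refine (congrArg (mapArrow (sliceMap φ (m ≫ inv n)) ≫ ·)
    (totalMap_eq φ (x := ⟨X, y'⟩) ⟨k, n⟩)).trans
    (Eq.trans ?_ (totalMap_eq φ (x := ⟨X, y⟩) ⟨k, m⟩).symm)
  refine (Category.assoc _ _ _).symm.trans (congrArg (· ≫ _) ?_)
  refine ((mapArrow_comp _ _).symm.trans (congrArg mapArrow (sliceMap_comp φ _ _).symm)).trans ?_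
  exact congrArg (fun m ↦ mapArrow (sliceMap φ m))
    ((Category.assoc _ _ _).trans ((congrArg (m ≫ ·) (IsIso.inv_hom_id n)).trans
      (Category.comp_id m)))

/-- The Cartesian lift of `c.right` at `z` has a pullback square as its image, and `c` differs from
that square by a vertical isomorphism. -/
lemma exists_totalMap_eq_of_isCart {X : D} {p : Core (Over X)} {z : ∫ᶜ F}
    (c : objArrow p ⟶ objArrow (slice φ z.fiber)) (hc : IsCart c) :
    ∃ (y : F.obj ⟨op X⟩) (α : p ⟶ slice φ y) (f : (⟨X, y⟩ : ∫ᶜ F) ⟶ z),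
      mapArrow α ≫ totalMap φ f = c := by
  let f : domainCartesianLift z.fiber c.right ⟶ z := cartesianLift z.fiber c.right
  obtain ⟨a, ha, har⟩ := (isCart_totalMap φ f).exists_lift c (𝟙 X) (Category.id_comp _)
  obtain ⟨α, rfl⟩ := exists_mapArrow a ((isCart_totalMap φ f).of_comp_eq hc ha) har
  exact ⟨_, α, f, ha⟩

variable {φ} in
lemma isStructured_totalArrow (hF : ∀ X, IsGroupoid (F.obj X))
    (hφ : ∀ X, IsDiscreteFibration (φ.app X).toFunctor) : IsStructured (totalArrow φ) where
  isCart_map := isCart_totalMap φ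
  exists_lift {z p} c hc := by
    obtain ⟨y, α, f, h⟩ := exists_totalMap_eq_of_isCart φ (p := ⟨Over.mk p.hom⟩) c hc
    exact ⟨⟨_, y⟩, f, (show objArrow (⟨Over.mk p.hom⟩ : Core (Over p.right)) ≅ objArrow (slice φ y) from
      asIso (mapArrow α)), h⟩
  exists_fac {x y z} f g h w := by
    obtain ⟨m, hm, rfl⟩ := exists_total_lift hF f g h.right congr(($w).right)
    exact ⟨m, (isCart_totalMap φ g).hom_ext (((totalArrow φ).map_comp _ _).symm.trans w.symm) hm⟩
  map_injective {x y} m n h := by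
    obtain ⟨k, m⟩ := m
    obtain ⟨k', n⟩ := n
    obtain rfl : k = k' := congr(($h).right)
    congr 1
    refine (hφ _).map_injective (mapArrow_injective
      ((isCart_natArrow φ k.op.toLoc y.fiber).hom_ext ?_ rfl))
    exact (totalMap_eq φ (x := x) (y := y) ⟨k, m⟩).symm.trans (h.trans (totalMap_eq φ _))

/-- A structure on an arrow isomorphic to `p` can be transported along the discrete fibration to one
whose underlying arrow equals `p`. The small strict fibre over `p` therefore represents all
structures up to isomorphism. -/
lemma hasSmallFibres_totalArrow (hF : ∀ X, IsGroupoid (F.obj X))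
    (hφ : ∀ X, IsDiscreteFibration (φ.app X).toFunctor)
    (hs : ∀ X p, Small.{w} {x : F.obj X // (φ.app X).toFunctor.obj x = p}) :
    IsStructured.HasSmallFibres.{w} (totalArrow φ) := by
  intro p
  have hT := isStructured_totalArrow hF hφ
  let p' : Core (Over p.right) := ⟨Over.mk p.hom⟩
  have := hs ⟨op p.right⟩ p'
  let e (x : {x : F.obj ⟨op p.right⟩ // (φ.app _).toFunctor.obj x = p'}) :
      objArrow p' ≅ objArrow (slice φ x.1) := eqArrow (q := slice φ x.1) x.2.symm
  refine ⟨Shrink.{w} {x : F.obj ⟨op p.right⟩ // (φ.app _).toFunctor.obj x = p'},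
    fun i ↦ ⟨p.right, ((equivShrink _).symm i).1⟩, fun i ↦ e ((equivShrink _).symm i), fun z c ↦ ?_⟩
  obtain ⟨y, α, f, h⟩ := exists_totalMap_eq_of_isCart φ (p := p') c.hom
    (.of_isIso (p := p) (q := (totalArrow φ).obj z) c.hom)
  obtain ⟨y', hy, u, hu⟩ := exists_slice_eq φ hφ α
  obtain ⟨m, hm⟩ := exists_totalMap_comp φ u f
  have he : (e ⟨y', hy⟩).hom ≫ totalMap φ m = c.hom :=
    (congrArg (_ ≫ ·) hm).trans ((Category.assoc _ _ _).symm.trans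
      ((congrArg (· ≫ _) hu).trans h))
  obtain ⟨n, hn⟩ : ∃ n : z ⟶ ⟨p.right, y'⟩, (totalArrow φ).map n = c.inv ≫ (e ⟨y', hy⟩).hom := by
    refine hT.exists_fac (𝟙 z) m _ ?_
    refine (Category.assoc _ _ _).trans ((congrArg (c.inv ≫ ·) he).trans ?_)
    exact c.inv_hom_id.trans ((totalArrow φ).map_id z).symm
  have hn' : c.hom ≫ (totalArrow φ).map n = (e ⟨y', hy⟩).hom :=
    (congrArg (c.hom ≫ ·) hn).trans (c.hom_inv_id_assoc _)
  obtain ⟨i, hi⟩ := (equivShrink _).symm.surjective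
    (⟨y', hy⟩ : {x : F.obj ⟨op p.right⟩ // (φ.app _).toFunctor.obj x = p'})
  refine ⟨i, ?_⟩
  dsimp only
  rw [hi]
  exact ⟨n, hn'⟩

lemma coversFibrations_totalArrow [CategoryWithFibrations D]
    (h : ∀ (X : LocallyDiscrete Dᵒᵖ) (p : (codomainPseudo D).obj X),
      (∃ x, (φ.app X).toFunctor.obj x = p) ↔ (fibProperty D).prop X p) :
    IsStructured.CoversFibrations (totalArrow φ) := by
  refine ⟨fun z ↦ (h _ _).1 ⟨z.fiber, rfl⟩, fun p hp ↦ ?_⟩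
  obtain ⟨x, hx⟩ := (h ⟨op p.right⟩ (⟨Over.mk p.hom⟩ : Core (Over p.right))).2 hp
  exact ⟨⟨p.right, x⟩, ⟨eqArrow (p := slice φ x) (q := ⟨Over.mk p.hom⟩) hx⟩⟩

end Total

/-! ### Local representability gives universal structured arrows -/

section Universal

variable {D : Type u} [Category.{v} D]

/-- The universal element is terminal in `∫ C(-, A)`: the fibre part of a map to it determines its
base. -/
lemma yo_hom_univ_ext {A : D} {x : ∫ᶜ (yoPseudo A)} (f g : x ⟶ ⟨A, (⟨𝟙 A⟩ : HomSet A A)⟩) :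
    f = g := by
  refine yo_hom_ext ?_
  have (f : x ⟶ ⟨A, (⟨𝟙 A⟩ : HomSet A A)⟩) : (x.fiber : HomSet x.base A).hom = f.base :=
    f.fiber.down.down.trans (Category.comp_id _)
  rw [← this f, this g]

variable [HasPullbacks D] {F : LocallyDiscrete Dᵒᵖ ⥤ᵖ Cat.{v, max u v}}
  (φ : F ⟶ codomainPseudo D)

/-- The map in `∫ F` to the universal value of a map out of a representable. -/
def univHom {R : D} (b : yoPseudo R ⟶ F) {X : D} (k : HomSet X R) :
    (⟨X, (b.app ⟨op X⟩).toFunctor.obj k⟩ : ∫ᶜ F) ⟶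
      ⟨R, (b.app ⟨op R⟩).toFunctor.obj (⟨𝟙 R⟩ : HomSet R R)⟩ :=
  (map b).map (yoUniv k)

lemma totalMap_univHom {R : D} (b : yoPseudo R ⟶ F) {X : D} (k : HomSet X R) :
    totalMap φ (univHom b k) = yoArrow (b ≫ φ) k :=
  (totalMap_comp_left b φ (yoUniv k)).symm

/-- The canonical isomorphism between an arrow and the universal value of the corresponding map out
of a representable. -/
def yoOfArrow {B : D} (p : Core (Over B)) :
    objArrow (yoSlice (yoOf (H := codomainPseudo D) p) ⟨𝟙 B⟩) ⟶ objArrow p :=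
  projArrow (𝟙 B) p

variable {R Z : D} {b : yoPseudo R ⟶ F} {r : yoPseudo R ⟶ yoPseudo Z}
  {a : yoPseudo Z ⟶ codomainPseudo D} (θ : b ≫ φ ≅ r ≫ a)

/-- The value of a map of representables. -/
abbrev yoHom (r : yoPseudo R ⟶ yoPseudo Z) {X : D} (k : HomSet X R) : HomSet X Z :=
  (r.app ⟨op X⟩).toFunctor.obj k

/-- The component of the 2-cell of a pseudo-pullback square. -/
def cellApp {X : D} (k : HomSet X R) : yoSlice (b ≫ φ) k ⟶ yoSlice a (yoHom r k) :=
  sliceTwo θ.hom (X := ⟨op X⟩) k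

/-- The pullback square given by a pseudo-pullback square. -/
def univSquare : objArrow (yoSlice (b ≫ φ) ⟨𝟙 R⟩) ⟶ objArrow (yoSlice a ⟨𝟙 Z⟩) :=
  mapArrow (cellApp φ θ ⟨𝟙 R⟩) ≫ yoArrow a (yoHom r ⟨𝟙 R⟩)

lemma isCart_univSquare : IsCart (univSquare φ θ) :=
  (isCart_mapArrow _).comp (isCart_yoArrow _ _)

/-- By naturality of the 2-cell `θ` with respect to the map to the universal element, and
terminality of the universal element of `C(-, Z)`. -/
lemma yoArrow_univSquare {X : D} (k : HomSet X R) :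
    yoArrow (b ≫ φ) k ≫ univSquare φ θ = mapArrow (cellApp φ θ k) ≫ yoArrow a (yoHom r k) := by
  refine (Category.assoc _ _ _).symm.trans
    ((congrArg (· ≫ _) (totalMap_comp_mapArrow θ.hom (yoUniv k))).trans ?_)
  refine (Category.assoc _ _ _).trans (congrArg (mapArrow (cellApp φ θ k) ≫ ·) ?_)
  refine (congrArg (· ≫ _) (totalMap_comp_left r a (yoUniv k))).trans ?_
  refine (totalMap_comp a ((map r).map (yoUniv k)) (yoUniv (yoHom r ⟨𝟙 R⟩))).symm.trans ?_
  exact congrArg (totalMap a) (yo_hom_univ_ext _ _)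

variable {φ θ}

lemma exists_of_isPseudoPullback (h : IsPseudoPullback b r φ a θ) {X : D} (y : F.obj ⟨op X⟩)
    (f : HomSet X Z) (α : slice φ y ⟶ yoSlice a f) :
    ∃ (k : HomSet X R) (u : y ⟶ (b.app ⟨op X⟩).toFunctor.obj k),
      mapArrow (sliceMap φ u) ≫ mapArrow (cellApp φ θ k) ≫ yoArrow a (yoHom r k) =
        mapArrow α ≫ yoArrow a f := by
  have := (h ⟨op X⟩).essSurj
  let i : slice φ y ≅ yoSlice a f := asIso α
  obtain ⟨k, ⟨e⟩⟩ := this.mem_essImage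
    { fst := y, snd := f, iso := i }
  have hw : sliceMap φ e.inv.fst ≫ cellApp φ θ k = α ≫ yoSliceMap a e.inv.snd := e.inv.w
  refine ⟨k, e.inv.fst, ?_⟩
  refine (Category.assoc _ _ _).symm.trans ((congrArg (· ≫ _)
    ((mapArrow_comp _ _).symm.trans ((congrArg mapArrow hw).trans (mapArrow_comp _ _)))).trans ?_)
  exact (Category.assoc _ _ _).trans (congrArg (_ ≫ ·) (yoSliceMap_yoArrow a e.inv.snd))

/-- Fullness of the comparison functor gives a morphism `k ⟶ k'`, and in a discrete groupoid this is
an equality. -/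
lemma eq_of_isPseudoPullback (h : IsPseudoPullback b r φ a θ) {X : D} {k k' : HomSet X R}
    (g : (b.app ⟨op X⟩).toFunctor.obj k ⟶ (b.app ⟨op X⟩).toFunctor.obj k')
    (hk : (yoHom r k).hom = (yoHom r k').hom)
    (hg : mapArrow (sliceMap φ g) ≫ mapArrow (cellApp φ θ k') ≫ yoArrow a (yoHom r k') =
      mapArrow (cellApp φ θ k) ≫ yoArrow a (yoHom r k)) : k.hom = k'.hom := by
  have := (h ⟨op X⟩).full
  let n : yoHom r k ⟶ yoHom r k' := ⟨⟨hk⟩⟩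
  have hw : sliceMap φ g ≫ cellApp φ θ k' = cellApp φ θ k ≫ yoSliceMap a n := by
    refine mapArrow_injective ((isCart_yoArrow a _).hom_ext ?_ rfl)
    refine ((congrArg (· ≫ _) (mapArrow_comp _ _)).trans (Category.assoc _ _ _)).trans
      (hg.trans (Eq.symm ?_))
    refine ((congrArg (· ≫ _) (mapArrow_comp _ _)).trans (Category.assoc _ _ _)).trans ?_
    exact congrArg (_ ≫ ·) (yoSliceMap_yoArrow a n)
  obtain ⟨m, -⟩ := this.map_surjective (X := k) (Y := k') { fst := g, snd := n, w := hw }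
  exact m.down.down

/-- The arrow `p` is named by a map `a` from a representable; the universal element of the object
representing the pseudo-pullback along `a` is the universal structured arrow. Essential surjectivity
of the comparison gives the factorizations, fullness their uniqueness. -/
lemma hasUniversal_totalArrow (hF : ∀ X, IsGroupoid (F.obj X))
    (hT : IsStructured (totalArrow φ))
    (hφ : ∀ (Z : D) (a : yoPseudo Z ⟶ codomainPseudo D), ∃ (R : D) (b : yoPseudo R ⟶ F)
      (r : yoPseudo R ⟶ yoPseudo Z) (θ : b ≫ φ ≅ r ≫ a), IsPseudoPullback b r φ a θ) :
    IsStructured.HasUniversal (totalArrow φ) := by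
  intro p
  let p' : Core (Over p.right) := ⟨Over.mk p.hom⟩
  let a := yoOf (H := codomainPseudo D) (A := p.right) p'
  obtain ⟨R, b, r, θ, h⟩ := hφ p.right a
  -- The value of `a` at the identity is the reindexing of `p` along the identity; `π` identifies it
  -- with `p`.
  let π := yoOfArrow p'
  have hπ : IsCart π := isCart_projArrow _ _
  have hπr : π.right = 𝟙 p.right := rfl
  let c : objArrow (yoSlice (b ≫ φ) ⟨𝟙 R⟩) ⟶ objArrow p' := univSquare φ θ ≫ π
  have hc : IsCart c := (isCart_univSquare φ θ).comp hπ
  have key {X : D} {y : F.obj ⟨op X⟩} {k : HomSet X R}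
      (u : y ⟶ (b.app ⟨op X⟩).toFunctor.obj k) :
      (mapArrow (sliceMap φ u) ≫ totalMap φ (univHom b k)) ≫ c =
        (mapArrow (sliceMap φ u) ≫ mapArrow (cellApp φ θ k) ≫ yoArrow a (yoHom r k)) ≫ π := by
    refine (congrArg (fun e ↦ (_ ≫ e) ≫ c) (totalMap_univHom φ b k)).trans ?_
    refine (Category.assoc _ _ _).symm.trans (congrArg (· ≫ π) ?_)
    exact (Category.assoc _ _ _).trans (congrArg (_ ≫ ·) (yoArrow_univSquare φ θ k))
  refine ⟨⟨R, (b.app ⟨op R⟩).toFunctor.obj (⟨𝟙 R⟩ : HomSet R R)⟩, c, hc, fun y d hd ↦ ?_⟩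
  refine existsUnique_of_exists_of_unique ?_ ?_
  · obtain ⟨α, hα, hαr⟩ : ∃ α : objArrow (slice φ y.fiber) ⟶ objArrow (yoSlice a ⟨d.right⟩),
        (α ≫ yoArrow a ⟨d.right⟩) ≫ π = d ∧ α.right = 𝟙 y.base := by
      obtain ⟨α, hα, hαr⟩ := ((isCart_yoArrow a ⟨d.right⟩).comp hπ).exists_lift d (𝟙 _)
        ((Category.id_comp _).trans (Category.comp_id d.right))
      exact ⟨α, (Category.assoc _ _ _).trans hα, hαr⟩
    have hα' : IsCart α := ((isCart_yoArrow a ⟨d.right⟩).comp hπ).of_comp_eq hd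
      ((Category.assoc _ _ _).symm.trans hα)
    obtain ⟨α, rfl⟩ := exists_mapArrow α hα' hαr
    obtain ⟨k, u, hu⟩ := exists_of_isPseudoPullback h y.fiber ⟨d.right⟩ α
    obtain ⟨m, hm⟩ := exists_totalMap_comp φ u (univHom b k)
    refine ⟨m, (congrArg (· ≫ c) hm).trans ((key u).trans ((congrArg (· ≫ π) hu).trans hα))⟩
  · intro m m' hm hm'
    -- Each solution differs by a vertical isomorphism from the universal map over the same base, so
    -- its base is an element of the pseudo-pullback. The two elements are isomorphic there, hence
    -- equal.
    obtain ⟨u, hu⟩ := exists_sliceMap_comp φ hF m (univHom b ⟨m.base⟩) rfl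
    obtain ⟨u', hu'⟩ := exists_sliceMap_comp φ hF m' (univHom b ⟨m'.base⟩) rfl
    have : IsIso π := hπ.isIso (by rw [hπr]; exact inferInstanceAs (IsIso (𝟙 p.right)))
    have hb : m.base = m'.base := by
      have e := (cancel_mono π).1 (((key u).symm.trans ((congrArg (· ≫ c) hu).trans hm)).trans
        ((key u').symm.trans ((congrArg (· ≫ c) hu').trans hm')).symm)
      have : IsIso u := (hF _).all_isIso u
      have hu₁ : mapArrow (sliceMap φ (inv u)) ≫ mapArrow (sliceMap φ u) = 𝟙 _ := by
        rw [← mapArrow_comp, ← sliceMap_comp, IsIso.inv_hom_id, sliceMap_id, mapArrow_id]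
      refine eq_of_isPseudoPullback h (inv u ≫ u') ?_ ?_
      · have he (k : HomSet y.base R) :
            𝟙 y.base ≫ 𝟙 y.base ≫ (yoHom r k).hom = (yoHom r k).hom :=
          (Category.id_comp _).trans (Category.id_comp _)
        exact (he _).symm.trans (congr(($e).right).trans (he _))
      · rw [sliceMap_comp, mapArrow_comp]
        refine (Category.assoc _ _ _).trans ((congrArg (_ ≫ ·) e.symm).trans ?_)
        refine (Category.assoc _ _ _).symm.trans ((congrArg (· ≫ _) hu₁).trans ?_)
        exact Category.id_comp _
    exact hT.map_injective (hc.hom_ext (hm.trans hm'.symm) hb)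

end Universal

/-! ### Acyclic fibrations give extension of structures -/

section Acyclic

variable {D : Type u} [Category.{v} D] [HasPullbacks D] [CategoryWithFibrations D]
  [(fibrations D).IsStableUnderBaseChange] {F : FibredStructure.{w} D} (h : F.CoversFibrations)

/-- A 2-cell between maps to the pseudo-functor of fibrations, as a 2-cell to the codomain
pseudo-functor. -/
def fibCell {K : LocallyDiscrete Dᵒᵖ ⥤ᵖ Cat.{v, max u v}} {l : K ⟶ F.toPseudofunctor}
    {b : K ⟶ fibPseudo D} (ζ : l ≫ F.toFib h ⟶ b) : l ≫ F.toCodomain ⟶ b ≫ fibInclusion D :=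
  twoCell h (ζ ≫ (λ_ b).inv) ≫ (λ_ _).hom

lemma sliceTwo_fibCell {K : LocallyDiscrete Dᵒᵖ ⥤ᵖ Cat.{v, max u v}} {l : K ⟶ F.toPseudofunctor}
    {b : K ⟶ fibPseudo D} (ζ : l ≫ F.toFib h ⟶ b) {X : LocallyDiscrete Dᵒᵖ} (k : K.obj X) :
    sliceTwo (fibCell h ζ) k = ((ζ.as.app X).toNatTrans.app k).hom := by
  refine (Category.comp_id _).trans ((sliceTwo_twoCell h (ζ ≫ (λ_ b).inv) k).trans ?_)
  exact Category.comp_id _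

variable {A B : D} {i : A ⟶ B} {a : yoPseudo A ⟶ F.toPseudofunctor} {b : yoPseudo B ⟶ fibPseudo D}

/-- The lifting problem given by a pullback square. -/
def squareFib (Γ : a ≫ F.toCodomain ⟶ yoMap i ≫ b ≫ fibInclusion D) :
    a ≫ F.toFib h ≅ yoMap i ≫ b :=
  fibTwoCell h (Γ ≫ (α_ _ _ _).inv)

lemma squareFib_app (Γ : a ≫ F.toCodomain ⟶ yoMap i ≫ b ≫ fibInclusion D) {X : D}
    (k : HomSet X A) :
    (((squareFib h Γ).hom.as.app ⟨op X⟩).toNatTrans.app k).hom =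
      sliceTwo Γ (X := ⟨op X⟩) k :=
  (fibTwoCell_app h (Γ ≫ (α_ _ _ _).inv) (X := ⟨op X⟩) k).trans (Category.comp_id _)

variable [CategoryWithCofibrations D]

lemma exists_of_isAcyclicFibration (h' : IsAcyclicFibration (F.toFib h)) (hi : cofibrations D i)
    (Γ : a ≫ F.toCodomain ⟶ yoMap i ≫ b ≫ fibInclusion D) :
    ∃ (l : yoPseudo B ⟶ F.toPseudofunctor) (Z : l ≫ F.toCodomain ⟶ b ≫ fibInclusion D)
      (u : (a.app ⟨op A⟩).toFunctor.obj (⟨𝟙 A⟩ : HomSet A A) ⟶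
        (l.app ⟨op A⟩).toFunctor.obj (⟨𝟙 A ≫ i⟩ : HomSet A B)),
      sliceMap F.toCodomain u ≫ sliceTwo Z (X := ⟨op A⟩) (⟨𝟙 A ≫ i⟩ : HomSet A B) =
        sliceTwo Γ (X := ⟨op A⟩) (⟨𝟙 A⟩ : HomSet A A) := by
  obtain ⟨l, η, ζ, e⟩ := h' i hi a b (squareFib h Γ)
  refine ⟨l, fibCell h ζ.hom, (η.hom.as.app ⟨op A⟩).toNatTrans.app (⟨𝟙 A⟩ : HomSet A A), ?_⟩
  have e' := congrArg (fun θ : a ≫ F.toFib h ⟶ yoMap i ≫ b ↦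
    ((θ.as.app ⟨op A⟩).toNatTrans.app (⟨𝟙 A⟩ : HomSet A A)).hom) e
  refine Eq.trans ?_ (e'.symm.trans (squareFib_app h Γ ⟨𝟙 A⟩))
  refine (congrArg (_ ≫ ·) (sliceTwo_fibCell h ζ.hom _)).trans (congrArg (_ ≫ ·) ?_)
  exact (Category.id_comp _).symm

/-- The Yoneda lemma turns `z` and `p` into maps out of representables and `c` into a lifting
problem between them. The value of a filler at the identity of `p.right` is the extended structure.
-/
lemma isAcyclic_totalArrow (hF : ∀ X, IsGroupoid (F.toPseudofunctor.obj X))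
    (h' : IsAcyclicFibration (F.toFib h)) :
    IsStructured.IsAcyclic (totalArrow F.toCodomain) := by
  intro z p c hc hi hp
  let φ := F.toCodomain
  let x : F.toPseudofunctor.obj ⟨op z.base⟩ := z.fiber
  let a := yoOf (H := F.toPseudofunctor) (A := z.base) x
  let p' : Core (Over p.right) := ⟨Over.mk p.hom⟩
  let b := yoOf (H := fibPseudo D) (A := p.right) ⟨p', hp⟩
  let π : objArrow (yoSlice (b ≫ fibInclusion D) ⟨𝟙 p.right⟩) ⟶ objArrow p' :=
    projArrow (𝟙 p.right) p'
  have hπ : IsCart π := isCart_projArrow _ _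
  have hπr : π.right = 𝟙 p.right := rfl
  have : IsIso π := hπ.isIso (by rw [hπr]; exact inferInstanceAs (IsIso (𝟙 p.right)))
  -- The Yoneda map of `z` takes at the identity the reindexing of `z` along the identity. The map
  -- `κ` compares it with `z`, and `κ'` is a section of `κ`.
  let κ : (⟨z.base, (a.app ⟨op z.base⟩).toFunctor.obj (⟨𝟙 z.base⟩ : HomSet z.base z.base)⟩ :
    ∫ᶜ F.toPseudofunctor) ⟶ z := cartesianLift x (𝟙 z.base)
  obtain ⟨κ', -, hκ⟩ := exists_total_lift hF (𝟙 z) κ (𝟙 z.base) (Category.id_comp _)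
  obtain ⟨d, hd, hdr⟩ := hπ.exists_lift (totalMap φ κ ≫ c) c.right
    ((Category.comp_id c.right).trans (Category.id_comp c.right).symm)
  have hd' : IsCart d := hπ.of_comp_eq ((isCart_totalMap φ κ).comp hc) hd
  obtain ⟨l, Z, u, hu⟩ := exists_of_isAcyclicFibration h h' hi (a := a) (b := b)
    (squareTwoCell c.right (a ≫ φ) (b ≫ fibInclusion D) d hd' hdr).hom
  obtain ⟨n, hn⟩ := exists_totalMap_comp φ u (univHom l ⟨𝟙 z.base ≫ c.right⟩)
  let y : ∫ᶜ F.toPseudofunctor := ⟨p.right, (l.app ⟨op p.right⟩).toFunctor.obj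
    (⟨𝟙 p.right⟩ : HomSet p.right p.right)⟩
  let ζ : slice φ y.fiber ⟶ yoSlice (b ≫ fibInclusion D) ⟨𝟙 p.right⟩ := sliceTwo Z _
  let e : objArrow (slice φ y.fiber) ≅ objArrow p' := asIso (mapArrow ζ) ≪≫ asIso π
  have hnd : totalMap φ n ≫ mapArrow ζ = d := by
    refine (congrArg (· ≫ mapArrow ζ) (hn.trans (congrArg (_ ≫ ·) (totalMap_univHom φ l _)))).trans ?_
    refine (Category.assoc _ _ _).trans ((congrArg (mapArrow (sliceMap φ u) ≫ ·)
      (totalMap_comp_mapArrow Z (yoUniv ⟨𝟙 z.base ≫ c.right⟩))).trans ?_)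
    refine (Category.assoc _ _ _).symm.trans ((congrArg (· ≫ _) ((mapArrow_comp _ _).symm.trans
      (congrArg mapArrow hu))).trans ?_)
    refine (squareApp_yoArrow c.right (a ≫ φ) (b ≫ fibInclusion D) d hd' hdr ⟨𝟙 _⟩).trans ?_
    -- The map from the universal element to itself is the identity, by terminality.
    refine (congrArg (· ≫ d) ?_).trans (Category.id_comp d)
    exact (congrArg (totalMap (a ≫ φ)) (yo_hom_univ_ext _ _)).trans (totalMap_id (a ≫ φ) _)
  refine ⟨y, e, κ' ≫ n, ?_⟩
  have hκn : totalMap φ κ' ≫ totalMap φ κ = 𝟙 _ :=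
    (totalMap_comp φ κ' κ).symm.trans ((congrArg (totalMap φ) hκ).trans (totalMap_id φ z))
  refine (congrArg (· ≫ e.hom) (totalMap_comp φ κ' n)).trans ((Category.assoc _ _ _).trans ?_)
  refine (congrArg (totalMap φ κ' ≫ ·) ((Category.assoc _ _ _).symm.trans
    ((congrArg (· ≫ π) hnd).trans hd))).trans ?_
  exact (Category.assoc _ _ _).symm.trans ((congrArg (· ≫ c) hκn).trans (Category.id_comp c))

end Acyclic

open RestrictionSystem RestrictionSystem.FilterQuotient

universe t

/-! ### Representatives of squares of the filter quotient -/

section QuotientArrows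

variable {I : Type t} [Preorder I] {E : Type u'} [Category.{v'} E] {R : RestrictionSystem I E}

lemma lift_tr_ι {W U : I} (h : W ≤ U) {X Y : E} (hY : R.IsOver W Y) (f : Y ⟶ X) :
    R.lift hY f ≫ R.tr h X ≫ R.ι U X = f := by
  rw [R.tr_ι, R.lift_ι]

/-- Restriction to `U` is a pullback. -/
lemma isPullback_ι (U : I) {X Y : E} (f : X ⟶ Y) :
    IsPullback (R.ι U X) (R.ext (R.ι U X ≫ f)) f (R.ι U Y) := by
  refine isPullback_of_exists (R.ext_ι _).symm (fun {T} a b w ↦ ?_) (fun {T} m m' hm _ ↦ ?_)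
  · have hs : R.IsOver U T := R.isOver_of_hom b (R.isOver_res _ _)
    refine ⟨R.lift hs a, R.lift_ι _ _, R.hom_ext _ _ ?_⟩
    rw [Category.assoc, R.ext_ι, ← Category.assoc, R.lift_ι, w]
  · exact R.hom_ext _ _ hm

variable [IsCodirectedOrder I] [Nonempty I]

/-- Testing against all objects over `U`, and not only against the restriction of `X`, lets this be
applied to restrictions of structured arrows, whose domains are other models of the product with
`U`. -/
lemma exists_of_homOf_eq {X Y : E} {f g : X ⟶ Y}
    (h : homOf (R := R) (X := ⟨X⟩) (Y := ⟨Y⟩) f = homOf g) (U₀ : I) :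
    ∃ U ≤ U₀, ∀ {T : E} (_ : R.IsOver U T) (e : T ⟶ X), e ≫ f = e ≫ g := by
  rw [homOf_eq f U₀, homOf_eq g U₀] at h
  obtain ⟨U, h₁, h₂, h⟩ := (homMk_eq_iff _ _).1 h
  refine ⟨U, h₁, fun hT e ↦ ?_⟩
  rw [← lift_tr_ι h₁ hT e, Category.assoc, Category.assoc, Category.assoc, Category.assoc, h]

/-- An object over `W ≤ U` maps to `X` through the restriction of `X` to `U`, where the
representative `l` is defined; so the composite comes from a morphism of `E`. -/
lemma homOf_lift_tr_comp {W U : I} (h : W ≤ U) {T X Y : E} (hT : R.IsOver W T) (e : T ⟶ X)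
    (l : R.res U X ⟶ Y) : homOf (R := R) (X := ⟨T⟩) (Y := ⟨Y⟩) (R.lift hT e ≫ R.tr h X ≫ l) =
      homOf (Y := ⟨X⟩) e ≫ homMk (X := ⟨X⟩) (Y := ⟨Y⟩) U l := by
  have h₁ : homOf (R := R) (X := ⟨T⟩) (Y := ⟨X⟩) e =
      homOf (Y := ⟨R.res U X⟩) (R.lift hT e ≫ R.tr h X) ≫ homOf (R.ι U X) := by
    rw [homOf_comp, Category.assoc, lift_tr_ι]
  have h₂ : homOf (X := ⟨R.res U X⟩) (Y := ⟨X⟩) (R.ι U X) ≫ homMk (X := ⟨X⟩) (Y := ⟨Y⟩) U l =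
      homOf (X := ⟨R.res U X⟩) (Y := ⟨Y⟩) l := resIso_hom_homMk U l
  rw [h₁, Category.assoc, h₂, homOf_comp, Category.assoc]

/-- The representatives live over a common `U`, but the square they form need only commute after
restriction to a smaller `V`. -/
lemma exists_homMk_square {X X' Y Y' : E} (f : X ⟶ X') (g : Y ⟶ Y')
    (a : (⟨X⟩ : FilterQuotient R) ⟶ ⟨Y⟩) (b : (⟨X'⟩ : FilterQuotient R) ⟶ ⟨Y'⟩)
    (w : a ≫ homOf g = homOf f ≫ b) (U₀ : I) :
    ∃ (U V : I) (_ : V ≤ U₀) (h : V ≤ U) (l : R.res U X ⟶ Y) (r : R.res U X' ⟶ Y'),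
      a = homMk U l ∧ b = homMk U r ∧
        R.tr h X ≫ l ≫ g = R.tr h X ≫ R.ext (R.ι U X ≫ f) ≫ r := by
  obtain ⟨U₁, hU₁, l, rfl⟩ := exists_homMk a U₀
  obtain ⟨U, hU, r, rfl⟩ := exists_homMk b U₁
  rw [← homMk_tr hU] at w ⊢
  rw [homMk_comp_homOf, homOf_eq _ U, homMk_comp] at w
  obtain ⟨W, h₁, h₂, w⟩ := (homMk_eq_iff _ _).1 w
  exact ⟨U, W, h₁.trans (hU.trans hU₁), h₁, _, r, rfl, rfl, w⟩

/-- An isomorphism of the quotient has an invertible representative, which agrees with `f` over some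
smaller `U`; restrictions of isomorphisms are pullbacks of them and stay invertible. -/
lemma exists_isIso_ext {X Y : E} (f : X ⟶ Y) (hf : IsIso ((projection R).map f)) (U₀ : I) :
    ∃ U ≤ U₀, IsIso (R.ext (R.ι U X ≫ f)) := by
  let i : (⟨X⟩ : FilterQuotient R) ≅ ⟨Y⟩ := @asIso _ _ _ _ ((projection R).map f) hf
  obtain ⟨W, hW, a, ha, hai⟩ := isIso_rep i U₀
  have hi : i.hom = homMk W (R.ι W X ≫ f) := projection_map f W
  obtain ⟨U, h₁, h₂, e⟩ := (homMk_eq_iff _ _).1 (ha.symm.trans hi)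
  have h := (isPullback_tr h₁ a).isIso_snd_of_isIso
  refine ⟨U, h₁.trans hW, ?_⟩
  rwa [e, ← Category.assoc, R.tr_ι] at h

variable (R) in
/-- The functor from arrows of a category to arrows of its filter quotient. -/
abbrev arrowProj : Arrow E ⥤ Arrow (FilterQuotient R) := (projection R).mapArrow

lemma IsCart.arrowProj {p q : Arrow E} {c : p ⟶ q} (hc : IsCart c) :
    IsCart ((arrowProj R).map c) :=
  isPullback_homOf (R := R) (P := ⟨_⟩) (X := ⟨_⟩) (Y := ⟨_⟩) (Z := ⟨_⟩) hc

lemma exists_of_arrowProj_map_eq {p q : Arrow E} {c d : p ⟶ q}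
    (h : (arrowProj R).map c = (arrowProj R).map d) (U₀ : I) :
    ∃ U ≤ U₀, ∀ {r : Arrow E} (_ : R.IsOver U r.right) (e : r ⟶ p), e ≫ c = e ≫ d := by
  obtain ⟨U, hU, h₁⟩ := exists_of_homOf_eq (R := R) (f := c.left) (g := d.left) congr(($h).left) U₀
  obtain ⟨V, hV, h₂⟩ := exists_of_homOf_eq (R := R) (f := c.right) (g := d.right)
    congr(($h).right) U
  refine ⟨V, hV.trans hU, fun {r} hr e ↦ Arrow.hom_ext _ _ ?_ (h₂ hr e.right)⟩
  exact h₁ (R.isOver_of_hom r.hom (R.isOver_mono hV hr)) e.left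

lemma exists_arrowProj_map_eq {p q : Arrow E} (d : (arrowProj R).obj p ⟶ (arrowProj R).obj q)
    (U₀ : I) : ∃ U ≤ U₀, ∀ {r : Arrow E} (_ : R.IsOver U r.right) (e : r ⟶ p),
      ∃ d' : r ⟶ q, (arrowProj R).map d' = (arrowProj R).map e ≫ d := by
  obtain ⟨U, W, hW, h₁, l, r, hl, hr, w⟩ := exists_homMk_square p.hom q.hom d.left d.right d.w U₀
  refine ⟨W, hW, fun {p'} hp e ↦ ?_⟩
  have hp' : R.IsOver W p'.left := R.isOver_of_hom p'.hom hp
  refine ⟨Arrow.homMk (R.lift hp' e.left ≫ R.tr h₁ _ ≫ l) (R.lift hp e.right ≫ R.tr h₁ _ ≫ r) ?_,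
    Arrow.hom_ext _ _ ?_ ?_⟩
  · have h : R.lift hp' e.left ≫ R.tr h₁ _ ≫ R.ext (R.ι U _ ≫ p.hom) =
        p'.hom ≫ R.lift hp e.right ≫ R.tr h₁ _ := by
      refine R.hom_ext _ _ ?_
      simp only [Category.assoc, R.ext_ι]
      rw [lift_tr_ι, ← Category.assoc (R.tr h₁ _), ← Category.assoc, lift_tr_ι]
      exact e.w
    simp only [Category.assoc, w]
    rw [← Category.assoc (R.tr h₁ _), ← Category.assoc (R.lift _ _), h]
    simp only [Category.assoc]
  · exact (homOf_lift_tr_comp h₁ hp' e.left l).trans (congrArg (_ ≫ ·) hl.symm)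
  · exact (homOf_lift_tr_comp h₁ hp e.right r).trans (congrArg (_ ≫ ·) hr.symm)

/-- Compare `c` with the pullback of `q` along `c.right`. The comparison `κ` is invertible in the
quotient, hence invertible over some `U`, so that over `U` the square `c` is itself a pullback. -/
lemma exists_isCart_comp [HasPullbacks E] {p q : Arrow E} {c : p ⟶ q}
    (h : IsCart ((arrowProj R).map c)) (U₀ : I) :
    ∃ U ≤ U₀, ∀ {r : Arrow E} (_ : R.IsOver U r.right) (e : r ⟶ p), IsCart e → IsCart (e ≫ c) := by
  obtain ⟨Q, q', π, hπ, hπr⟩ := exists_isCart q c.right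
  obtain ⟨κ, rfl, hκr⟩ := hπ.exists_lift c (𝟙 _) (by rw [hπr]; exact Category.id_comp _)
  have : IsIso κ.right := by rw [hκr]; exact inferInstanceAs (IsIso (𝟙 p.right))
  have : IsIso ((arrowProj R).map κ) := by
    refine (hπ.arrowProj.of_comp (by rwa [Functor.map_comp] at h)).isIso ?_
    exact inferInstanceAs (IsIso ((projection R).map κ.right))
  obtain ⟨U, hU, hκ⟩ := exists_isIso_ext (R := R) κ.left
    (inferInstanceAs (IsIso (Arrow.leftFunc.map ((arrowProj R).map κ)))) U₀
  have hκι : R.ext (R.ι U p.left ≫ κ.left) ≫ R.ι U Q = R.ι U p.left ≫ κ.left := R.ext_ι _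
  generalize R.ext (R.ι U p.left ≫ κ.left) = k at hκ hκι
  refine ⟨U, hU, fun {r} hr e he ↦ ?_⟩
  rw [← Category.assoc]
  refine .comp ?_ hπ
  have hk {T : E} (hT : R.IsOver U T) (n : T ⟶ p.left) : n ≫ κ.left = R.lift hT n ≫ k ≫ R.ι U Q := by
    rw [hκι, ← Category.assoc, R.lift_ι]
  -- Every test object maps to `r.right` and so lies over `U`. Its maps to `p.left` and `Q` factor
  -- through the restrictions to `U`, between which `k` is invertible.
  refine isPullback_of_exists (e ≫ κ).w (fun {T} a b w ↦ ?_) (fun {T} m m' h₁ h₂ ↦ ?_)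
  · have hT : R.IsOver U T := R.isOver_of_hom b hr
    obtain ⟨n, hn⟩ : ∃ n : T ⟶ p.left, n ≫ κ.left = a := by
      refine ⟨R.lift hT a ≫ inv k ≫ R.ι U p.left, ?_⟩
      rw [Category.assoc, Category.assoc, ← hκι, IsIso.inv_hom_id_assoc]
      exact R.lift_ι hT a
    have hn' : n ≫ p.hom = b ≫ e.right := by
      rw [← cancel_mono κ.right, Category.assoc, Category.assoc, ← κ.w, ← Category.assoc, hn]
      exact w
    refine ⟨he.lift n b hn', ?_, he.lift_snd n b hn'⟩
    exact (Category.assoc _ _ _).symm.trans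
      ((congrArg (· ≫ κ.left) (he.lift_fst n b hn')).trans hn)
  · have hT : R.IsOver U T := R.isOver_of_hom (m ≫ r.hom) hr
    refine IsPullback.hom_ext he ?_ h₂
    have h₁' : (m ≫ e.left) ≫ κ.left = (m' ≫ e.left) ≫ κ.left := by
      rw [Category.assoc, Category.assoc]
      exact h₁
    rw [hk hT, hk hT, ← Category.assoc, ← Category.assoc] at h₁'
    have := (cancel_mono k).1 (R.hom_ext _ _ h₁')
    rw [← R.lift_ι hT (m ≫ e.left), this, R.lift_ι]

end QuotientArrows

/-! ### The total category of the filter quotient is structured -/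

section InducedArrow

variable {C : Type u} [Category.{v} C] [HasPullbacks C] [HasTerminal C] [HasBinaryProducts C]
  (Φ : Order.PFilter (Subobject (⊤_ C))) {F : LocallyDiscrete Cᵒᵖ ⥤ᵖ Cat.{v, max u v}}
  (φ : F ⟶ codomainPseudo C)

/-- The image in the filter quotient of the map of arrows given by a morphism of `∫ F`. -/
abbrev quotientMap {x y : ∫ᶜ F} (f : x ⟶ y) :
    (arrowProj (productSystem Φ)).obj ((totalArrow φ).obj x) ⟶
      (arrowProj (productSystem Φ)).obj ((totalArrow φ).obj y) :=
  (arrowProj (productSystem Φ)).map ((totalArrow φ).map f)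

/-- The map of arrows given by a morphism of `(∫ F)_Φ`. -/
abbrev inducedMap {x y : ∫ᶜ F} (f : (⟨x⟩ : InducedTotal Φ F) ⟶ ⟨y⟩) :
    (arrowProj (productSystem Φ)).obj ((totalArrow φ).obj x) ⟶
      (arrowProj (productSystem Φ)).obj ((totalArrow φ).obj y) :=
  (inducedArrow Φ φ).map f

instance (U : Φ) (z : ∫ᶜ F) : IsIso (quotientMap Φ φ ((totalSystem Φ F).ι U z)) :=
  inferInstanceAs (IsIso ((totalArrow φ ⋙ (projection (productSystem Φ)).mapArrow).map
    ((totalSystem Φ F).ι U z)))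

lemma quotientMap_comp {x y z : ∫ᶜ F} (f : x ⟶ y) (g : y ⟶ z) :
    quotientMap Φ φ (f ≫ g) = quotientMap Φ φ f ≫ quotientMap Φ φ g :=
  (totalArrow φ ⋙ arrowProj (productSystem Φ)).map_comp f g

/-- The induced functor sends the class of `f` to the inverse of the image of `x × U ⟶ x` followed
by the image of `f`; below, it is computed through this identity. -/
lemma quotientMap_ι_inducedMap {x y : ∫ᶜ F} (U : Φ) (f : (totalSystem Φ F).res U x ⟶ y) :
    quotientMap Φ φ ((totalSystem Φ F).ι U x) ≫
      inducedMap Φ φ (homMk (X := ⟨x⟩) (Y := ⟨y⟩) U f) = quotientMap Φ φ f :=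
  IsIso.hom_inv_id_assoc (quotientMap Φ φ ((totalSystem Φ F).ι U x)) (quotientMap Φ φ f)

lemma quotientMap_tr_ι {W U : Φ} (h : W ≤ U) (x : ∫ᶜ F) :
    quotientMap Φ φ ((totalSystem Φ F).tr h x) ≫ quotientMap Φ φ ((totalSystem Φ F).ι U x) =
      quotientMap Φ φ ((totalSystem Φ F).ι W x) := by
  rw [← quotientMap_comp, (totalSystem Φ F).tr_ι]

lemma inducedMap_projection {x y : ∫ᶜ F} (f : x ⟶ y) :
    inducedMap Φ φ ((projection (totalSystem Φ F)).map f) = quotientMap Φ φ f := by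
  let U : Φ := Classical.arbitrary Φ
  rw [← cancel_epi (quotientMap Φ φ ((totalSystem Φ F).ι U x))]
  exact (congrArg (fun f ↦ _ ≫ inducedMap Φ φ f) (projection_map f U)).trans
    ((quotientMap_ι_inducedMap Φ φ U _).trans (quotientMap_comp Φ φ _ _))

lemma isCart_quotientMap {x y : ∫ᶜ F} (f : x ⟶ y) : IsCart (quotientMap Φ φ f) :=
  IsCart.arrowProj (totalArrow_isPullback φ f)

lemma isCart_inducedMap {x y : ∫ᶜ F} (f : (⟨x⟩ : InducedTotal Φ F) ⟶ ⟨y⟩) :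
    IsCart (inducedMap Φ φ f) := by
  obtain ⟨U, -, f, rfl⟩ := exists_homMk f (Classical.arbitrary Φ)
  have : inducedMap Φ φ (homMk U f) =
      inv (quotientMap Φ φ ((totalSystem Φ F).ι U x)) ≫ quotientMap Φ φ f := by
    rw [IsIso.eq_inv_comp]
    exact quotientMap_ι_inducedMap Φ φ U f
  rw [this]
  exact .comp (.of_isIso _) (isCart_quotientMap Φ φ f)

variable {Φ φ}

/-- Maps of arrows that become equal in the filter quotient are equal after restriction. -/
lemma exists_tr_comp_eq {x : ∫ᶜ F} {q : Arrow C} {U : Φ}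
    {c d : (totalArrow φ).obj ((totalSystem Φ F).res U x) ⟶ q}
    (h : (arrowProj (productSystem Φ)).map c = (arrowProj (productSystem Φ)).map d) :
    ∃ (W : Φ) (hW : W ≤ U), (totalArrow φ).map ((totalSystem Φ F).tr hW x) ≫ c =
      (totalArrow φ).map ((totalSystem Φ F).tr hW x) ≫ d := by
  obtain ⟨W, hW, h⟩ := exists_of_arrowProj_map_eq h U
  exact ⟨W, hW, h (r := (totalArrow φ).obj ((totalSystem Φ F).res W x))
    (show (productSystem Φ).IsOver W _ from (totalSystem Φ F).isOver_res W x) _⟩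

/-- Maps of arrows in the filter quotient are represented by maps of restricted arrows. -/
lemma exists_quotientMap_comp_eq {x : ∫ᶜ F} {q : Arrow C}
    (d : (arrowProj (productSystem Φ)).obj ((totalArrow φ).obj x) ⟶
      (arrowProj (productSystem Φ)).obj q) (U₀ : Φ) :
    ∃ (U : Φ) (_ : U ≤ U₀) (d' : (totalArrow φ).obj ((totalSystem Φ F).res U x) ⟶ q),
      (arrowProj (productSystem Φ)).map d' = quotientMap Φ φ ((totalSystem Φ F).ι U x) ≫ d := by
  obtain ⟨U, hU, h⟩ := exists_arrowProj_map_eq d U₀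
  obtain ⟨d', hd'⟩ := h (r := (totalArrow φ).obj ((totalSystem Φ F).res U x))
    (show (productSystem Φ).IsOver U _ from (totalSystem Φ F).isOver_res U x)
    ((totalArrow φ).map ((totalSystem Φ F).ι U x))
  exact ⟨U, hU, d', hd'⟩

/-- Pullback squares in the filter quotient are represented by pullback squares. -/
lemma exists_isCart_quotientMap_comp_eq {x : ∫ᶜ F} {q : Arrow C}
    (d : (arrowProj (productSystem Φ)).obj ((totalArrow φ).obj x) ⟶
      (arrowProj (productSystem Φ)).obj q) (hd : IsCart d) (U₀ : Φ) :
    ∃ (U : Φ) (_ : U ≤ U₀) (d' : (totalArrow φ).obj ((totalSystem Φ F).res U x) ⟶ q), IsCart d' ∧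
      (arrowProj (productSystem Φ)).map d' = quotientMap Φ φ ((totalSystem Φ F).ι U x) ≫ d := by
  obtain ⟨U, hU, d', hd'⟩ := exists_quotientMap_comp_eq d U₀
  have h : IsCart ((arrowProj (productSystem Φ)).map d') := by
    rw [hd']
    exact (isCart_quotientMap Φ φ _).comp hd
  obtain ⟨W, hW, h⟩ := exists_isCart_comp h U
  refine ⟨W, hW.trans hU, (totalArrow φ).map ((totalSystem Φ F).tr hW x) ≫ d',
    h (r := (totalArrow φ).obj ((totalSystem Φ F).res W x))
      (show (productSystem Φ).IsOver W _ from (totalSystem Φ F).isOver_res W x) _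
      (totalArrow_isPullback φ _), ?_⟩
  rw [Functor.map_comp, hd', ← Category.assoc, quotientMap_tr_ι]

/-- Equal images in the quotient become equal squares after restriction to some `W`, where the
injectivity of `totalArrow φ` applies. -/
lemma inducedMap_injective (hT : IsStructured (totalArrow φ)) {x y : ∫ᶜ F}
    {m n : (⟨x⟩ : InducedTotal Φ F) ⟶ ⟨y⟩} (h : inducedMap Φ φ m = inducedMap Φ φ n) : m = n := by
  obtain ⟨U, f, g, rfl, rfl⟩ := exists_homMk₂ m n
  have e : quotientMap Φ φ f = quotientMap Φ φ g := by
    rw [← quotientMap_ι_inducedMap, h, quotientMap_ι_inducedMap]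
  obtain ⟨W, hW, e⟩ := exists_tr_comp_eq e
  rw [← Functor.map_comp, ← Functor.map_comp] at e
  exact (homMk_eq_iff _ _).2 ⟨W, hW, hW, hT.map_injective e⟩

/-- All three maps are represented over members of the filter, and the given equation holds between
squares of the original category over some `W`; there the factorization in `∫ F` exists. -/
lemma exists_inducedMap_eq (hT : IsStructured (totalArrow φ)) {x y z : ∫ᶜ F}
    (f : (⟨x⟩ : InducedTotal Φ F) ⟶ ⟨z⟩) (g : (⟨y⟩ : InducedTotal Φ F) ⟶ ⟨z⟩)
    (h : (arrowProj (productSystem Φ)).obj ((totalArrow φ).obj x) ⟶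
      (arrowProj (productSystem Φ)).obj ((totalArrow φ).obj y))
    (w : h ≫ inducedMap Φ φ g = inducedMap Φ φ f) :
    ∃ m : (⟨x⟩ : InducedTotal Φ F) ⟶ ⟨y⟩, inducedMap Φ φ m = h := by
  obtain ⟨U₁, -, f, rfl⟩ := exists_homMk f (Classical.arbitrary Φ)
  obtain ⟨U, hU, g, rfl⟩ := exists_homMk g U₁
  obtain ⟨V, hV, h', hh'⟩ := exists_quotientMap_comp_eq h U
  -- As `V ≤ U`, the representative of `h` factors through the restriction of `y` to `U`, where `g`
  -- is defined.
  obtain ⟨k, hk⟩ : ∃ k : (totalArrow φ).obj ((totalSystem Φ F).res V x) ⟶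
      (totalArrow φ).obj ((totalSystem Φ F).res U y),
      k ≫ (totalArrow φ).map ((totalSystem Φ F).ι U y) = h' := by
    obtain ⟨k, hk, -⟩ := (isCart_totalMap φ ((totalSystem Φ F).ι U y)).exists_lift h'
      ((productSystem Φ).lift ((productSystem Φ).isOver_mono hV
        ((totalSystem Φ F).isOver_res V x)) h'.right) ((productSystem Φ).lift_ι _ _)
    exact ⟨k, hk⟩
  have hk' : (arrowProj (productSystem Φ)).map k ≫ quotientMap Φ φ ((totalSystem Φ F).ι U y) =
      (arrowProj (productSystem Φ)).map h' :=
    ((arrowProj (productSystem Φ)).map_comp _ _).symm.trans (congrArg _ hk)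
  have e : (arrowProj (productSystem Φ)).map (k ≫ (totalArrow φ).map g) =
      (arrowProj (productSystem Φ)).map ((totalArrow φ).map
        ((totalSystem Φ F).tr (hV.trans hU) x ≫ f)) :=
    calc
      _ = (arrowProj (productSystem Φ)).map k ≫ quotientMap Φ φ g := Functor.map_comp _ _ _
      _ = (arrowProj (productSystem Φ)).map k ≫ quotientMap Φ φ ((totalSystem Φ F).ι U y) ≫
          inducedMap Φ φ (homMk (X := ⟨y⟩) (Y := ⟨z⟩) U g) := by rw [quotientMap_ι_inducedMap]
      _ = (arrowProj (productSystem Φ)).map h' ≫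
          inducedMap Φ φ (homMk (X := ⟨y⟩) (Y := ⟨z⟩) U g) := by rw [← Category.assoc, hk']
      _ = quotientMap Φ φ ((totalSystem Φ F).ι V x) ≫
          inducedMap Φ φ (homMk (X := ⟨x⟩) (Y := ⟨z⟩) U₁ f) := by rw [hh', Category.assoc, w]
      _ = quotientMap Φ φ ((totalSystem Φ F).tr (hV.trans hU) x ≫ f) := by
        rw [← quotientMap_tr_ι Φ φ (hV.trans hU), Category.assoc, quotientMap_ι_inducedMap,
          ← quotientMap_comp]
  obtain ⟨W, hW, e⟩ := exists_tr_comp_eq e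
  obtain ⟨m, hm⟩ := hT.exists_fac (x := (totalSystem Φ F).res W x)
    ((totalSystem Φ F).tr hW x ≫ (totalSystem Φ F).tr (hV.trans hU) x ≫ f) g
    ((totalArrow φ).map ((totalSystem Φ F).tr hW x) ≫ k)
    ((Category.assoc _ _ _).trans (e.trans (Functor.map_comp _ _ _).symm))
  refine ⟨homMk W (m ≫ (totalSystem Φ F).ι U y), ?_⟩
  have hm' : quotientMap Φ φ m = quotientMap Φ φ ((totalSystem Φ F).tr hW x) ≫
      (arrowProj (productSystem Φ)).map k :=
    (congrArg (arrowProj (productSystem Φ)).map hm).trans (Functor.map_comp _ _ _)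
  rw [← cancel_epi (quotientMap Φ φ ((totalSystem Φ F).ι W x))]
  calc
    _ = quotientMap Φ φ (m ≫ (totalSystem Φ F).ι U y) := quotientMap_ι_inducedMap Φ φ W _
    _ = quotientMap Φ φ ((totalSystem Φ F).tr hW x) ≫ (arrowProj (productSystem Φ)).map h' := by
      rw [quotientMap_comp, hm', Category.assoc, hk']
    _ = quotientMap Φ φ ((totalSystem Φ F).ι W x) ≫ h := by
      rw [hh', ← Category.assoc, quotientMap_tr_ι]

lemma isStructured_inducedArrow (hT : IsStructured (totalArrow φ)) :
    IsStructured (inducedArrow Φ φ) where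
  isCart_map f := isCart_inducedMap Φ φ f
  exists_lift {z p} c hc := by
    -- Only the codomain part of `c` needs a representative `k`: the lift is the reindexing of `z`
    -- along `k`, whose base is isomorphic in the quotient to `p.right`.
    obtain ⟨U, -, k, hk⟩ := exists_homMk c.right (Classical.arbitrary Φ)
    let f : domainCartesianLift z.as.fiber k ⟶ z.as := cartesianLift z.as.fiber k
    let ρ := resIso U p.right
    have e : ρ.inv ≫ homOf k = c.right := by
      rw [Iso.inv_comp_eq, hk]
      exact (resIso_hom_homMk U k).symm
    obtain ⟨a, ha, har⟩ := (isCart_quotientMap Φ φ f).exists_lift c ρ.inv e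
    have hi : IsIso a := ((isCart_quotientMap Φ φ f).of_comp_eq hc ha).isIso (by
      rw [har]
      exact ρ.isIso_inv)
    exact ⟨⟨_⟩, (projection (totalSystem Φ F)).map f, @asIso _ _ _ _ a hi,
      (congrArg (a ≫ ·) (inducedMap_projection Φ φ f)).trans ha⟩
  exists_fac f g h w := exists_inducedMap_eq hT f g h w
  map_injective h := inducedMap_injective hT h

end InducedArrow

section Representatives

variable {I : Type t} [Preorder I] {E : Type u'} [Category.{v'} E] {R : RestrictionSystem I E}
  [IsCodirectedOrder I] [Nonempty I]

/-- An arrow of the filter quotient is isomorphic to the image of a representative. -/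
def isoOfRep (p : Arrow (FilterQuotient R)) (U : I) (g : R.res U p.left.as ⟶ p.right.as)
    (hg : p.hom = homMk U g) : (arrowProj R).obj (Arrow.mk g) ≅ p :=
  Arrow.isoMk (f := (arrowProj R).obj (Arrow.mk g)) (g := p) (resIso U p.left) (Iso.refl p.right) (by
    rw [hg]
    exact (resIso_hom_homMk U g).trans (Category.comp_id _).symm)

/-- An arrow of the filter quotient is isomorphic to the image of a representative over `U`. -/
def isoOfExt (p : Arrow (FilterQuotient R)) (U : I) (g : R.res U p.left.as ⟶ p.right.as)
    (hg : p.hom = homMk U g) : (arrowProj R).obj (Arrow.mk (R.ext g)) ≅ p :=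
  Arrow.isoMk (f := (arrowProj R).obj (Arrow.mk (R.ext g))) (g := p) (resIso U p.left)
    (resIso U p.right) (by
      rw [hg]
      refine (resIso_hom_homMk U g).trans ?_
      rw [← R.ext_ι g]
      exact ((projection R).map_comp _ _).trans (by rw [R.ext_ι]; rfl))

end Representatives

/-! ### Universal structures and fibrations in the filter quotient -/

section Transfer

variable {C : Type u} [Category.{v} C] [HasPullbacks C] [HasTerminal C] [HasBinaryProducts C]
  {Φ : Order.PFilter (Subobject (⊤_ C))} {F : LocallyDiscrete Cᵒᵖ ⥤ᵖ Cat.{v, max u v}}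
  {φ : F ⟶ codomainPseudo C}

lemma quotientMap_ι_inducedMap_comp {x y : ∫ᶜ F} {q : Arrow C} (U : Φ)
    (f : (totalSystem Φ F).res U x ⟶ y) (c : (totalArrow φ).obj y ⟶ q) :
    quotientMap Φ φ ((totalSystem Φ F).ι U x) ≫ inducedMap Φ φ (homMk (X := ⟨x⟩) (Y := ⟨y⟩) U f) ≫
      (arrowProj (productSystem Φ)).map c =
        (arrowProj (productSystem Φ)).map ((totalArrow φ).map f ≫ c) := by
  rw [← Category.assoc, quotientMap_ι_inducedMap, Functor.map_comp]

/-- For existence, `d` is represented by a pullback square over some `V`. For uniqueness, the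
composites of two solutions with `c` agree over some `W`, where the uniqueness in `h` applies. -/
lemma existsUnique_inducedMap_comp_eq (hT : IsStructured (totalArrow φ)) {z : ∫ᶜ F} {q : Arrow C}
    {c : (totalArrow φ).obj z ⟶ q} (hc : IsCart c)
    (h : ∀ y (d : (totalArrow φ).obj y ⟶ q), IsCart d →
      ∃! m : y ⟶ z, (totalArrow φ).map m ≫ c = d) (y : ∫ᶜ F)
    (d : (arrowProj (productSystem Φ)).obj ((totalArrow φ).obj y) ⟶
      (arrowProj (productSystem Φ)).obj q) (hd : IsCart d) :
    ∃! m : (⟨y⟩ : InducedTotal Φ F) ⟶ ⟨z⟩,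
      inducedMap Φ φ m ≫ (arrowProj (productSystem Φ)).map c = d := by
  obtain ⟨V, -, d', hd', hdd⟩ := exists_isCart_quotientMap_comp_eq d hd (Classical.arbitrary Φ)
  obtain ⟨m, hm, -⟩ := h _ d' hd'
  have hm' : inducedMap Φ φ (homMk (X := ⟨y⟩) (Y := ⟨z⟩) V m) ≫
      (arrowProj (productSystem Φ)).map c = d := by
    rw [← cancel_epi (quotientMap Φ φ ((totalSystem Φ F).ι V y)), quotientMap_ι_inducedMap_comp,
      hm, hdd]
  refine ⟨homMk V m, hm', fun n (hn : inducedMap Φ φ n ≫ _ = d) ↦ ?_⟩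
  rw [← hm'] at hn
  generalize homMk V m = m at hn
  obtain ⟨U, f, g, rfl, rfl⟩ := exists_homMk₂ n m
  have e : (arrowProj (productSystem Φ)).map ((totalArrow φ).map f ≫ c) =
      (arrowProj (productSystem Φ)).map ((totalArrow φ).map g ≫ c) := by
    rw [← quotientMap_ι_inducedMap_comp, hn, quotientMap_ι_inducedMap_comp]
  obtain ⟨W, hW, e⟩ := exists_tr_comp_eq e
  refine (homMk_eq_iff _ _).2 ⟨W, hW, hW, (h _ ((totalArrow φ).map ((totalSystem Φ F).tr hW y ≫ g) ≫
    c) ((hT.isCart_map _).comp hc)).unique ?_ rfl⟩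
  rw [Functor.map_comp, Functor.map_comp, Category.assoc, Category.assoc]
  exact e

lemma hasUniversal_inducedArrow (hT : IsStructured (totalArrow φ))
    (h : IsStructured.HasUniversal (totalArrow φ)) :
    IsStructured.HasUniversal (inducedArrow Φ φ) := by
  intro p
  obtain ⟨U, -, g, hg⟩ := exists_homMk p.hom (Classical.arbitrary Φ)
  let e := isoOfRep p U g hg
  obtain ⟨z, c, hc, hu⟩ := h (Arrow.mk g)
  refine ⟨⟨z⟩, (arrowProj (productSystem Φ)).map c ≫ e.hom, hc.arrowProj.comp (.of_isIso _), ?_⟩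
  rintro ⟨y⟩ d hd
  obtain ⟨m, hm, hm'⟩ := existsUnique_inducedMap_comp_eq hT hc hu y (d ≫ e.inv)
    (hd.comp (.of_isIso _))
  refine ⟨m, ?_, fun n hn ↦ hm' n ?_⟩
  · exact (Category.assoc _ _ _).symm.trans ((Iso.eq_comp_inv e).1 hm)
  · exact (Iso.eq_comp_inv e).2 ((Category.assoc _ _ _).trans hn)

/-- Images of fibrations are fibrations because restriction is a base change. Conversely, a
fibration of the quotient is isomorphic to the image of its representative over `U`, a fibration
with a structure; the representative over `U` is used because it is the one that the definition of
fibrations concerns. -/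
lemma coversFibrations_inducedArrow [CategoryWithFibrations C]
    [(fibrations C).IsStableUnderBaseChange] (h : IsStructured.CoversFibrations (totalArrow φ)) :
    IsStructured.CoversFibrations (inducedArrow Φ φ) := by
  refine ⟨fun z ↦ ?_, ?_⟩
  · let U : Φ := Classical.arbitrary Φ
    exact ⟨U, _, homOf_eq _ U, (fibrations C).of_isPullback (isPullback_ι U _) (h.1 z.as)⟩
  · rintro p ⟨U, g, hg, hf⟩
    obtain ⟨z, ⟨e⟩⟩ := h.2 (Arrow.mk ((productSystem Φ).ext g)) hf
    exact ⟨⟨z⟩, ⟨(arrowProj (productSystem Φ)).mapIso e ≪≫ isoOfExt p U g hg⟩⟩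

end Transfer

/-! ### Classes of morphisms stable under restriction -/

section Restriction

variable {I : Type t} [Preorder I] {E : Type u'} [Category.{v'} E] {R : RestrictionSystem I E}
  [IsCodirectedOrder I]

/-- A property that is stable under restriction is stable under passing to a smaller index. -/
lemma ext_tr_of_ext {S : MorphismProperty E} [S.RespectsIso]
    (hS : ∀ (U : I) {X Y : E} (f : X ⟶ Y), S f → S (R.ext (R.ι U X ≫ f))) {X Y : E} {U W : I}
    (h : W ≤ U) (g : R.res U X ⟶ Y) (hg : S (R.ext g)) : S (R.ext (R.tr h X ≫ g)) := by
  -- For `W ≤ U`, the product `Z × W` is also `(Z × U) × W`; hence restricting the representative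
  -- over `U` to `W` is restricting an actual morphism.
  let α (Z : E) : R.res W Z ≅ R.res W (R.res U Z) :=
    { hom := R.lift (R.isOver_res W Z) (R.tr h Z)
      inv := R.ext (R.ι W _ ≫ R.ι U Z)
      hom_inv_id := R.hom_ext _ _ (by
        rw [Category.assoc, R.ext_ι, ← Category.assoc, R.lift_ι, R.tr_ι, Category.id_comp])
      inv_hom_id := R.hom_ext _ _ (R.hom_ext _ _ (by
        rw [Category.assoc (R.ext _), R.lift_ι, Category.assoc, R.tr_ι, R.ext_ι,
          Category.id_comp])) }
  refine (S.arrow_mk_iso_iff (Arrow.isoMk (α X) (α Y) ?_)).2 (hS W _ hg)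
  refine R.hom_ext _ _ ?_
  change (R.lift _ _ ≫ R.ext _) ≫ _ = (R.ext _ ≫ R.lift _ _) ≫ _
  rw [Category.assoc, R.ext_ι, ← Category.assoc, R.lift_ι, Category.assoc, R.lift_ι]
  exact tr_ext h g

/-- A variant of `quotientProperty_of_iso` for cofibrations, which are stable under products with
members of the filter but in general not under base change. -/
lemma quotientProperty_iso_comp [Nonempty I] {S : MorphismProperty E} [S.RespectsIso]
    (hS : ∀ (U : I) {X Y : E} (f : X ⟶ Y), S f → S (R.ext (R.ι U X ≫ f)))
    {X Y Z : FilterQuotient R} (e : X ≅ Y) (f : Y ⟶ Z) (hf : quotientProperty S f) :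
    quotientProperty S (e.hom ≫ f) := by
  obtain ⟨U, f, rfl, hf⟩ := hf
  obtain ⟨W, h, a, ha, _⟩ := isIso_rep e U
  refine ⟨W, R.ext a ≫ R.tr h _ ≫ f, ?_, ?_⟩
  · rw [← homMk_comp, homMk_tr, ha]
  · rw [ext_comp_ext, MorphismProperty.cancel_left_of_respectsIso S]
    exact ext_tr_of_ext hS h f hf

lemma isIso_projection_map_tr [Nonempty I] {U W : I} (h : W ≤ U) (X : E) :
    IsIso ((projection R).map (R.tr h X)) := by
  have e : (projection R).map (R.tr h X) ≫ (projection R).map (R.ι U X) =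
      (projection R).map (R.ι W X) := by
    rw [← Functor.map_comp, R.tr_ι]
  have : IsIso ((projection R).map (R.tr h X) ≫ (projection R).map (R.ι U X)) := by
    rw [e]
    infer_instance
  exact IsIso.of_isIso_comp_right _ ((projection R).map (R.ι U X))

end Restriction

/-! ### Extension of structures in the filter quotient -/

section Acyclic

lemma totalSystem_tr_base {C : Type u} [Category.{v} C] [HasTerminal C] [HasBinaryProducts C]
    {Φ : Order.PFilter (Subobject (⊤_ C))} {F : LocallyDiscrete Cᵒᵖ ⥤ᵖ Cat.{v, max u v}} {U W : Φ}
    (h : W ≤ U) (z : ∫ᶜ F) :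
    ((totalSystem Φ F).tr h z).base = (productSystem Φ).tr h z.base :=
  (productSystem Φ).hom_ext _ _ ((congrArg Hom.base ((totalSystem Φ F).tr_ι h z)).trans
    ((productSystem Φ).tr_ι h z.base).symm)

variable {C : Type u} [Category.{v} C] [HasPullbacks C] [HasTerminal C] [HasBinaryProducts C]
  {Φ : Order.PFilter (Subobject (⊤_ C))} {F : LocallyDiscrete Cᵒᵖ ⥤ᵖ Cat.{v, max u v}}
  {φ : F ⟶ codomainPseudo C}

lemma inducedMap_homMk_comp_eq {x y : ∫ᶜ F} {q : Arrow C} {U : Φ}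
    {f : (totalSystem Φ F).res U x ⟶ y} {c : (totalArrow φ).obj y ⟶ q}
    {d : (arrowProj (productSystem Φ)).obj ((totalArrow φ).obj x) ⟶
      (arrowProj (productSystem Φ)).obj q}
    (h : (arrowProj (productSystem Φ)).map ((totalArrow φ).map f ≫ c) =
      quotientMap Φ φ ((totalSystem Φ F).ι U x) ≫ d) :
    inducedMap Φ φ (homMk (X := ⟨x⟩) (Y := ⟨y⟩) U f) ≫ (arrowProj (productSystem Φ)).map c = d := by
  rw [← cancel_epi (quotientMap Φ φ ((totalSystem Φ F).ι U x)), quotientMap_ι_inducedMap_comp, h]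

/-- A pullback square in the filter quotient over a map with representative `i` is represented by
one over the map induced by a restriction of `i`. -/
lemma exists_isCart_right_eq {z : ∫ᶜ F} {X Y : C} {U U' : Φ} (g : (productSystem Φ).res U X ⟶ Y)
    (i : (productSystem Φ).res U' z.base ⟶ Y)
    (d : (arrowProj (productSystem Φ)).obj ((totalArrow φ).obj z) ⟶
      (arrowProj (productSystem Φ)).obj (Arrow.mk ((productSystem Φ).ext g))) (hd : IsCart d)
    (b : (⟨z.base⟩ : FilterQuotientCategory Φ) ⟶ ⟨(productSystem Φ).res U Y⟩) (hb : d.right = b)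
    (hi : b ≫ homOf (X := ⟨(productSystem Φ).res U Y⟩) (Y := ⟨Y⟩) ((productSystem Φ).ι U Y) =
      homMk U' i) :
    ∃ (W : Φ) (hU : W ≤ U) (hU' : W ≤ U') (c : (totalArrow φ).obj ((totalSystem Φ F).res W z) ⟶
        Arrow.mk ((productSystem Φ).ext g)), IsCart c ∧
      (arrowProj (productSystem Φ)).map c = quotientMap Φ φ ((totalSystem Φ F).ι W z) ≫ d ∧
      @Eq ((productSystem Φ).res W z.base ⟶ (productSystem Φ).res U Y) c.right
        ((productSystem Φ).ext ((productSystem Φ).tr hU' z.base ≫ i) ≫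
          (productSystem Φ).tr hU Y) := by
  obtain ⟨U₀, h₀, h₀'⟩ := exists_le_le U U'
  obtain ⟨V, hV, c, hc, hcd⟩ := exists_isCart_quotientMap_comp_eq d hd U₀
  obtain ⟨k, hk⟩ : ∃ k : (productSystem Φ).res V z.base ⟶ (productSystem Φ).res U Y, c.right = k :=
    ⟨c.right, rfl⟩
  have hkb : homOf (R := productSystem Φ) (X := ⟨(productSystem Φ).res V z.base⟩)
      (Y := ⟨(productSystem Φ).res U Y⟩) k =
      homOf (Y := ⟨z.base⟩) ((productSystem Φ).ι V z.base) ≫ b := by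
    rw [← hk, ← hb]
    exact congr(($hcd).right)
  have hr : homOf (R := productSystem Φ) (X := ⟨(productSystem Φ).res V z.base⟩) (Y := ⟨Y⟩)
      (k ≫ (productSystem Φ).ι U Y) =
        homOf ((productSystem Φ).tr (hV.trans h₀') z.base ≫ i) := by
    refine Eq.trans ?_ (resIso_hom_homMk (R := productSystem Φ) (X := ⟨z.base⟩) (Y := ⟨Y⟩) V _)
    rw [homMk_tr, ← hi]
    refine (homOf_comp (R := productSystem Φ) (X := ⟨_⟩) (Y := ⟨_⟩) (Z := ⟨_⟩) k _).symm.trans ?_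
    rw [hkb]
    exact Category.assoc _ _ _
  -- The codomain part of the representing square and the restriction of `i` agree in the quotient,
  -- hence already over some `W`.
  obtain ⟨W, hW, hr⟩ := exists_of_homOf_eq (R := productSystem Φ) hr V
  refine ⟨W, hW.trans (hV.trans h₀), hW.trans (hV.trans h₀'),
    (totalArrow φ).map ((totalSystem Φ F).tr hW z) ≫ c,
    IsCart.comp (totalArrow_isPullback φ _) hc, ?_, ?_⟩
  · rw [Functor.map_comp, hcd, ← Category.assoc, quotientMap_tr_ι]
  · have e : (productSystem Φ).tr hW z.base ≫ k =
        (productSystem Φ).ext ((productSystem Φ).tr (hW.trans (hV.trans h₀')) z.base ≫ i) ≫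
          (productSystem Φ).tr (hW.trans (hV.trans h₀)) Y := by
      refine (productSystem Φ).hom_ext _ _ ?_
      rw [Category.assoc, Category.assoc, (productSystem Φ).tr_ι, (productSystem Φ).ext_ι,
        ← (productSystem Φ).tr_tr hW (hV.trans h₀'), Category.assoc]
      exact hr ((productSystem Φ).isOver_res W z.base) _
    exact (congrArg (((totalSystem Φ F).tr hW z).base ≫ ·) hk).trans
      ((congrArg (· ≫ k) (totalSystem_tr_base hW z)).trans e)

/-- Write `Y` for the codomain of `p`. The cofibration has a representative `i` and the fibration
one over `Y × U`. Over a small enough `W`, the square lies over `i × W` followed by `Y × W ⟶ Y × U`.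
The structure is extended along `i × W` to the pullback of the fibration to `Y × W`, and in the
quotient this pullback is isomorphic to `p`. -/
lemma isAcyclic_inducedArrow [CategoryWithFibrations C] [CategoryWithCofibrations C]
    [(fibrations C).IsStableUnderBaseChange] [(cofibrations C).RespectsIso]
    (hS : ∀ (U : Φ) {X Y : C} (f : X ⟶ Y), cofibrations C f →
      cofibrations C ((productSystem Φ).ext ((productSystem Φ).ι U X ≫ f)))
    (h : IsStructured.IsAcyclic (totalArrow φ)) :
    IsStructured.IsAcyclic (inducedArrow Φ φ) := by
  rintro ⟨z⟩ p c hc ⟨U', i, hi, hi'⟩ ⟨U, g, hg, hf⟩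
  let e := isoOfExt p U g hg
  change (productSystem Φ).res U' z.base ⟶ p.right.as at i
  obtain ⟨W, hU, hU', d, hd, hdc, hdr⟩ := exists_isCart_right_eq g i (c ≫ e.inv)
    (hc.comp (.of_isIso _)) _ rfl (by
      refine (Category.assoc c.right _ _).trans (Eq.trans ?_ hi)
      exact (congrArg (c.right ≫ ·) (resIso U p.right).inv_hom_id).trans (Category.comp_id _))
  -- The fibration is first pulled back to `Y × W`, since `i × W` is a cofibration while its
  -- composite to `Y × U` need not be one.
  obtain ⟨Q, q, π, hπ, hπr⟩ := exists_isCart (Arrow.mk ((productSystem Φ).ext g))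
    ((productSystem Φ).tr hU p.right.as)
  obtain ⟨c', hc', hcr'⟩ := hπ.exists_lift d
    ((productSystem Φ).ext ((productSystem Φ).tr hU' z.base ≫ i))
    ((congrArg (_ ≫ ·) hπr).trans hdr.symm)
  obtain ⟨y, e', m, hm⟩ := h ((totalSystem Φ F).res W z) (Arrow.mk q) c'
    (hπ.of_comp_eq hd hc') (by
      rw [hcr']
      exact ext_tr_of_ext hS _ i hi')
    ((fibrations C).of_isPullback hπ hf)
  have hπi : IsIso ((arrowProj (productSystem Φ)).map π) := hπ.arrowProj.isIso (by
    change IsIso ((projection (productSystem Φ)).map π.right)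
    rw [hπr]
    exact isIso_projection_map_tr _ _)
  refine ⟨⟨y⟩, (arrowProj (productSystem Φ)).mapIso e' ≪≫
    asIso ((arrowProj (productSystem Φ)).map π) ≪≫ e, homMk W m, ?_⟩
  have key := inducedMap_homMk_comp_eq (x := z) (f := m) (c := e'.hom ≫ π) (d := c ≫ e.inv) (by
    rw [← Category.assoc, hm, hc', hdc])
  rw [Functor.map_comp] at key
  refine Eq.trans ?_ ((Iso.eq_comp_inv e).1 key)
  exact ((congrArg (_ ≫ ·) (Category.assoc _ _ _).symm).trans (Category.assoc _ _ _).symm)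

end Acyclic

/-! ### Smallness of the fibres in the filter quotient -/

section SmallFibres

/-- An isomorphism in the filter quotient is represented by a pullback square from the restriction
`q U` of its domain to some `U`. -/
lemma exists_isCart_of_iso {I : Type t} [Preorder I] {E : Type u'} [Category.{v'} E]
    {R : RestrictionSystem I E} [IsCodirectedOrder I] [Nonempty I] [HasPullbacks E] {p r : Arrow E}
    (q : I → Arrow E) (π : ∀ U, q U ⟶ p) (hπ : ∀ U, IsCart (π U))
    (hq : ∀ U, R.IsOver U (q U).right) (k : ∀ {U W : I}, W ≤ U → ((q W).right ⟶ (q U).right))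
    (hk : ∀ {U W : I} (h : W ≤ U), k h ≫ (π U).right = (π W).right)
    (d : (arrowProj R).obj p ≅ (arrowProj R).obj r) :
    ∃ (U : I) (c : q U ⟶ r), IsCart c ∧
      (arrowProj R).map c = (arrowProj R).map (π U) ≫ d.hom := by
  obtain ⟨V, -, hV⟩ := exists_arrowProj_map_eq d.hom (Classical.arbitrary I)
  obtain ⟨d', hd'⟩ := hV (hq V) (π V)
  obtain ⟨W, hW, h⟩ := exists_isCart_comp (R := R) (c := d') (by
    rw [hd']
    exact (hπ V).arrowProj.comp (.of_isIso _)) V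
  obtain ⟨κ, hκ, -⟩ := (hπ V).exists_lift (π W) (k hW) (hk hW)
  refine ⟨W, κ ≫ d', h (hq W) κ ((hπ V).of_comp_eq (hπ W) hκ), ?_⟩
  rw [Functor.map_comp, hd', ← Category.assoc, ← Functor.map_comp, hκ]

variable {C : Type u} [Category.{v} C] [HasPullbacks C] [HasTerminal C] [HasBinaryProducts C]
  {Φ : Order.PFilter (Subobject (⊤_ C))} {F : LocallyDiscrete Cᵒᵖ ⥤ᵖ Cat.{v, max u v}}
  {φ : F ⟶ codomainPseudo C}

/-- A structure on `p` in the quotient comes from a structure on the restriction `q U` of a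
representative of `p`, for some `U`. So the pairs of an element `U` of the small filter and an index
for the structures on `q U` suffice. -/
lemma hasSmallFibres_inducedArrow [Small.{w} Φ] (hT : IsStructured (totalArrow φ))
    (h : IsStructured.HasSmallFibres.{w} (totalArrow φ)) :
    IsStructured.HasSmallFibres.{w} (inducedArrow Φ φ) := by
  intro p
  obtain ⟨U, -, g, hg⟩ := exists_homMk p.hom (Classical.arbitrary Φ)
  let j := isoOfRep p U g hg
  choose Q q π hπ hπr using fun U : Φ ↦
    exists_isCart (Arrow.mk g) ((productSystem Φ).ι U p.right.as)
  have hi (U : Φ) : IsIso ((arrowProj (productSystem Φ)).map (π U)) := (hπ U).arrowProj.isIso (by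
    change IsIso ((projection (productSystem Φ)).map (π U).right)
    rw [hπr]
    exact isIso_projection_map_ι (R := productSystem Φ) U p.right.as)
  let ρ (U : Φ) := asIso ((arrowProj (productSystem Φ)).map (π U))
  choose ι y e he using fun U : Φ ↦ h (Arrow.mk (q U))
  let e' (U : Φ) (i : ι U) : p ≅ (inducedArrow Φ φ).obj ⟨y U i⟩ :=
    j.symm ≪≫ (ρ U).symm ≪≫ (arrowProj (productSystem Φ)).mapIso (e U i)
  refine ⟨Σ U : Shrink.{w} Φ, ι ((equivShrink Φ).symm U), fun i ↦ ⟨y _ i.2⟩, fun i ↦ e' _ i.2, ?_⟩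
  rintro ⟨z⟩ c
  obtain ⟨W, d, hd, hdc⟩ := exists_isCart_of_iso (R := productSystem Φ) (fun U ↦ Arrow.mk (q U)) π hπ
    (fun U ↦ (productSystem Φ).isOver_res U p.right.as)
    (fun h ↦ (productSystem Φ).tr h p.right.as)
    (fun {U W} h ↦ by
      rw [hπr, hπr]
      exact (productSystem Φ).tr_ι h p.right.as) (j ≪≫ c)
  obtain ⟨z', f, α, hα⟩ := hT.exists_lift d hd
  obtain ⟨i, m, hm⟩ := he W z' α
  -- The map `m` lies over an isomorphism of arrows, and `n` lies over the inverse of that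
  -- isomorphism.
  obtain ⟨n, hn⟩ := hT.exists_fac (𝟙 (y W i)) m ((e W i).inv ≫ α.hom) (by
    rw [Category.assoc, hm, Iso.inv_hom_id, CategoryTheory.Functor.map_id])
  obtain ⟨s, rfl⟩ : ∃ s, (equivShrink Φ).symm s = W := ⟨equivShrink Φ W, by simp⟩
  have key : quotientMap Φ φ (n ≫ f) = (e' _ i).inv ≫ c.hom := by
    have hnd : (totalArrow φ).map (n ≫ f) = (e _ i).inv ≫ d := by
      rw [Functor.map_comp, hn, Category.assoc, hα]
    refine (congrArg (arrowProj (productSystem Φ)).map hnd).trans ?_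
    rw [Functor.map_comp, hdc]
    change _ ≫ _ ≫ j.hom ≫ c.hom = ((_ ≫ _) ≫ j.hom) ≫ c.hom
    simp only [Category.assoc]
    rfl
  obtain ⟨m', hm'⟩ := (isStructured_inducedArrow hT).exists_fac (𝟙 (⟨z⟩ : InducedTotal Φ F))
    ((projection (totalSystem Φ F)).map (n ≫ f)) (c.inv ≫ (e' _ i).hom) (by
      refine (congrArg (_ ≫ ·) ((inducedMap_projection Φ φ (n ≫ f)).trans key)).trans ?_
      refine (Category.assoc _ _ _).trans ?_
      refine (congrArg (c.inv ≫ ·) (Iso.hom_inv_id_assoc _ _)).trans ?_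
      exact (c.inv_hom_id).trans (CategoryTheory.Functor.map_id _ _).symm)
  exact ⟨⟨s, i⟩, m', (Iso.eq_inv_comp c).1 hm'⟩

end SmallFibres

lemma ext_ι_comp_eq {C : Type u} [Category.{v} C] [HasTerminal C] [HasBinaryProducts C]
    {Φ : Order.PFilter (Subobject (⊤_ C))} (U : Φ) {X Y : C} (f : X ⟶ Y) :
    (productSystem Φ).ext ((productSystem Φ).ι U X ≫ f) = prod.map f (𝟙 (U.1 : C)) :=
  (productSystem Φ).hom_ext _ _ (((productSystem Φ).ext_ι _).trans (prod.map_fst _ _).symm)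

end FilterModel
end

theorem proposition3p40 {M : Type u} [Category.{v} M] [ModelCategory M]
    (hM : ∀ ⦃X Y : M⦄ (f : X ⟶ Y), (Over.pullback f).IsLeftAdjoint)
    (Φ : Order.PFilter (Subobject (⊤_ M))) (hΦ : IsModelFilter Φ) [Small.{w} Φ]
    (F : AcyclicFibredStructure.{w} M) :
    ∃ G : AcyclicFibredStructure.{w} (FilterQuotientCategory Φ),
      IsInduced Φ F.toCodomain G.toCodomain := by
  have hT := isStructured_totalArrow F.isGroupoid F.isDiscreteFibration
  have hS (U : Φ) {X Y : M} (f : X ⟶ Y) (hf : cofibrations M f) : cofibrations M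
      ((productSystem Φ).ext ((productSystem Φ).ι U X ≫ f)) := by
    rw [ext_ι_comp_eq]
    exact hΦ.cofibrations_prod U.2 f hf
  exact (isStructured_inducedArrow hT).exists_acyclicFibredStructure
    (fun e f hf ↦ quotientProperty_iso_comp hS e f hf)
    (hasUniversal_inducedArrow hT (hasUniversal_totalArrow F.isGroupoid hT F.isLocallyRepresentable))
    (coversFibrations_inducedArrow (coversFibrations_totalArrow _ F.coversFibrations))
    (isAcyclic_inducedArrow hS (isAcyclic_totalArrow F.coversFibrations F.isGroupoid
      F.isAcyclicFibration))
    (hasSmallFibres_inducedArrow hT (hasSmallFibres_totalArrow _ F.isGroupoid F.isDiscreteFibration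
      F.small_fibre))
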